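/- **Theorem 2.2.** All algorithms are programs of a word RAM with words of $\Theta(\log(n+p+q))$ bits; randomized ones may also draw uniformly random words. Graphs are simple, connected and undirected with $n$ nodes, $m$ edges and integer capacities in $\{1,\dots,U\}$, $U=n^{O(1)}$, and $\tilde O(\cdot)$ hides factors polylogarithmic in $n$; "with high probability" means with probability at least $1-n^{-c}$, for any constant $c$ fixed beforehand (it affects only the hidden constants). $\mathrm{MaxFlow}_G(s,t)$ is the capacity of a minimum $st$-cut of $G$, and a cut separating $s$ from $t$ is a $(1+\varepsilon)$-approximate minimum $st$-cut if its capacity is at most $(1+\varepsilon)\,\mathrm{MaxFlow}_G(s,t)$. Let $\delta=p/q\ge 0$ be rational and let $\varepsilon$ be a real number with $(1+\delta)^2\le 1+\varepsilon$ (for instance $\delta=\varepsilon/3$ if $0<\varepsilon\le 3$ is rational). Suppose there is a deterministic offline $(1+\delta)$-approximate minimum $st$-cut algorithm $A$: given such a graph on $n$ nodes and $m$ edges and two distinct nodes $s,t$, it returns a $(1+\delta)$-approximate minimum $st$-cut in time at most $t_{\mathrm{offline}}=t_{\mathrm{offline}}(n,m)$, where $t_{\mathrm{offline}}(n,m)\ge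 n+m$. Then there are randomized algorithms that, given $G=(V,E,c)$ and $\delta$, making $\tilde O(n)$ calls to $A$, construct with high probability 1. in time $\tilde O(n\cdot t_{\mathrm{offline}})$ a $(1+\varepsilon)$-approximate flow-equivalent tree $T$ of $G$, i.e. a capacitated tree $T$ on $V$ with $\mathrm{MaxFlow}_G(s,t)\le \mathrm{MaxFlow}_T(s,t)\le(1+\varepsilon)\,\mathrm{MaxFlow}_G(s,t)$ for all distinct $s,t\in V$; and 2. in time $\tilde O(n\cdot t_{\mathrm{offline}})$ a data structure $D$ of size $\tilde O(n^2)$ words that stores a set $\mathcal C$ of $\tilde O(n)$ cuts and that, given distinct $s,t\in V$, returns in time $\tilde O(1)$ a pointer to a cut in $\mathcal C$ that is a $(1+\varepsilon)$-approximate minimum $st$-cut of $G$. The programs call $A$ as a subroutine and do not depend on $A$, $\delta$, $\varepsilon$ or $t_{\mathrm{offline}}$; neither do the hidden constants and exponents, which depend only on $c$, on the exponent in the bound on $U$, and on the constant in the word size that $A$ requires. -/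

import Mathlib

/-! ### Capacitated graphs, cuts and flow-equivalent trees -/

/-- A connected simple undirected graph on the node set `Fin n` with `m` edges and positive integer
capacities, given by its list of edges (in any order, each edge in any orientation). -/
structure CapGraph (n m : ℕ) where
  src : Fin m → Fin n
  dst : Fin m → Fin n
  cap : Fin m → ℕ
  cap_pos : ∀ i, 0 < cap i
  no_loop : ∀ i, src i ≠ dst i
  no_parallel : Function.Injective fun i => s(src i, dst i)
  connected : (SimpleGraph.fromEdgeSet (Set.range fun i => s(src i, dst i))).Connected

namespace CapGraph

variable {n m : ℕ}

/-- The underlying simple graph. -/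
def graph (G : CapGraph n m) : SimpleGraph (Fin n) :=
  SimpleGraph.fromEdgeSet (Set.range fun i => s(G.src i, G.dst i))

open Classical in
/-- The capacity of the cut `(S, V ∖ S)`: the total capacity of the edges with exactly one endpoint
in `S`. -/
noncomputable def cutCap (G : CapGraph n m) (S : Set (Fin n)) : ℕ :=
  ∑ i, if (G.src i ∈ S ↔ G.dst i ∈ S) then 0 else G.cap i

/-- The cut `(S, V ∖ S)` separates `s` from `t`. -/
def Separates (S : Set (Fin n)) (s t : Fin n) : Prop := ¬ (s ∈ S ↔ t ∈ S)

/-- `Max-Flow(s, t)`, the capacity of a minimum `st`-cut (for `s ≠ t`). -/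
noncomputable def maxFlow (G : CapGraph n m) (s t : Fin n) : ℕ :=
  sInf {x | ∃ S : Set (Fin n), Separates S s t ∧ G.cutCap S = x}

/-- `(S, V ∖ S)` is a `(1 + δ)`-approximate minimum `st`-cut of `G`. -/
def IsApproxMinCut (G : CapGraph n m) (δ : ℝ) (s t : Fin n) (S : Set (Fin n)) : Prop :=
  Separates S s t ∧ (G.cutCap S : ℝ) ≤ (1 + δ) * G.maxFlow s t

/-- `T` is a `(1 + ε)`-approximate flow-equivalent tree of `G`: a capacitated tree on the nodes of
`G` such that for all `s ≠ t` the minimum `st`-cut value in `T` lies between the one in `G` and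
`1 + ε` times the one in `G`. -/
def IsApproxFlowTree (G : CapGraph n m) (ε : ℝ) {m' : ℕ} (T : CapGraph n m') : Prop :=
  T.graph.IsTree ∧ ∀ s t : Fin n, s ≠ t →
    (G.maxFlow s t : ℝ) ≤ T.maxFlow s t ∧ (T.maxFlow s t : ℝ) ≤ (1 + ε) * G.maxFlow s t

/-- The edge list of `G` as a list of numbers, three per edge. -/
def edgeWords (G : CapGraph n m) : List ℕ :=
  (List.finRange m).flatMap fun i => [(G.src i : ℕ), (G.dst i : ℕ), G.cap i]

/-- The input describing `G` together with an accuracy parameter `p / q`. -/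
def inputWords (G : CapGraph n m) (p q : ℕ) : List ℕ := n :: m :: p :: q :: G.edgeWords

end CapGraph

/-! ### A randomized word RAM with one subroutine -/

namespace WordRAM

/-- The memory: a cell for every address. -/
abbrev Mem := ℕ → ℕ

/-- The memory that holds the list `l` from address `0` on, and zeros behind it. -/
def loadList (l : List ℕ) : Mem := fun i => l.getD i 0

/-- Expressions, over the variables `0, 1, 2, …` and the memory. -/
inductive Expr where
  | const (c : ℕ)
  | var (x : ℕ)
  | load (addr : Expr)
  | add (a b : Expr)
  | sub (a b : Expr)
  | mul (a b : Expr)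
  | div (a b : Expr)
  | lt (a b : Expr)
  | eq (a b : Expr)

/-- Programs. A program text uses only finitely many variables; unbounded storage is in memory. -/
inductive Cmd where
  | skip
  | assign (x : ℕ) (e : Expr)
  | store (addr val : Expr)
  | rand (x : ℕ)
  | call (inAddr inLen outAddr outLen : Expr)
  | seq (c d : Cmd)
  | ite (e : Expr) (c d : Cmd)
  | loop (e : Expr) (c : Cmd)

/-- A machine state: variables, memory, and the random words not used so far. -/
structure State where
  vars : ℕ → ℕ
  mem : Mem
  tape : List ℕ

/-- The value of an expression on a machine with words of `w` bits. Sums and products are reduced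
modulo `2 ^ w`, subtraction is truncated at `0`, comparisons give `1` or `0`. -/
def Expr.eval (w : ℕ) (σ : State) : Expr → ℕ
  | .const c => c % 2 ^ w
  | .var x => σ.vars x
  | .load a => σ.mem (a.eval w σ)
  | .add a b => (a.eval w σ + b.eval w σ) % 2 ^ w
  | .sub a b => a.eval w σ - b.eval w σ
  | .mul a b => (a.eval w σ * b.eval w σ) % 2 ^ w
  | .div a b => a.eval w σ / b.eval w σ
  | .lt a b => if a.eval w σ < b.eval w σ then 1 else 0
  | .eq a b => if a.eval w σ = b.eval w σ then 1 else 0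

/-- The number of unit-cost operations in an expression. -/
def Expr.cost : Expr → ℕ
  | .const _ => 1
  | .var _ => 1
  | .load a => a.cost + 1
  | .add a b => a.cost + b.cost + 1
  | .sub a b => a.cost + b.cost + 1
  | .mul a b => a.cost + b.cost + 1
  | .div a b => a.cost + b.cost + 1
  | .lt a b => a.cost + b.cost + 1
  | .eq a b => a.cost + b.cost + 1

/-- The behaviour of a subroutine: `O M M' t` says that, started on the memory `M`, it stops after
`t` steps with the memory `M'`. -/
abbrev Subroutine := Mem → Mem → ℕ → Prop

/-- `Exec w O c σ σ' t r`: on a machine with `w`-bit words and with the subroutine `O`, the program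
`c` started in the state `σ` stops in the state `σ'`, after `t` steps (those of the subroutine
included) and `r` calls of the subroutine.

A `rand` moves the next random word to a variable; it cannot be executed when the tape is empty.
A `call` copies a block of the memory to a fresh memory, runs the subroutine on it, and copies an
initial block of the resulting memory back; every copied word counts as one step. -/
inductive Exec (w : ℕ) (O : Subroutine) : Cmd → State → State → ℕ → ℕ → Prop
  | skip (σ : State) : Exec w O .skip σ σ 1 0
  | assign (x : ℕ) (e : Expr) (σ : State) :
      Exec w O (.assign x e) σ { σ with vars := Function.update σ.vars x (e.eval w σ) }
        (e.cost + 1) 0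
  | store (a e : Expr) (σ : State) :
      Exec w O (.store a e) σ { σ with mem := Function.update σ.mem (a.eval w σ) (e.eval w σ) }
        (a.cost + e.cost + 1) 0
  | rand (x : ℕ) (σ : State) (b : ℕ) (l : List ℕ) (h : σ.tape = b :: l) :
      Exec w O (.rand x) σ { σ with vars := Function.update σ.vars x b, tape := l } 1 0
  | call (a len a' len' : Expr) (σ : State) (M : Mem) (t : ℕ)
      (h : O (fun i => if i < len.eval w σ then σ.mem (a.eval w σ + i) else 0) M t) :
      Exec w O (.call a len a' len') σ
        { σ with mem := fun i =>
            if a'.eval w σ ≤ i ∧ i < a'.eval w σ + len'.eval w σ then M (i - a'.eval w σ)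
            else σ.mem i }
        (a.cost + len.cost + a'.cost + len'.cost + len.eval w σ + t + len'.eval w σ + 1) 1
  | seq (c d : Cmd) (σ σ' σ'' : State) (t t' r r' : ℕ)
      (hc : Exec w O c σ σ' t r) (hd : Exec w O d σ' σ'' t' r') :
      Exec w O (.seq c d) σ σ'' (t + t') (r + r')
  | ite_true (e : Expr) (c d : Cmd) (σ σ' : State) (t r : ℕ) (he : e.eval w σ ≠ 0)
      (hc : Exec w O c σ σ' t r) : Exec w O (.ite e c d) σ σ' (e.cost + 1 + t) r
  | ite_false (e : Expr) (c d : Cmd) (σ σ' : State) (t r : ℕ) (he : e.eval w σ = 0)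
      (hd : Exec w O d σ σ' t r) : Exec w O (.ite e c d) σ σ' (e.cost + 1 + t) r
  | loop_true (e : Expr) (c : Cmd) (σ σ' σ'' : State) (t t' r r' : ℕ) (he : e.eval w σ ≠ 0)
      (hc : Exec w O c σ σ' t r) (hl : Exec w O (.loop e c) σ' σ'' t' r') :
      Exec w O (.loop e c) σ σ'' (e.cost + 1 + t + t') (r + r')
  | loop_false (e : Expr) (c : Cmd) (σ : State) (he : e.eval w σ = 0) :
      Exec w O (.loop e c) σ σ (e.cost + 1) 0

/-- No subroutine: a `call` cannot be executed. -/
def noSubroutine : Subroutine := fun _ _ _ => False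

/-- The program `A` as a subroutine. It gets no random words and no subroutine of its own, so it is
a deterministic program; its variables are `0` in the beginning. -/
def asSubroutine (w : ℕ) (A : Cmd) : Subroutine := fun M M' t =>
  ∃ σ, Exec w noSubroutine A ⟨fun _ => 0, M, []⟩ σ t 0 ∧ σ.mem = M'

/-- The program `B`, which may call `A`, started on the input `l` with the random words `ρ`, stops
with the memory `M` after `t` steps and `r` calls of `A`. -/
def RunsTo (w : ℕ) (A B : Cmd) (l ρ : List ℕ) (M : Mem) (t r : ℕ) : Prop :=
  ∃ σ, Exec w (asSubroutine w A) B ⟨fun _ => 0, loadList l, ρ⟩ σ t r ∧ σ.mem = M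

/-- The deterministic program `Q`, started on the memory `D` with `a` and `b` in its first two
variables, stops after `t` steps with `j` in its first variable. -/
def QueryRunsTo (w : ℕ) (Q : Cmd) (D : Mem) (a b j t : ℕ) : Prop :=
  ∃ σ, Exec w noSubroutine Q ⟨fun x => if x = 0 then a else if x = 1 then b else 0, D, []⟩ σ t 0 ∧
    σ.vars 0 = j

/-- The probability of an event that depends on `T` independent uniformly random `w`-bit words. -/
noncomputable def prob (w T : ℕ) (good : List ℕ → Prop) : ℝ :=
  ({ρ : Fin T → Fin (2 ^ w) | good (List.ofFn fun i => (ρ i : ℕ))}.ncard : ℝ) / (2 ^ w : ℝ) ^ T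

end WordRAM

open WordRAM

/-- The set of nodes whose indicator vector is stored from address `j` on. -/
def storedSide (n : ℕ) (M : Mem) (j : ℕ) : Set (Fin n) := {v | M (j + v) ≠ 0}

/-- `A` is a deterministic offline `(1 + p/q)`-approximate minimum `st`-cut algorithm with running
time `t` (a function of the numbers of nodes and edges), for graphs with capacities at most `n ^ κ`,
on machines with words of at least `β * log₂ (n + p + q)` bits. The input consists of `s`, `t` and
the graph; the output is the indicator vector of one side of the cut. -/
def IsOfflineMinCutAlg (A : Cmd) (κ β p q : ℕ) (t : ℕ → ℕ → ℕ) : Prop :=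
  ∀ (n m : ℕ) (G : CapGraph n m) (w : ℕ), (∀ i, G.cap i ≤ n ^ κ) → (n + p + q) ^ β ≤ 2 ^ w →
    ∀ x y : Fin n, x ≠ y → ∃ (M : Mem) (time : ℕ),
      asSubroutine w A (loadList ((x : ℕ) :: (y : ℕ) :: G.inputWords p q)) M time ∧
      time ≤ t n m ∧ G.IsApproxMinCut ((p : ℝ) / q) x y (storedSide n M 0)

/-- The memory `M` holds (the edge list of) a `(1 + ε)`-approximate flow-equivalent tree of `G`. -/
def HoldsFlowTree {n m : ℕ} (G : CapGraph n m) (ε : ℝ) (M : Mem) : Prop :=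
  ∃ T : CapGraph n (n - 1), G.IsApproxFlowTree ε T ∧
    ∀ i < T.edgeWords.length, M i = T.edgeWords.getD i 0

/-- The first `L ≤ size` cells of `M` are a data structure that stores a set `𝒞` of at most `cuts`
cuts (identified by the addresses of their indicator vectors), from which the program `Q` finds,
for all nodes `x ≠ y`, within `qtime` steps a pointer to a cut in `𝒞` that is a
`(1 + ε)`-approximate minimum `xy`-cut of `G`. -/
def HoldsCutStructure {n m : ℕ} (G : CapGraph n m) (ε : ℝ) (w : ℕ) (Q : Cmd)
    (size cuts qtime : ℕ) (M : Mem) : Prop :=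
  ∃ (L : ℕ) (𝒞 : Finset ℕ), L ≤ size ∧ 𝒞.card ≤ cuts ∧ (∀ j ∈ 𝒞, j + n ≤ L) ∧
    ∀ x y : Fin n, x ≠ y → ∃ j ∈ 𝒞, ∃ time ≤ qtime,
      QueryRunsTo w Q (fun i => if i < L then M i else 0) x y j time ∧
      G.IsApproxMinCut ε x y (storedSide n M j)

/-! ### Total-correctness reasoning for word RAM programs -/

namespace WordRAM

variable {w : ℕ} {O : Subroutine}

/-! The construction is deterministic, so for `n ≥ 2` both events have probability `1`; for `n = 1`
the required probability is `0`. Write `λ` for minimum cut values and `1 + δ = (p + q) / q`. A cut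
between two nodes leaves any third node on one side, so `λ u x ≥ min (λ u v) (λ v x)`.

A task consists of a range of thresholds `lo`, `hi` and of clusters, given by labels: nodes of one
cluster satisfy `λ > hi`, and any two nodes of the task satisfy `λ ≥ (lo + 1) / (1 + δ)`. It is
refined at the middle threshold `mid`. A partition into parts with representatives gets finer, while
linked classes of clusters get coarser. As long as some node lies in a class different from that of
its representative, `A` is called for this pair. If the cut found has capacity above `mid`, the pair
has `λ ≥ (mid + 1) / (1 + δ)` and the two classes merge (`Refining.merge`). Otherwise the cut splits
the part (`Refining.split`); it separates no cluster, because its capacity is at most `hi`, and it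
is recorded for all pairs of the part that it separates and improves. At the end, nodes of one part
are linked at `mid + 1`, and nodes in different parts have a recorded cut of capacity at most `mid`.
The remaining work is one lower task, with the parts as clusters and thresholds below `mid / (1 +
δ)`, and one upper task per part, with the old clusters and thresholds above `mid`
(`Refining.pending_sub`). Once a range is empty, a recorded value `x ≤ (1 + δ) (hi + 1)` meets `λ ≥
(lo + 1) / (1 + δ)`, so `x ≤ (1 + δ)² λ ≤ (1 + ε) λ` (`Pending.done`).

For the cost, each query either loses a class or gains a part, so `k` clusters cause at most `2 (k -
1)` queries. The quantity `k - 1`, summed over the subtasks, does not exceed its value for the task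
(`Refining.sum_numLab`), and the ranges halve, so there are `O(n log tot)` queries and records,
where `tot` is the total capacity (`weight_subtasks`). Recording a cut takes time proportional to
the number of pairs it separates within the part; this is paid by the number of pairs of nodes in
different clusters, a potential with the same additivity (`Refining.openPairs_split`,
`Refining.sum_numPairs`). Hence the bookkeeping costs `O(n² log tot)` apart from `O(n + m)` per
query.

The matrix of pointers to the best recorded cuts is the data structure. The tree is a maximum
spanning tree of the recorded values. A minimum cut of the tree between two nodes contains a tree
edge at least as heavy as their recorded value (`le_maxFlow_tree`). Conversely, a minimum cut of the
graph is crossed by an edge of the tree path, whose removal gives a tree cut of the weight of that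
edge (`maxFlow_tree_le`). -/

/-- `c` started in `σ` stops, and the final state, the time and the number of calls satisfy `Q`. -/
def Wp (w : ℕ) (O : Subroutine) (c : Cmd) (σ : State) (Q : State → ℕ → ℕ → Prop) : Prop :=
  ∃ σ' t r, Exec w O c σ σ' t r ∧ Q σ' t r

/-- `c` started in `σ` stops within `T` steps and `R` calls in a state that satisfies `P`. -/
def Run (w : ℕ) (O : Subroutine) (c : Cmd) (σ : State) (T R : ℕ) (P : State → Prop) : Prop :=
  Wp w O c σ fun σ' t r => t ≤ T ∧ r ≤ R ∧ P σ'

theorem Wp.mono {c : Cmd} {σ : State} {Q Q' : State → ℕ → ℕ → Prop} (h : Wp w O c σ Q)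
    (hQ : ∀ σ' t r, Q σ' t r → Q' σ' t r) : Wp w O c σ Q' := by
  obtain ⟨σ', t, r, hc, hq⟩ := h
  exact ⟨σ', t, r, hc, hQ _ _ _ hq⟩

theorem Run.mono {c : Cmd} {σ : State} {T R T' R' : ℕ} {P P' : State → Prop}
    (h : Run w O c σ T R P) (hT : T ≤ T') (hR : R ≤ R') (hP : ∀ σ', P σ' → P' σ') :
    Run w O c σ T' R' P' :=
  Wp.mono h fun _ _ _ hq => ⟨hq.1.trans hT, hq.2.1.trans hR, hP _ hq.2.2⟩

theorem Run.wp {c : Cmd} {σ : State} {T R : ℕ} {P : State → Prop} {Q : State → ℕ → ℕ → Prop}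
    (h : Run w O c σ T R P) (hP : ∀ σ' t r, t ≤ T → r ≤ R → P σ' → Q σ' t r) : Wp w O c σ Q :=
  Wp.mono h fun _ _ _ hq => hP _ _ _ hq.1 hq.2.1 hq.2.2

theorem Run.seq {c d : Cmd} {σ : State} {T R T₁ R₁ T₂ R₂ : ℕ} {P P' : State → Prop}
    (hc : Run w O c σ T₁ R₁ P') (hd : ∀ σ', P' σ' → Run w O d σ' T₂ R₂ P)
    (hT : T₁ + T₂ ≤ T) (hR : R₁ + R₂ ≤ R) : Run w O (.seq c d) σ T R P := by
  obtain ⟨σ₁, t, r, hc, ht, hr, hP⟩ := hc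
  obtain ⟨σ₂, t', r', hd, ht', hr', hP'⟩ := hd _ hP
  exact ⟨σ₂, _, _, Exec.seq _ _ _ _ _ _ _ _ _ hc hd, by omega, by omega, hP'⟩

theorem wp_skip {σ : State} {Q : State → ℕ → ℕ → Prop} :
    Wp w O .skip σ Q ↔ Q σ 1 0 := by
  constructor
  · rintro ⟨_, _, _, h, hq⟩; cases h; exact hq
  · exact fun h => ⟨_, _, _, Exec.skip _, h⟩

theorem wp_assign {x : ℕ} {e : Expr} {σ : State} {Q : State → ℕ → ℕ → Prop} :
    Wp w O (.assign x e) σ Q ↔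
      Q ⟨Function.update σ.vars x (e.eval w σ), σ.mem, σ.tape⟩ (e.cost + 1) 0 := by
  constructor
  · rintro ⟨_, _, _, h, hq⟩; cases h; exact hq
  · exact fun h => ⟨_, _, _, Exec.assign _ _ _, h⟩

theorem wp_store {a e : Expr} {σ : State} {Q : State → ℕ → ℕ → Prop} :
    Wp w O (.store a e) σ Q ↔
      Q ⟨σ.vars, Function.update σ.mem (a.eval w σ) (e.eval w σ), σ.tape⟩
        (a.cost + e.cost + 1) 0 := by
  constructor
  · rintro ⟨_, _, _, h, hq⟩; cases h; exact hq
  · exact fun h => ⟨_, _, _, Exec.store _ _ _, h⟩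

theorem wp_seq {c d : Cmd} {σ : State} {Q : State → ℕ → ℕ → Prop} :
    Wp w O (.seq c d) σ Q ↔
      Wp w O c σ fun σ' t r => Wp w O d σ' fun σ'' t' r' => Q σ'' (t + t') (r + r') := by
  constructor
  · rintro ⟨_, _, _, h, hq⟩
    cases h with
    | seq _ _ _ _ _ _ _ _ _ hc hd => exact ⟨_, _, _, hc, _, _, _, hd, hq⟩
  · rintro ⟨_, _, _, hc, _, _, _, hd, hq⟩
    exact ⟨_, _, _, Exec.seq _ _ _ _ _ _ _ _ _ hc hd, hq⟩

theorem wp_ite {e : Expr} {c d : Cmd} {σ : State} {Q : State → ℕ → ℕ → Prop} :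
    Wp w O (.ite e c d) σ Q ↔
      (e.eval w σ ≠ 0 → Wp w O c σ fun σ' t r => Q σ' (e.cost + 1 + t) r) ∧
      (e.eval w σ = 0 → Wp w O d σ fun σ' t r => Q σ' (e.cost + 1 + t) r) := by
  constructor
  · rintro ⟨_, _, _, h, hq⟩
    cases h with
    | ite_true _ _ _ _ _ _ _ he hc => exact ⟨fun _ => ⟨_, _, _, hc, hq⟩, fun h => absurd h he⟩
    | ite_false _ _ _ _ _ _ _ he hc => exact ⟨fun h => absurd he h, fun _ => ⟨_, _, _, hc, hq⟩⟩
  · rintro ⟨h1, h2⟩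
    by_cases he : e.eval w σ = 0
    · obtain ⟨_, _, _, hc, hq⟩ := h2 he
      exact ⟨_, _, _, Exec.ite_false _ _ _ _ _ _ _ he hc, hq⟩
    · obtain ⟨_, _, _, hc, hq⟩ := h1 he
      exact ⟨_, _, _, Exec.ite_true _ _ _ _ _ _ _ he hc, hq⟩

/-- Only one direction, unlike the other rules: the subroutine is a relation, and the run of it has
to be supplied. -/
theorem wp_call {a len a' len' : Expr} {σ : State} {M : Mem} {t : ℕ}
    {Q : State → ℕ → ℕ → Prop}
    (h : O (fun i => if i < len.eval w σ then σ.mem (a.eval w σ + i) else 0) M t)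
    (hQ : Q ⟨σ.vars, fun i =>
            if a'.eval w σ ≤ i ∧ i < a'.eval w σ + len'.eval w σ then M (i - a'.eval w σ)
            else σ.mem i, σ.tape⟩
        (a.cost + len.cost + a'.cost + len'.cost + len.eval w σ + t + len'.eval w σ + 1) 1) :
    Wp w O (.call a len a' len') σ Q :=
  ⟨_, _, _, Exec.call _ _ _ _ _ _ _ h, hQ⟩

/-- Loop rule: the invariant `I` carries time and call credits. -/
theorem Run.loop {e : Expr} {c : Cmd} {P : State → Prop} (I : State → ℕ → ℕ → Prop)
    (h : ∀ σ T R, I σ T R →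
      (e.eval w σ = 0 ∧ e.cost + 1 ≤ T ∧ P σ) ∨
      (e.eval w σ ≠ 0 ∧ ∃ T₁ R₁, Run w O c σ T₁ R₁ fun σ' =>
        ∃ T' R', I σ' T' R' ∧ e.cost + 1 + T₁ + T' ≤ T ∧ R₁ + R' ≤ R))
    {σ : State} {T R : ℕ} (hI : I σ T R) : Run w O (.loop e c) σ T R P := by
  -- Each round spends at least one unit of the time credit on the test, so the credit itself proves
  -- termination.
  induction T using Nat.strong_induction_on generalizing σ R with
  | _ T ih =>
    rcases h σ T R hI with ⟨he, hT, hP⟩ | ⟨he, T₁, R₁, σ', t, r, hc, ht, hr, T', R', hI', hT, hR⟩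
    · exact ⟨σ, _, _, Exec.loop_false _ _ _ he, hT, Nat.zero_le _, hP⟩
    · obtain ⟨σ'', t', r', hc', ht', hr', hP⟩ := ih T' (by omega) hI'
      exact ⟨σ'', _, _, Exec.loop_true _ _ _ _ _ _ _ _ _ he hc hc', by omega, by omega, hP⟩

/-- `for i = 0, …, N - 1 do c`. -/
def Cmd.for (i : ℕ) (N : Expr) (c : Cmd) : Cmd :=
  .seq (.assign i (.const 0))
    (.loop (.lt (.var i) N) (.seq c (.assign i (.add (.var i) (.const 1)))))

/-- Rule for counting loops; `B k` bounds the time of round `k`. -/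
theorem Run.for {i : ℕ} {N : Expr} {c : Cmd} {σ : State} {cnt : ℕ} {T : ℕ}
    {P : State → Prop} (I : ℕ → State → Prop) (B : ℕ → ℕ)
    (hcnt : cnt < 2 ^ w)
    (h0 : I 0 ⟨Function.update σ.vars i 0, σ.mem, σ.tape⟩)
    (hN : ∀ k ≤ cnt, ∀ σ', I k σ' → N.eval w σ' = cnt ∧ σ'.vars i = k)
    (hstep : ∀ k < cnt, ∀ σ', I k σ' → Run w O c σ' (B k) 0 fun σ'' =>
      σ''.vars i = k ∧ I (k + 1) ⟨Function.update σ''.vars i (k + 1), σ''.mem, σ''.tape⟩)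
    (hT : ∑ k ∈ Finset.range cnt, B k + (N.cost + 7) * (cnt + 1) ≤ T)
    (hP : ∀ σ', I cnt σ' → P σ') :
    Run w O (.for i N c) σ T 0 P := by
  have hw1 : 1 ≤ 2 ^ w := Nat.one_le_two_pow
  -- A round costs `N.cost + 3` for the test and `4` for the increment on top of `B k`; the failing
  -- test at the end adds the last `N.cost + 3`.
  have key : Run w O (.loop (.lt (.var i) N) (.seq c (.assign i (.add (.var i) (.const 1)))))
      ⟨Function.update σ.vars i 0, σ.mem, σ.tape⟩
      (∑ k ∈ Finset.range cnt, B k + (N.cost + 7) * cnt + N.cost + 3) 0 P := by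
    refine Run.loop (fun σ' T R => ∃ k ≤ cnt, I k σ' ∧
      T = ∑ j ∈ Finset.Ico k cnt, B j + (N.cost + 7) * (cnt - k) + N.cost + 3) ?_
      ⟨0, Nat.zero_le _, h0, by simp⟩
    rintro σ' T R ⟨k, hk, hI, rfl⟩
    obtain ⟨hNe, hi⟩ := hN k hk σ' hI
    rcases hk.eq_or_lt with rfl | hk
    · left
      refine ⟨by simp [Expr.eval, hNe, hi], ?_, hP _ hI⟩
      simp [Expr.cost]; omega
    · right
      refine ⟨by simp [Expr.eval, hNe, hi, hk], B k + 4, 0, ?_⟩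
      refine Run.seq (hstep k hk σ' hI) (T₂ := 4) (R₂ := 0) ?_ le_rfl le_rfl
      rintro σ'' ⟨hi', hI'⟩
      refine wp_assign.2 ⟨by simp [Expr.cost], le_rfl, _, 0, ⟨k + 1, hk, ?_, rfl⟩, ?_, by simp⟩
      · have h2 : 1 < 2 ^ w := by
          by_contra hc
          omega
        have : (Expr.add (.var i) (.const 1)).eval w σ'' = k + 1 := by
          simp only [Expr.eval, hi']
          rw [Nat.mod_eq_of_lt h2, Nat.mod_eq_of_lt (by omega)]
        rw [this]; exact hI'
      · rw [← Finset.sum_Ioo_add_eq_sum_Ico hk, show cnt - k = (cnt - (k + 1)) + 1 by omega]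
        have : Finset.Ioo k cnt = Finset.Ico (k + 1) cnt := by ext; simp
        rw [this]
        simp only [Expr.cost]
        ring_nf; omega
  refine Run.seq (T₁ := 2) (R₁ := 0) (P' := fun σ' =>
    σ' = ⟨Function.update σ.vars i 0, σ.mem, σ.tape⟩)
    (T₂ := ∑ k ∈ Finset.range cnt, B k + (N.cost + 7) * cnt + N.cost + 3) (R₂ := 0)
    ?_ ?_ ?_ le_rfl
  rotate_left
  · rintro _ rfl; exact key
  · refine le_trans ?_ hT; ring_nf; omega
  · refine wp_assign.2 ⟨by simp [Expr.cost], le_rfl, by simp [Expr.eval]⟩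

/-! ### Filling arrays, summation, and branch-free selection -/

/-- `μ` with the block of length `n` from `b` on replaced by `f 0, …, f (n - 1)`. -/
def writeArr (μ : Mem) (b n : ℕ) (f : ℕ → ℕ) : Mem :=
  fun a => if b ≤ a ∧ a < b + n then f (a - b) else μ a

theorem writeArr_zero (μ : Mem) (b : ℕ) (f : ℕ → ℕ) : writeArr μ b 0 f = μ := by
  funext a; simp only [writeArr]; rw [if_neg (by omega)]

theorem writeArr_succ (μ : Mem) (b k : ℕ) (f : ℕ → ℕ) :
    Function.update (writeArr μ b k f) (b + k) (f k) = writeArr μ b (k + 1) f := by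
  funext a
  by_cases h : a = b + k
  · subst h; simp [writeArr]
  · rw [Function.update_of_ne h]
    simp only [writeArr]
    by_cases h2 : b ≤ a ∧ a < b + k
    · rw [if_pos h2, if_pos (by omega)]
    · rw [if_neg h2, if_neg (by omega)]

theorem writeArr_at {μ : Mem} {b n k : ℕ} {f : ℕ → ℕ} (h : k < n) :
    writeArr μ b n f (b + k) = f k := by
  simp [writeArr, h]

theorem writeArr_of_lt {μ : Mem} {b n a : ℕ} {f : ℕ → ℕ} (h : a < b) :
    writeArr μ b n f a = μ a := by
  simp only [writeArr]; rw [if_neg (by omega)]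

theorem writeArr_of_ge {μ : Mem} {b n a : ℕ} {f : ℕ → ℕ} (h : b + n ≤ a) :
    writeArr μ b n f a = μ a := by
  simp only [writeArr]; rw [if_neg (by omega)]

/-- `for i = 0, …, N - 1 do memory[b + i] := e`. -/
def Cmd.fill (i : ℕ) (b N e : Expr) : Cmd := .for i N (.store (.add b (.var i)) e)

/-- Hypothesis `he` evaluates `e` on memory whose first `k` cells are already overwritten. This
admits in-place updates that read the cell about to be written, as in `merge_spec`. -/
theorem Run.fill {i : ℕ} {b N e : Expr} {V : ℕ → ℕ} {μ : Mem} {τ : List ℕ} {base cnt T : ℕ}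
    {P : State → Prop} (f : ℕ → ℕ) (hcnt : base + cnt < 2 ^ w)
    (hb : ∀ k M, b.eval w ⟨Function.update V i k, M, τ⟩ = base)
    (hN : ∀ k M, N.eval w ⟨Function.update V i k, M, τ⟩ = cnt)
    (he : ∀ k < cnt, e.eval w ⟨Function.update V i k, writeArr μ base k f, τ⟩ = f k)
    (hT : (N.cost + b.cost + e.cost + 10) * (cnt + 1) ≤ T)
    (hP : P ⟨Function.update V i cnt, writeArr μ base cnt f, τ⟩) :
    Run w O (.fill i b N e) ⟨V, μ, τ⟩ T 0 P := by
  refine Run.for (fun k σ => σ = ⟨Function.update V i k, writeArr μ base k f, τ⟩)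
    (fun _ => b.cost + e.cost + 3) (by omega) (by simp [writeArr_zero]) ?_ ?_ ?_ ?_ (cnt := cnt)
  · rintro k hk _ rfl
    exact ⟨hN _ _, by simp⟩
  · rintro k hk _ rfl
    refine wp_store.2 ⟨by simp [Expr.cost]; omega, le_rfl, by simp, ?_⟩
    have h1 : (Expr.add b (.var i)).eval w ⟨Function.update V i k, writeArr μ base k f, τ⟩
        = base + k := by
      simp only [Expr.eval, hb, Function.update_self]
      exact Nat.mod_eq_of_lt (by omega)
    simp only [h1, he k hk, writeArr_succ, Function.update_idem]
  · refine le_trans ?_ hT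
    simp only [Finset.sum_const, Finset.card_range, smul_eq_mul]
    ring_nf; omega
  · rintro _ rfl; exact hP

/-- `x := ∑ i < N, e`. -/
def Cmd.sum (i x : ℕ) (N e : Expr) : Cmd :=
  .seq (.assign x (.const 0)) (.for i N (.assign x (.add (.var x) e)))

theorem Run.sum {i x : ℕ} {N e : Expr} {V : ℕ → ℕ} {μ : Mem} {τ : List ℕ} {cnt T : ℕ}
    {P : State → Prop} (f : ℕ → ℕ) (hix : i ≠ x) (hcnt : cnt < 2 ^ w)
    (hsum : ∑ k ∈ Finset.range cnt, f k < 2 ^ w)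
    (hN : ∀ s k, N.eval w ⟨Function.update (Function.update V x s) i k, μ, τ⟩ = cnt)
    (he : ∀ s, ∀ k < cnt,
      e.eval w ⟨Function.update (Function.update V x s) i k, μ, τ⟩ = f k)
    (hT : (N.cost + e.cost + 10) * (cnt + 1) + 3 ≤ T)
    (hP : P ⟨Function.update (Function.update V x (∑ k ∈ Finset.range cnt, f k)) i cnt, μ, τ⟩) :
    Run w O (.sum i x N e) ⟨V, μ, τ⟩ T 0 P := by
  refine Run.seq (T₁ := 2) (R₁ := 0) (R₂ := 0) (P' := fun σ' =>
    σ' = ⟨Function.update V x 0, μ, τ⟩) ?_ ?_ (T₂ := (N.cost + e.cost + 10) * (cnt + 1))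
    (by omega) le_rfl
  · exact wp_assign.2 ⟨by simp [Expr.cost], le_rfl, by simp [Expr.eval]⟩
  rintro _ rfl
  refine Run.for (fun k σ => σ = ⟨Function.update (Function.update V x
      (∑ j ∈ Finset.range k, f j)) i k, μ, τ⟩)
    (fun _ => e.cost + 3) hcnt (by simp) ?_ ?_ ?_ ?_ (cnt := cnt)
  · rintro k hk _ rfl
    exact ⟨hN _ _, by simp⟩
  · rintro k hk _ rfl
    refine wp_assign.2 ⟨by simp [Expr.cost]; omega, le_rfl, ?_, ?_⟩
    · simp [Function.update_of_ne hix]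
    have h1 : (Expr.add (.var x) e).eval w ⟨Function.update (Function.update V x
        (∑ j ∈ Finset.range k, f j)) i k, μ, τ⟩ = ∑ j ∈ Finset.range (k + 1), f j := by
      simp only [Expr.eval, he _ k hk, Function.update_of_ne hix.symm, Function.update_self]
      rw [Finset.sum_range_succ]
      refine Nat.mod_eq_of_lt (lt_of_le_of_lt ?_ hsum)
      rw [← Finset.sum_range_succ]
      exact Finset.sum_le_sum_of_subset (by
        intro j hj; simp only [Finset.mem_range] at *; omega)
    rw [h1]
    refine congrArg (fun z => State.mk z μ τ) ?_
    funext y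
    simp only [Function.update_apply]
    split_ifs <;> simp_all
  · simp only [Finset.sum_const, Finset.card_range, smul_eq_mul]
    ring_nf; omega
  · rintro _ rfl; exact hP

/-- The indicator of `a ≠ b`. -/
def Expr.ne (a b : Expr) : Expr := .eq (.eq a b) (.const 0)

/-- `a` if `c = 1`, `b` if `c = 0`. -/
def Expr.sel (c a b : Expr) : Expr := .add (.mul c a) (.mul (.sub (.const 1) c) b)

theorem Expr.eval_ne {a b : Expr} {σ : State} :
    (Expr.ne a b).eval w σ = if a.eval w σ ≠ b.eval w σ then 1 else 0 := by
  simp only [Expr.ne, Expr.eval, Nat.zero_mod]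
  split_ifs <;> simp_all

/-- The operand that is not selected is multiplied by `0`, so only the selected one has to fit into
a word. -/
theorem Expr.eval_sel {c a b : Expr} {σ : State} {p : Prop} [Decidable p] (hw : 1 < 2 ^ w)
    (hc : c.eval w σ = if p then 1 else 0)
    (ha : p → a.eval w σ < 2 ^ w) (hb : ¬p → b.eval w σ < 2 ^ w) :
    (Expr.sel c a b).eval w σ = if p then a.eval w σ else b.eval w σ := by
  simp only [Expr.sel, Expr.eval, hc, Nat.mod_eq_of_lt hw]
  split_ifs with h
  · simp [Nat.mod_eq_of_lt (ha h)]
  · simp [Nat.mod_eq_of_lt (hb h)]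

end WordRAM

/-! ### The combinatorics of threshold refinement -/

/-- Minimum cut values `lam` on the nodes `0, …, n - 1`, all at most `tot`, and an accuracy
`p / q`. -/
structure Net where
  n : ℕ
  tot : ℕ
  p : ℕ
  q : ℕ
  lam : ℕ → ℕ → ℕ
  q_pos : 0 < q
  lam_le : ∀ {u v}, u < n → v < n → u ≠ v → lam u v ≤ tot
  lam_pos : ∀ {u v}, u < n → v < n → u ≠ v → 0 < lam u v
  lam_symm : ∀ u v, lam u v = lam v u
  lam_ultra : ∀ {u v x}, u < n → v < n → x < n → u ≠ v → v ≠ x → u ≠ x →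
    lam u v ≤ lam u x ∨ lam v x ≤ lam u x

/-- A task: refine the clusters given by the nonzero labels `lab`, with thresholds between `lo`
and `hi`. Nodes with label `0` do not belong to the task. -/
structure RefTask where
  lo : ℕ
  hi : ℕ
  lab : ℕ → ℕ

namespace Net

open Finset

variable (N : Net)

/-- The nodes `u` and `v` are known to be at least `y / (1 + p / q)`-connected. -/
def Linked (y u v : ℕ) : Prop := u ≠ v → y ≤ N.tot ∧ y * N.q ≤ (N.p + N.q) * N.lam u v

variable {N}

theorem Linked.symm {y u v : ℕ} (h : N.Linked y u v) : N.Linked y v u := by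
  intro huv; rw [N.lam_symm]; exact h huv.symm

/-- The ultrametric inequality makes this transitive with no loss. Otherwise every merge along a
chain would cost another factor `1 + p / q`. -/
theorem Linked.trans {y u v x : ℕ} (hu : u < N.n) (hv : v < N.n) (hx : x < N.n)
    (h : N.Linked y u v) (h' : N.Linked y v x) : N.Linked y u x := by
  intro hux
  by_cases huv : u = v
  · subst huv; exact h' hux
  by_cases hvx : v = x
  · subst hvx; exact h hux
  refine ⟨(h huv).1, ?_⟩
  rcases N.lam_ultra hu hv hx huv hvx hux with h1 | h1
  · exact (h huv).2.trans (Nat.mul_le_mul_left _ h1)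
  · exact (h' hvx).2.trans (Nat.mul_le_mul_left _ h1)

variable (N)

/-- Nodes with equal labels are more than `hi`-connected, all nodes of the task are linked at
`lo + 1`. -/
structure TaskOK (τ : RefTask) : Prop where
  hi_le : τ.hi ≤ N.tot
  lab_lam : ∀ {u v}, u < N.n → v < N.n → u ≠ v → τ.lab u ≠ 0 → τ.lab u = τ.lab v →
    τ.hi < N.lam u v
  linked : ∀ {u v}, u < N.n → v < N.n → τ.lab u ≠ 0 → τ.lab v ≠ 0 → N.Linked (τ.lo + 1) u v

/-- The value `x` is good enough for the pair `u`, `v`. -/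
def Done (x u v : ℕ) : Prop :=
  x ≤ N.tot ∧ x * N.q ^ 2 ≤ (N.p + N.q) ^ 2 * N.lam u v

/-- The pair `u`, `v`, with current value `x`, is left to the task `τ`. -/
def Pending (τ : RefTask) (x u v : ℕ) : Prop :=
  N.TaskOK τ ∧ τ.lab u ≠ 0 ∧ τ.lab v ≠ 0 ∧ τ.lab u ≠ τ.lab v ∧
    (τ.hi = N.tot ∨ (x ≤ N.tot ∧ x * N.q ≤ (N.p + N.q) * (τ.hi + 1)))

variable {N}

theorem Pending.mono {τ : RefTask} {x y u v : ℕ} (h : N.Pending τ x u v) (hy : y ≤ x) :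
    N.Pending τ y u v := by
  obtain ⟨h1, h2, h3, h4, h5⟩ := h
  refine ⟨h1, h2, h3, h4, h5.imp_right fun h => ⟨hy.trans h.1, ?_⟩⟩
  exact (Nat.mul_le_mul_right _ hy).trans h.2

theorem Done.mono {x y u v : ℕ} (h : N.Done x u v) (hy : y ≤ x) : N.Done y u v :=
  ⟨hy.trans h.1, (Nat.mul_le_mul_right _ hy).trans h.2⟩

/-- In a nonpositive range, `x ≤ (1 + δ) (hi + 1) ≤ (1 + δ) (lo + 1) ≤ (1 + δ)² λ`; this is the only
source of the square. The alternative `hi = tot`, where nothing is known about `x`, cannot occur,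
because linkedness forces `lo + 1 ≤ tot`. -/
theorem Pending.done {τ : RefTask} {x u v : ℕ} (h : N.Pending τ x u v) (hu : u < N.n) (hv : v < N.n)
    (hle : τ.hi ≤ τ.lo) : N.Done x u v := by
  obtain ⟨h1, h2, h3, h4, h5⟩ := h
  have huv : u ≠ v := fun h => h4 (by rw [h])
  obtain ⟨h6, h7⟩ := h1.linked hu hv h2 h3 huv
  rcases h5 with h5 | ⟨h5, h8⟩
  · omega
  refine ⟨h5, ?_⟩
  calc x * N.q ^ 2 = (x * N.q) * N.q := by ring
    _ ≤ ((N.p + N.q) * (τ.hi + 1)) * N.q := Nat.mul_le_mul_right _ h8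
    _ ≤ ((N.p + N.q) * (τ.lo + 1)) * N.q := by gcongr
    _ = (N.p + N.q) * ((τ.lo + 1) * N.q) := by ring
    _ ≤ (N.p + N.q) * ((N.p + N.q) * N.lam u v) := Nat.mul_le_mul_left _ h7
    _ = _ := by ring

/-- The state of the refinement of the task `τ` at the threshold `mid`: `mg` are labels of linked
classes, `part` maps each node to the representative of its part, `val` are the capacities of the
best cuts found. -/
structure Refining (N : Net) (τ : RefTask) (mid : ℕ) (mg part : ℕ → ℕ) (val : ℕ → ℕ → ℕ) : Prop where
  mg_zero : ∀ {v}, v < N.n → (mg v = 0 ↔ τ.lab v = 0)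
  mg_lab : ∀ {u v}, u < N.n → v < N.n → τ.lab u = τ.lab v → mg u = mg v
  mg_linked : ∀ {u v}, u < N.n → v < N.n → mg u ≠ 0 → mg u = mg v → N.Linked (mid + 1) u v
  part_lt : ∀ {v}, v < N.n → part v < N.n
  part_part : ∀ {v}, v < N.n → part (part v) = part v
  part_absent : ∀ {v}, v < N.n → τ.lab v = 0 → part v = v
  part_present : ∀ {v}, v < N.n → τ.lab v ≠ 0 → τ.lab (part v) ≠ 0
  part_lab : ∀ {u v}, u < N.n → v < N.n → τ.lab u ≠ 0 → τ.lab u = τ.lab v → part u = part v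
  val_le : ∀ {u v}, u < N.n → v < N.n → τ.lab u ≠ 0 → τ.lab v ≠ 0 → part u ≠ part v →
    val u v ≤ mid

/-- At the start the classes are the clusters, which are linked because `λ > hi ≥ mid`, and the
whole task is one part, so nothing is demanded of `val`. Nodes outside the task represent
themselves. -/
theorem Refining.init {τ : RefTask} (hτ : N.TaskOK τ) {mid r : ℕ} (hmid : mid ≤ τ.hi)
    (hr : r < N.n) (hr0 : (∃ v < N.n, τ.lab v ≠ 0) → τ.lab r ≠ 0) (val : ℕ → ℕ → ℕ) :
    Refining N τ mid τ.lab (fun v => if τ.lab v = 0 then v else r) val where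
  mg_zero _ := Iff.rfl
  mg_lab _ _ h := h
  mg_linked {u v} hu hv h0 h huv := by
    have h1 := hτ.lab_lam hu hv huv h0 h
    refine ⟨?_, ?_⟩
    · have := N.lam_le hu hv huv; omega
    · calc (mid + 1) * N.q ≤ N.lam u v * (N.p + N.q) :=
          Nat.mul_le_mul (by omega) (by omega)
        _ = _ := by ring
  part_lt hv := by split_ifs <;> assumption
  part_part {v} hv := by
    by_cases h : τ.lab v = 0
    · simp [h]
    · simp [h]
  part_absent _ h := by simp [h]
  part_present {v} hv h := by simpa [h] using hr0 ⟨v, hv, h⟩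
  part_lab _ _ h h' := by rw [if_neg h, if_neg (h' ▸ h)]
  val_le _ _ h h' h'' := absurd (by rw [if_neg h, if_neg h']) h''

theorem Refining.present_of_ne {τ : RefTask} {mid : ℕ} {mg part : ℕ → ℕ} {val : ℕ → ℕ → ℕ}
    (h : Refining N τ mid mg part val) {v : ℕ} (hv : v < N.n) (hne : mg v ≠ mg (part v)) :
    τ.lab v ≠ 0 := fun h0 => hne (by rw [h.part_absent hv h0])

/-- An approximate cut of capacity `c > mid` certifies `λ ≥ c / (1 + δ) ≥ (mid + 1) / (1 + δ)` for
`v` and its representative. Transitivity extends this link to the union of the two classes. -/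
theorem Refining.merge {τ : RefTask} {mid : ℕ} {mg part : ℕ → ℕ} {val : ℕ → ℕ → ℕ}
    (h : Refining N τ mid mg part val) {v c : ℕ} (hv : v < N.n) (hne : mg v ≠ mg (part v))
    (hc : mid < c) (hct : c ≤ N.tot) (hcA : N.q * c ≤ (N.p + N.q) * N.lam (part v) v) :
    Refining N τ mid (fun x => if mg x = mg v then mg (part v) else mg x) part val where
  mg_zero {x} hx := by
    have hp := h.present_of_ne hv hne
    have hp' := h.part_present hv hp
    by_cases hxv : mg x = mg v
    · simp only [hxv, if_true]
      rw [h.mg_zero (h.part_lt hv), ← h.mg_zero hx, hxv, h.mg_zero hv]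
      tauto
    · simp only [hxv, if_false]; exact h.mg_zero hx
  mg_lab hu hx hl := by simp only [h.mg_lab hu hx hl]
  mg_linked {u x} hu hx h0 he := by
    have hr := h.part_lt hv
    have hp := h.present_of_ne hv hne
    have hp' := h.part_present hv hp
    have hlink : N.Linked (mid + 1) (part v) v := fun _ => ⟨by omega, by
      calc (mid + 1) * N.q ≤ c * N.q := Nat.mul_le_mul_right _ hc
        _ = N.q * c := by ring
        _ ≤ _ := hcA⟩
    have hv0 : mg v ≠ 0 := fun h' => hp ((h.mg_zero hv).1 h')
    have hr0 : mg (part v) ≠ 0 := fun h' => hp' ((h.mg_zero hr).1 h')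
    by_cases hu1 : mg u = mg v <;> by_cases hx1 : mg x = mg v <;>
      simp only [hu1, hx1, if_true, if_false] at he h0
    · exact h.mg_linked hu hx (hu1 ▸ hv0) (hu1.trans hx1.symm)
    · exact ((h.mg_linked hu hv (hu1 ▸ hv0) hu1).trans hu hv hr hlink.symm).trans hu hr hx
        (h.mg_linked hr hx hr0 he)
    · exact ((h.mg_linked hu hr h0 he).trans hu hr hv hlink).trans hu hv hx
        (h.mg_linked hv hx hv0 hx1.symm)
    · exact h.mg_linked hu hx h0 he
  part_lt := h.part_lt
  part_part := h.part_part
  part_absent := h.part_absent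
  part_present := h.part_present
  part_lab := h.part_lab
  val_le := h.val_le

/-- `u` and `x` are in the part of `r`, on different sides of the cut `S`. -/
def Crossing (part : ℕ → ℕ) (r : ℕ) (S : ℕ → Prop) (u x : ℕ) : Prop :=
  part u = r ∧ part x = r ∧ ¬ (S u ↔ S x)

open Classical in
/-- The parts after splitting the part of `r` with the cut `S`; `v` represents the side without
`r`. -/
noncomputable def splitPart (part : ℕ → ℕ) (r v : ℕ) (S : ℕ → Prop) : ℕ → ℕ :=
  fun x => if part x = r ∧ ¬ (S x ↔ S r) then v else part x

theorem splitPart_eq_self {part : ℕ → ℕ} {r v : ℕ} {S : ℕ → Prop} {x : ℕ}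
    (h : ¬ (part x = r ∧ ¬ (S x ↔ S r))) : splitPart part r v S x = part x := if_neg h

theorem splitPart_eq {part : ℕ → ℕ} {r v : ℕ} {S : ℕ → Prop} {x : ℕ}
    (h : part x = r) (h' : ¬ (S x ↔ S r)) : splitPart part r v S x = v := if_pos ⟨h, h'⟩

theorem splitPart_congr {part : ℕ → ℕ} {r v : ℕ} {S : ℕ → Prop} {x y : ℕ}
    (h : part x = part y) (h' : S x ↔ S y) : splitPart part r v S x = splitPart part r v S y := by
  by_cases hx : part x = r ∧ ¬ (S x ↔ S r)
  · rw [splitPart_eq hx.1 hx.2, splitPart_eq (h ▸ hx.1) (by rw [← h']; exact hx.2)]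
  · rw [splitPart_eq_self hx, splitPart_eq_self (by rwa [h, h'] at hx), h]

/-! ### Splitting a part along a light cut -/

section Split

variable {τ : RefTask} {mid : ℕ} {mg part : ℕ → ℕ} {val val' : ℕ → ℕ → ℕ}
  {v c : ℕ} {S : ℕ → Prop}

/-- A cut of capacity at most `mid ≤ hi` cannot separate nodes that are more than `hi`-connected, so
clusters stay whole. -/
theorem Refining.side_of_lab (hτ : N.TaskOK τ) (hmid : mid ≤ τ.hi) (hc : c ≤ mid)
    (hS : ∀ {a b}, a < N.n → b < N.n → ¬ (S a ↔ S b) → N.lam a b ≤ c)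
    {a b : ℕ} (ha : a < N.n) (hb : b < N.n) (h0 : τ.lab a ≠ 0) (hab : τ.lab a = τ.lab b) :
    S a ↔ S b := by
  by_contra hne
  have h1 := hS ha hb hne
  have h2 := hτ.lab_lam ha hb (fun h => hne (by rw [h])) h0 hab
  omega

/-- The only pairs separated for the first time are those crossing the cut inside the part of `v`,
and they receive a value of at most `c ≤ mid`; earlier separated pairs keep their bound. The
representative stays on its side and `v` represents the other one. -/
theorem Refining.split (h : Refining N τ mid mg part val) (hτ : N.TaskOK τ) (hmid : mid ≤ τ.hi)
    (hv : v < N.n) (hne : mg v ≠ mg (part v)) (hc : c ≤ mid)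
    (hS : ∀ {a b}, a < N.n → b < N.n → ¬ (S a ↔ S b) → N.lam a b ≤ c)
    (hSv : ¬ (S v ↔ S (part v)))
    (hval : ∀ {a b}, a < N.n → b < N.n → val' a b ≤ val a b)
    (hval' : ∀ {a b}, a < N.n → b < N.n → Crossing part (part v) S a b → val' a b ≤ c) :
    Refining N τ mid mg (splitPart part (part v) v S) val' := by
  have hvp := h.present_of_ne hv hne
  have hside {a b : ℕ} (ha : a < N.n) (hb : b < N.n) (h0 : τ.lab a ≠ 0) (hab : τ.lab a = τ.lab b) :=
    Refining.side_of_lab hτ hmid hc hS ha hb h0 hab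
  have hvv : splitPart part (part v) v S v = v := splitPart_eq rfl hSv
  refine ⟨h.mg_zero, h.mg_lab, h.mg_linked, ?_, ?_, ?_, ?_, ?_, ?_⟩
  · intro x hx
    by_cases hx' : part x = part v ∧ ¬ (S x ↔ S (part v))
    · rw [splitPart_eq hx'.1 hx'.2]; exact hv
    · rw [splitPart_eq_self hx']; exact h.part_lt hx
  · intro x hx
    by_cases hx' : part x = part v ∧ ¬ (S x ↔ S (part v))
    · rw [splitPart_eq hx'.1 hx'.2, hvv]
    · rw [splitPart_eq_self hx', splitPart_eq_self, h.part_part hx]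
      rintro ⟨h1, h2⟩
      rw [h.part_part hx] at h1
      rw [h1] at h2
      exact h2 Iff.rfl
  · intro x hx hx0
    rw [splitPart_eq_self, h.part_absent hx hx0]
    rintro ⟨h1, -⟩
    rw [h.part_absent hx hx0] at h1
    exact h.part_present hv hvp (h1 ▸ hx0)
  · intro x hx hx0
    by_cases hx' : part x = part v ∧ ¬ (S x ↔ S (part v))
    · rw [splitPart_eq hx'.1 hx'.2]; exact hvp
    · rw [splitPart_eq_self hx']; exact h.part_present hx hx0
  · intro a b ha hb h0 hab
    have h1 := hside ha hb h0 hab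
    have h2 := h.part_lab ha hb h0 hab
    exact splitPart_congr h2 h1
  · intro a b ha hb ha0 hb0 hab
    by_cases hpab : part a = part b
    · refine (hval' ha hb ?_).trans hc
      by_cases ha' : part a = part v
      · refine ⟨ha', hpab ▸ ha', fun hs => hab ?_⟩
        exact splitPart_congr hpab hs
      · refine absurd ?_ hab
        rw [splitPart_eq_self (fun h => ha' h.1), splitPart_eq_self (fun h => ha' (hpab ▸ h.1)), hpab]
    · exact (hval ha hb).trans (h.val_le ha hb ha0 hb0 hpab)

end Split

/-! #### Subtasks -/

/-- The task of separating the parts at smaller thresholds. -/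
def lowerTask (N : Net) (τ : RefTask) (mid : ℕ) (part : ℕ → ℕ) : RefTask :=
  ⟨τ.lo, (mid * N.q - 1) / (N.p + N.q), fun v => if τ.lab v = 0 then 0 else part v + 1⟩

/-- The task of refining the part of `r` at larger thresholds. -/
def upperTask (τ : RefTask) (mid : ℕ) (part : ℕ → ℕ) (r : ℕ) : RefTask :=
  ⟨mid, τ.hi, fun v => if part v = r then τ.lab v else 0⟩

/-- For `mid > 0` this threshold is `⌈mid / (1 + δ)⌉ - 1`. It is small enough to be exceeded by `λ`
for nodes linked at `mid + 1` (`Refining.lower_ok`), and large enough that `mid` is within a factor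
`1 + δ` of its successor (`le_lower_hi`). -/
theorem lower_hi_lt {mid : ℕ} (hmid : 0 < mid) : (mid * N.q - 1) / (N.p + N.q) < mid := by
  have hq := N.q_pos
  rw [Nat.div_lt_iff_lt_mul (by omega)]
  have : mid * N.q ≤ mid * (N.p + N.q) := Nat.mul_le_mul_left _ (by omega)
  have : 0 < mid * N.q := Nat.mul_pos hmid hq
  omega

theorem le_lower_hi {mid : ℕ} : mid * N.q ≤ (N.p + N.q) * ((mid * N.q - 1) / (N.p + N.q) + 1) := by
  have hq := N.q_pos
  have := Nat.lt_mul_div_succ (mid * N.q - 1) (show 0 < N.p + N.q by omega)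
  omega

/-- No part contains nodes of different linked classes. -/
def Settled (N : Net) (mg part : ℕ → ℕ) : Prop := ∀ v < N.n, mg v = mg (part v)

section Sub

variable {τ : RefTask} {mid : ℕ} {mg part : ℕ → ℕ} {val : ℕ → ℕ → ℕ}

theorem Refining.linked_of_part (h : Refining N τ mid mg part val) (hs : Settled N mg part)
    {u v : ℕ} (hu : u < N.n) (hv : v < N.n) (hu0 : τ.lab u ≠ 0) (huv : part u = part v) :
    N.Linked (mid + 1) u v :=
  h.mg_linked hu hv (fun h' => hu0 ((h.mg_zero hu).1 h')) (by rw [hs u hu, hs v hv, huv])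

theorem Refining.lower_ok (h : Refining N τ mid mg part val) (hs : Settled N mg part)
    (hτ : N.TaskOK τ) (hmid : mid ≤ τ.hi) (h0 : 0 < mid) : N.TaskOK (lowerTask N τ mid part) where
  hi_le := (lower_hi_lt h0).le.trans (hmid.trans hτ.hi_le)
  lab_lam {u v} hu hv huv hu0 he := by
    simp only [lowerTask] at hu0 he ⊢
    have hu1 : τ.lab u ≠ 0 := fun h => by simp [h] at hu0
    have hv1 : τ.lab v ≠ 0 := fun h => by simp [h, hu1] at he
    simp only [hu1, hv1, if_false, Nat.add_right_cancel_iff] at he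
    obtain ⟨-, h2⟩ := h.linked_of_part hs hu hv hu1 he huv
    have hq := N.q_pos
    rw [Nat.div_lt_iff_lt_mul (by omega), mul_comm (N.lam u v)]
    have : 0 < mid * N.q := Nat.mul_pos h0 hq
    have : (mid + 1) * N.q = mid * N.q + N.q := by ring
    omega
  linked {u v} hu hv hu0 hv0 := by
    simp only [lowerTask] at hu0 hv0
    exact hτ.linked hu hv (fun h => by simp [h] at hu0) (fun h => by simp [h] at hv0)

theorem Refining.upper_ok (h : Refining N τ mid mg part val) (hs : Settled N mg part)
    (hτ : N.TaskOK τ) (r : ℕ) : N.TaskOK (upperTask τ mid part r) where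
  hi_le := hτ.hi_le
  lab_lam {u v} hu hv huv hu0 he := by
    simp only [upperTask] at hu0 he ⊢
    have hu1 : part u = r := by by_contra h; simp [h] at hu0
    simp only [hu1, if_true] at hu0 he
    have hv1 : part v = r := by by_contra h; simp [h, hu0] at he
    simp only [hv1, if_true] at he
    exact hτ.lab_lam hu hv huv hu0 he
  linked {u v} hu hv hu0 hv0 := by
    simp only [upperTask] at hu0 hv0 ⊢
    have hu1 : part u = r := by by_contra h; simp [h] at hu0
    have hv1 : part v = r := by by_contra h; simp [h] at hv0
    simp only [hu1, if_true] at hu0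
    exact h.linked_of_part hs hu hv hu0 (hu1.trans hv1.symm)

/-- A pair in different parts has a cut of capacity at most `mid`, which is what the lower task
needs. A pair in one part goes to the upper task, where `hi` is unchanged and the old guarantee on
the value still serves. -/
theorem Refining.pending_sub (h : Refining N τ mid mg part val) (hs : Settled N mg part)
    (hτ : N.TaskOK τ) (hmid : mid ≤ τ.hi) (h0 : 0 < mid) {u v : ℕ} (hu : u < N.n) (hv : v < N.n)
    (hp : N.Pending τ (val u v) u v) :
    N.Pending (lowerTask N τ mid part) (val u v) u v ∨
    ∃ r < N.n, τ.lab r ≠ 0 ∧ part r = r ∧ N.Pending (upperTask τ mid part r) (val u v) u v := by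
  obtain ⟨h1, h2, h3, h4, h5⟩ := hp
  by_cases huv : part u = part v
  · right
    refine ⟨part u, h.part_lt hu, h.part_present hu h2, h.part_part hu,
      h.upper_ok hs hτ _, ?_, ?_, ?_, h5⟩ <;> simpa [upperTask, huv]
  · left
    refine ⟨h.lower_ok hs hτ hmid h0, ?_, ?_, ?_, ?_⟩
    · simp [lowerTask, h2]
    · simp [lowerTask, h3]
    · simpa [lowerTask, h2, h3] using huv
    · right
      have h6 := h.val_le hu hv h2 h3 huv
      have h7 := hτ.hi_le
      exact ⟨by omega, (Nat.mul_le_mul_right _ h6).trans le_lower_hi⟩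

end Sub

/-! #### Potentials -/

/-- The number of different nonzero labels. -/
def numLab (n : ℕ) (f : ℕ → ℕ) : ℕ := (((range n).image f).erase 0).card

/-- The number of pairs of nodes with different nonzero labels. -/
def numPairs (n : ℕ) (f : ℕ → ℕ) : ℕ :=
  (((range n) ×ˢ (range n)).filter fun x => f x.1 ≠ 0 ∧ f x.2 ≠ 0 ∧ f x.1 ≠ f x.2).card

/-- The representatives of the parts. -/
def reps (n : ℕ) (lab part : ℕ → ℕ) : Finset ℕ :=
  (range n).filter fun v => lab v ≠ 0 ∧ part v = v

/-- The number of pairs of nodes with different labels in the same part. -/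
def openPairs (n : ℕ) (lab part : ℕ → ℕ) : ℕ :=
  (((range n) ×ˢ (range n)).filter fun x =>
    lab x.1 ≠ 0 ∧ lab x.2 ≠ 0 ∧ lab x.1 ≠ lab x.2 ∧ part x.1 = part x.2).card

theorem numLab_le (n : ℕ) (f : ℕ → ℕ) : numLab n f ≤ n :=
  (card_erase_le).trans (card_image_le.trans (card_range n).le)

theorem numPairs_le (n : ℕ) (f : ℕ → ℕ) : numPairs n f ≤ n * n :=
  (card_filter_le _ _).trans (by simp)

theorem openPairs_le (n : ℕ) (lab part : ℕ → ℕ) : openPairs n lab part ≤ numPairs n lab :=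
  card_le_card fun x hx => by
    simp only [mem_filter] at hx ⊢
    tauto

theorem numLab_merge_lt {n : ℕ} {mg : ℕ → ℕ} {u v : ℕ} (hu : u < n) (hv : v < n) (h0 : mg v ≠ 0)
    (hne : mg v ≠ mg u) :
    numLab n (fun x => if mg x = mg v then mg u else mg x) < numLab n mg := by
  refine card_lt_card (Finset.ssubset_iff_subset_ne.2 ⟨?_, ?_⟩)
  · intro y hy
    simp only [mem_erase, mem_image, mem_range] at hy ⊢
    obtain ⟨hy0, x, hx, rfl⟩ := hy
    refine ⟨hy0, ?_⟩
    split_ifs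
    · exact ⟨u, hu, rfl⟩
    · exact ⟨x, hx, rfl⟩
  · intro he
    have : mg v ∈ ((range n).image mg).erase 0 := by
      simp only [mem_erase, mem_image, mem_range]
      exact ⟨h0, v, hv, rfl⟩
    rw [← he] at this
    simp only [mem_erase, mem_image, mem_range] at this
    obtain ⟨-, x, hx, hxe⟩ := this
    split_ifs at hxe with h
    · exact hne hxe.symm
    · exact h hxe

section Pot

variable {τ : RefTask} {mid : ℕ} {mg part : ℕ → ℕ} {val : ℕ → ℕ → ℕ}

/-- A cluster lies in a single part, so different representatives have different labels. -/
theorem Refining.card_reps_le (h : Refining N τ mid mg part val) :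
    (reps N.n τ.lab part).card ≤ numLab N.n τ.lab := by
  refine card_le_card_of_injOn τ.lab ?_ ?_
  · intro x hx
    simp only [reps, coe_filter, mem_range, Set.mem_ofPred_eq] at hx
    simp only [coe_erase, Set.mem_sdiff, mem_coe, mem_image, mem_range, Set.mem_singleton_iff]
    exact ⟨⟨x, hx.1, rfl⟩, hx.2.1⟩
  · intro x hx y hy hxy
    simp only [reps, coe_filter, mem_range, Set.mem_ofPred_eq] at hx hy
    rw [← hx.2.2, ← hy.2.2]
    exact h.part_lab hx.1 hy.1 hx.2.1 hxy

theorem Refining.reps_lt_split (h : Refining N τ mid mg part val) {v : ℕ} {S : ℕ → Prop}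
    (hv : v < N.n) (hne : mg v ≠ mg (part v)) (hSv : ¬ (S v ↔ S (part v))) :
    (reps N.n τ.lab part).card < (reps N.n τ.lab (splitPart part (part v) v S)).card := by
  have hv0 := h.present_of_ne hv hne
  refine card_lt_card (ssubset_iff_of_subset ?_ |>.2 ⟨v, ?_, ?_⟩)
  · intro x hx
    simp only [reps, mem_filter, mem_range] at hx ⊢
    refine ⟨hx.1, hx.2.1, ?_⟩
    rw [splitPart_eq_self, hx.2.2]
    rintro ⟨h1, h2⟩
    rw [hx.2.2] at h1
    exact h2 (by rw [h1])
  · simp only [reps, mem_filter, mem_range]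
    exact ⟨hv, hv0, splitPart_eq rfl hSv⟩
  · simp only [reps, mem_filter, mem_range, not_and]
    intro _ _ h1
    exact hne (by rw [h1])

-- A pair crossing the cut inside the split part has different labels, since no cluster is cut, and
-- stops being open. Counting such pairs in one order gives the product of the sizes of the two
-- sides, which is the number of pairs visited by `moveCmd`.
open Classical in
theorem Refining.openPairs_split (h : Refining N τ mid mg part val) (hτ : N.TaskOK τ)
    (hmid : mid ≤ τ.hi) {v c : ℕ} {S : ℕ → Prop}
    (hv : v < N.n) (hne : mg v ≠ mg (part v)) (hc : c ≤ mid)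
    (hS : ∀ {a b}, a < N.n → b < N.n → ¬ (S a ↔ S b) → N.lam a b ≤ c) :
    openPairs N.n τ.lab (splitPart part (part v) v S) +
      ((range N.n).filter fun x => part x = part v ∧ (S x ↔ S (part v))).card *
      ((range N.n).filter fun x => part x = part v ∧ ¬ (S x ↔ S (part v))).card
      ≤ openPairs N.n τ.lab part := by
  have hv0 := h.present_of_ne hv hne
  have hpres : ∀ x < N.n, part x = part v → τ.lab x ≠ 0 := by
    intro x hx hxv h0
    have := h.part_absent hx h0
    exact h.part_present hv hv0 (by rw [← hxv, this, h0])
  rw [← card_product, openPairs, openPairs, ← card_union_of_disjoint]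
  · refine card_le_card ?_
    rintro ⟨a, b⟩ hx
    simp only [mem_union, mem_filter, mem_product, mem_range] at hx ⊢
    rcases hx with ⟨⟨ha, hb⟩, ha0, hb0, hab, hp⟩ | ⟨⟨ha, hav, hSa⟩, hb, hbv, hSb⟩
    · refine ⟨⟨ha, hb⟩, ha0, hb0, hab, ?_⟩
      by_cases h1 : part a = part v ∧ ¬ (S a ↔ S (part v)) <;>
        by_cases h2 : part b = part v ∧ ¬ (S b ↔ S (part v))
      · rw [h1.1, h2.1]
      -- In the mixed cases some old part would already be represented by `v`, so `v` would
      -- represent itself, against `hne`.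
      · rw [splitPart_eq h1.1 h1.2, splitPart_eq_self h2] at hp
        have h3 := h.part_part hb
        rw [← hp] at h3
        exact absurd (by rw [h3]) hne
      · rw [splitPart_eq h2.1 h2.2, splitPart_eq_self h1] at hp
        have h3 := h.part_part ha
        rw [hp] at h3
        exact absurd (by rw [h3]) hne
      · rwa [splitPart_eq_self h1, splitPart_eq_self h2] at hp
    · refine ⟨⟨ha, hb⟩, hpres a ha hav, hpres b hb hbv, ?_, hav.trans hbv.symm⟩
      intro hl
      have := Refining.side_of_lab hτ hmid hc hS ha hb (hpres a ha hav) hl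
      tauto
  · rw [disjoint_left]
    rintro ⟨a, b⟩ hx hx'
    simp only [mem_filter, mem_product, mem_range] at hx hx'
    obtain ⟨⟨ha, hb⟩, ha0, hb0, hab, hp⟩ := hx
    obtain ⟨⟨-, hav, hSa⟩, -, hbv, hSb⟩ := hx'
    rw [splitPart_eq hbv hSb, splitPart_eq_self (by tauto), hav] at hp
    exact hne (by rw [hp])

theorem Refining.numLab_lower (h : Refining N τ mid mg part val) :
    numLab N.n (lowerTask N τ mid part).lab ≤ (reps N.n τ.lab part).card := by
  refine (card_le_card (t := (reps N.n τ.lab part).image (· + 1)) ?_).trans card_image_le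
  intro y hy
  simp only [lowerTask, mem_erase, mem_image, mem_range, reps, mem_filter] at hy ⊢
  obtain ⟨hy0, x, hx, rfl⟩ := hy
  have hx0 : τ.lab x ≠ 0 := fun h => by simp [h] at hy0
  exact ⟨part x, ⟨h.part_lt hx, h.part_present hx hx0, h.part_part hx⟩, by simp [hx0]⟩

/-- Equal labels lie in one part, so the upper tasks use disjoint sets of labels. -/
theorem Refining.sum_numLab_upper (h : Refining N τ mid mg part val) :
    ∑ r ∈ reps N.n τ.lab part, numLab N.n (upperTask τ mid part r).lab ≤ numLab N.n τ.lab := by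
  unfold numLab
  rw [← card_biUnion]
  · refine card_le_card ?_
    intro y hy
    simp only [mem_biUnion, upperTask, mem_erase, mem_image, mem_range] at hy ⊢
    obtain ⟨r, hr, hy0, x, hx, rfl⟩ := hy
    refine ⟨hy0, x, hx, ?_⟩
    split_ifs at hy0 ⊢ with h1
    · rfl
    · simp at hy0
  · intro r hr r' hr' hrr
    simp only [Function.onFun]
    rw [disjoint_left]
    intro y hy hy'
    simp only [upperTask, mem_erase, mem_image, mem_range] at hy hy'
    obtain ⟨hy0, x, hx, rfl⟩ := hy
    obtain ⟨-, x', hx', he⟩ := hy'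
    have h1 : part x = r := by by_contra h; simp [h] at hy0
    simp only [h1, if_true] at hy0 he
    have h2 : part x' = r' := by by_contra h; simp [h] at he; exact hy0 he.symm
    simp only [h2, if_true] at he
    exact hrr (by rw [← h1, ← h2]; exact h.part_lab hx hx' hy0 he.symm)

theorem one_le_numLab_upper {r : ℕ} (hr : r ∈ reps N.n τ.lab part) :
    1 ≤ numLab N.n (upperTask τ mid part r).lab := by
  simp only [reps, mem_filter, mem_range] at hr
  refine card_pos.2 ⟨τ.lab r, ?_⟩
  simp only [upperTask, mem_erase, mem_image, mem_range]
  exact ⟨hr.2.1, r, hr.1, by simp [hr.2.2]⟩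

/-- With `k` labels and `r > 0` parts, the lower task contributes at most `r - 1` and the upper
tasks together at most `k - r`. Subtracting `1` per task is essential: `k` itself would not be a
potential, as the lower task would add `r`. -/
theorem Refining.sum_numLab (h : Refining N τ mid mg part val) :
    (numLab N.n (lowerTask N τ mid part).lab - 1) +
      ∑ r ∈ reps N.n τ.lab part, (numLab N.n (upperTask τ mid part r).lab - 1)
      ≤ numLab N.n τ.lab - 1 := by
  have h1 := h.numLab_lower
  have h2 := h.sum_numLab_upper
  have h3 : ∑ r ∈ reps N.n τ.lab part, (numLab N.n (upperTask τ mid part r).lab - 1) +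
      (reps N.n τ.lab part).card
      = ∑ r ∈ reps N.n τ.lab part, numLab N.n (upperTask τ mid part r).lab := by
    rw [card_eq_sum_ones, ← sum_add_distrib]
    exact sum_congr rfl fun r hr => Nat.sub_add_cancel (one_le_numLab_upper hr)
  -- The count `(r - 1) + (k - r)` fails for truncated subtraction at `r = 0`; then the lower task
  -- has no labels and the sum is empty.
  rcases Nat.eq_zero_or_pos (reps N.n τ.lab part).card with h4 | h4
  · rw [card_eq_zero] at h4
    rw [h4] at h1 ⊢
    simp only [card_empty, nonpos_iff_eq_zero] at h1
    simp [h1]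
  · omega

/-- A pair in different parts can only count for the lower task, a pair in one part only for the
upper task of this part. -/
theorem Refining.sum_numPairs (h : Refining N τ mid mg part val) :
    numPairs N.n (lowerTask N τ mid part).lab +
      ∑ r ∈ reps N.n τ.lab part, numPairs N.n (upperTask τ mid part r).lab
      ≤ numPairs N.n τ.lab := by
  unfold numPairs
  rw [← card_biUnion, ← card_union_of_disjoint]
  · refine card_le_card ?_
    rintro ⟨a, b⟩ hx
    simp only [mem_union, mem_biUnion, mem_filter, mem_product, mem_range] at hx ⊢
    simp only [lowerTask, upperTask] at hx
    rcases hx with ⟨⟨ha, hb⟩, ha0, hb0, hab⟩ | ⟨r, hr, ⟨ha, hb⟩, ha0, hb0, hab⟩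
    · have ha1 : τ.lab a ≠ 0 := fun h => by simp [h] at ha0
      have hb1 : τ.lab b ≠ 0 := fun h => by simp [h] at hb0
      refine ⟨⟨ha, hb⟩, ha1, hb1, fun hl => hab ?_⟩
      simp [ha1, hb1, h.part_lab ha hb ha1 hl]
    · have ha1 : part a = r := by by_contra h; simp [h] at ha0
      have hb1 : part b = r := by by_contra h; simp [h] at hb0
      simp only [ha1, hb1, if_true] at ha0 hb0 hab
      exact ⟨⟨ha, hb⟩, ha0, hb0, hab⟩
  · rw [disjoint_left]
    rintro ⟨a, b⟩ hx hx'
    simp only [mem_biUnion, mem_filter, mem_product, mem_range] at hx hx'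
    simp only [lowerTask, upperTask] at hx hx'
    obtain ⟨⟨ha, hb⟩, ha0, hb0, hab⟩ := hx
    obtain ⟨r, hr, -, ha0', hb0', hab'⟩ := hx'
    have ha1 : part a = r := by by_contra h; simp [h] at ha0'
    have hb1 : part b = r := by by_contra h; simp [h] at hb0'
    have ha2 : τ.lab a ≠ 0 := fun h => by simp [h] at ha0
    have hb2 : τ.lab b ≠ 0 := fun h => by simp [h] at hb0
    simp [ha1, hb1, ha2, hb2] at hab
  · intro r hr r' hr' hrr
    simp only [Function.onFun]
    rw [disjoint_left]
    rintro ⟨a, b⟩ hx hx'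
    simp only [mem_filter] at hx hx'
    simp only [upperTask] at hx hx'
    have h1 : part a = r := by by_contra h; simp [h] at hx
    have h2 : part a = r' := by by_contra h; simp [h] at hx'
    exact hrr (by rw [← h1, ← h2])

end Pot

end Net

/-! ### Machine environment and the query step -/

/-- The input, the subroutine and the word size, in the form in which the programs see them. The
subroutine answers the query `r`, `v` with the cut `ans r v`. -/
structure Env where
  N : Net
  m : ℕ
  w : ℕ
  tA : ℕ
  hmax : ℕ
  inp : List ℕ
  O : Subroutine
  ans : ℕ → ℕ → Mem
  n_ge : 2 ≤ N.n
  inp_length : inp.length = 4 + 3 * m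
  inp_zero : loadList inp 0 = N.n
  inp_one : loadList inp 1 = m
  inp_two : loadList inp 2 = N.p
  inp_three : loadList inp 3 = N.q
  src_lt : ∀ i < m, loadList inp (4 + 3 * i) < N.n
  dst_lt : ∀ i < m, loadList inp (4 + 3 * i + 1) < N.n
  sum_cap : ∑ i ∈ Finset.range m, loadList inp (4 + 3 * i + 2) = N.tot
  call : ∀ r v, r < N.n → v < N.n → r ≠ v → ∃ t ≤ tA, O (loadList (r :: v :: inp)) (ans r v) t
  word : 16 + hmax + N.n < 2 ^ w
  word_mul : (N.tot + 2) * (N.p + N.q + 1) < 2 ^ w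
  hmax_ge : 10 + 6 * m + 6 * N.n + N.n * N.n ≤ hmax

namespace Env

open Finset

variable (E : Env)

/-- Starting addresses of consecutive blocks: the argument of the subroutine (two nodes and a copy
of the input), the parts, the classes, the list of nodes on one side, the pointer matrix, the heap.
The slack of `3 * n` below `AB` guarantees that the edges of the tree, written from address `0` on,
do not reach the arrays. -/
def AB : ℕ := 4 + 3 * E.m + 3 * E.N.n
def PT : ℕ := E.AB + 6 + 3 * E.m
def MG : ℕ := E.PT + E.N.n
def LA : ℕ := E.MG + E.N.n
def PR : ℕ := E.LA + E.N.n
def H0 : ℕ := E.PR + E.N.n * E.N.n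

theorem layout : E.AB = 4 + 3 * E.m + 3 * E.N.n ∧ E.PT = E.AB + 6 + 3 * E.m ∧
    E.MG = E.PT + E.N.n ∧ E.LA = E.MG + E.N.n ∧ E.PR = E.LA + E.N.n ∧
    E.H0 = E.PR + E.N.n * E.N.n ∧ E.H0 ≤ E.hmax ∧ 16 + E.hmax + E.N.n < 2 ^ E.w ∧ 2 ≤ E.N.n := by
  refine ⟨rfl, rfl, rfl, rfl, rfl, rfl, ?_, E.word, E.n_ge⟩
  have := E.hmax_ge
  simp only [H0, PR, LA, MG, PT, AB]
  omega

theorem tot_lt : E.N.tot + 2 < 2 ^ E.w := by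
  have h := E.word_mul
  nlinarith [Nat.zero_le ((E.N.tot + 2) * (E.N.p + E.N.q))]

/-- The registers that keep their values after the setup. -/
structure Regs (V : ℕ → ℕ) : Prop where
  r0 : V 0 = E.N.n
  r1 : V 1 = E.m
  r2 : V 2 = E.N.p
  r3 : V 3 = E.N.q
  r4 : V 4 = E.AB
  r5 : V 5 = E.PT
  r6 : V 6 = E.MG
  r7 : V 7 = E.LA
  r9 : V 9 = E.PR

variable {E}

theorem Regs.update {V : ℕ → ℕ} (h : E.Regs V) (x a : ℕ) (hx : 10 ≤ x := by omega) :
    E.Regs (Function.update V x a) := by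
  constructor <;> rw [Function.update_of_ne (by omega)]
  exacts [h.r0, h.r1, h.r2, h.r3, h.r4, h.r5, h.r6, h.r7, h.r9]

variable (E)

/-- The input and its copy in the block that is passed to the subroutine. -/
def HasInput (μ : Mem) : Prop :=
  ∀ i < 4 + 3 * E.m, μ i = loadList E.inp i ∧ μ (E.AB + 2 + i) = loadList E.inp i

open Classical in
/-- The capacity of the cut with the side `S`. -/
noncomputable def cutVal (S : ℕ → Prop) : ℕ :=
  ∑ i ∈ range E.m, if (S (loadList E.inp (4 + 3 * i)) ↔ S (loadList E.inp (4 + 3 * i + 1))) then 0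
    else loadList E.inp (4 + 3 * i + 2)

theorem cutVal_le (S : ℕ → Prop) : E.cutVal S ≤ E.N.tot := by
  rw [← E.sum_cap]
  refine sum_le_sum fun i _ => ?_
  split_ifs <;> simp

end Env

open Env

/-- `memory[b + i]`, where `b` is in a register. -/
def readAt (b : ℕ) (i : Expr) : Expr := .load (.add (.var b) i)

/-- Calls the subroutine for the representative of the part of the current node and this node, and
computes the capacity of the answer. -/
def queryCmd : Cmd :=
  .seq (.assign 18 (readAt 5 (.var 17))) <|
  .seq (.store (.var 4) (.var 18)) <|
  .seq (.store (.add (.var 4) (.const 1)) (.var 17)) <|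
  .seq (.call (.var 4) (.add (.const 6) (.mul (.const 3) (.var 1))) (.add (.var 10) (.const 2))
    (.var 0)) <|
  .sum 30 19 (.var 1)
    (.mul (.ne
      (.eq (.load (.add (.add (.var 10) (.const 2))
        (.load (.add (.const 4) (.mul (.const 3) (.var 30)))))) (.const 0))
      (.eq (.load (.add (.add (.var 10) (.const 2))
        (.load (.add (.const 5) (.mul (.const 3) (.var 30)))))) (.const 0)))
      (.load (.add (.const 6) (.mul (.const 3) (.var 30)))))

/-- The answer is copied to `H + 2`, where the body of the next record would be, so keeping the cut
only requires writing the two header cells. -/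
theorem query_spec (E : Env) {V : ℕ → ℕ} {μ : Mem} {τ : List ℕ} {r v H : ℕ} {P : State → Prop}
    (hR : E.Regs V) (hI : E.HasInput μ) (hv : v < E.N.n) (hr : r < E.N.n) (hrv : r ≠ v)
    (h17 : V 17 = v) (h10 : V 10 = H) (hH : H ≤ E.hmax) (hH0 : E.H0 ≤ H) (hp : μ (E.PT + v) = r)
    (hP : P ⟨Function.update (Function.update (Function.update V 18 r) 19
        (E.cutVal fun x => E.ans r v x ≠ 0)) 30 E.m,
      writeArr (Function.update (Function.update μ E.AB r) (E.AB + 1) v) (H + 2) E.N.n (E.ans r v),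
      τ⟩) :
    Run E.w E.O queryCmd ⟨V, μ, τ⟩ (E.tA + 80 * (E.N.n + E.m + 1)) 1 P := by
  obtain ⟨l1, l2, l3, l4, l5, l6, l7, l8, l9⟩ := E.layout
  have ltot := E.tot_lt
  obtain ⟨tc, htc, hO⟩ := E.call r v hr hv hrv
  have e1 : (readAt 5 (.var 17)).eval E.w ⟨V, μ, τ⟩ = r := by
    simp (disch := omega) only [readAt, Expr.eval, hR.r5, h17, Nat.mod_eq_of_lt, hp]
  refine wp_seq.2 (wp_assign.2 (wp_seq.2 (wp_store.2 (wp_seq.2 (wp_store.2 (wp_seq.2 ?_))))))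
  have e2 : (Expr.add (.var 4) (.const 1)).eval E.w
      ⟨Function.update V 18 r, Function.update μ E.AB r, τ⟩ = E.AB + 1 := by
    simp (disch := omega) [Expr.eval, hR.r4, Nat.mod_eq_of_lt]
  simp only [e1]
  simp only [Expr.eval, ne_eq, Nat.reduceEqDiff, not_false_eq_true, Function.update_of_ne,
    Function.update_self, hR.r4, h17]
  simp (disch := omega) only [Nat.mod_eq_of_lt]
  -- The block passed on is the list of the two nodes followed by the input; beyond its length both
  -- memories are `0`.
  have hmem : (fun i => if i < 6 + 3 * E.m then
      Function.update (Function.update μ E.AB r) (E.AB + 1) v (E.AB + i) else 0)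
      = loadList (r :: v :: E.inp) := by
    funext i
    rcases i with _ | _ | i
    · simp [loadList]
    · simp [loadList]; omega
    · have hl : loadList (r :: v :: E.inp) (i + 1 + 1) = loadList E.inp i := by
        simp [loadList]
      rw [hl]
      split_ifs with h
      · rw [Function.update_of_ne (by omega), Function.update_of_ne (by omega),
          ← (hI i (by omega)).2]
        congr 1; omega
      · simp only [loadList]
        rw [List.getD_eq_default]
        rw [E.inp_length]; omega
  refine wp_call (M := E.ans r v) (t := tc) ?_ ?_
  · simpa (disch := omega) [Expr.eval, hR.r4, hR.r1, Nat.mod_eq_of_lt, hmem] using hO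
  simp only [Expr.eval, ne_eq, Nat.reduceEqDiff, not_false_eq_true, Function.update_of_ne,
    hR.r1, h10, hR.r0]
  simp (disch := omega) only [Nat.mod_eq_of_lt]
  set μ' := writeArr (Function.update (Function.update μ E.AB r) (E.AB + 1) v) (H + 2) E.N.n
    (E.ans r v) with hμ'
  have hin : ∀ i < 4 + 3 * E.m, μ' i = loadList E.inp i := by
    intro i hi
    rw [hμ', writeArr_of_lt (by omega), Function.update_of_ne (by omega),
      Function.update_of_ne (by omega), (hI i hi).1]
  have hans : ∀ i < E.N.n, μ' (H + 2 + i) = E.ans r v i := fun i hi => writeArr_at hi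
  change Wp E.w E.O _ ⟨Function.update V 18 r, μ', τ⟩ _
  clear_value μ'
  classical
  have hcv : E.cutVal (fun x => E.ans r v x ≠ 0) = ∑ i ∈ Finset.range E.m,
      if (E.ans r v (loadList E.inp (4 + 3 * i)) ≠ 0 ↔
        E.ans r v (loadList E.inp (4 + 3 * i + 1)) ≠ 0) then 0
      else loadList E.inp (4 + 3 * i + 2) := by
    unfold cutVal
    congr!
  refine Run.wp (T := 47 * (E.m + 1) + 3) (R := 0) (P := P) (Run.sum (cnt := E.m)
    (fun i => if (E.ans r v (loadList E.inp (4 + 3 * i)) ≠ 0 ↔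
      E.ans r v (loadList E.inp (4 + 3 * i + 1)) ≠ 0) then 0 else loadList E.inp (4 + 3 * i + 2))
    (by decide) (by omega) ?_ ?_ ?_ ?_ ?_) ?_
  · refine lt_of_le_of_lt ?_ (show E.N.tot < 2 ^ E.w by omega)
    rw [← hcv]
    exact E.cutVal_le _
  · intro s k
    simp [Expr.eval, hR.r1]
  · intro s k hk
    have hs := E.src_lt k hk
    have hd := E.dst_lt k hk
    have hc : loadList E.inp (4 + 3 * k + 2) ≤ E.N.tot := by
      rw [← E.sum_cap]
      exact Finset.single_le_sum (f := fun i => loadList E.inp (4 + 3 * i + 2))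
        (fun _ _ => Nat.zero_le _) (Finset.mem_range.2 hk)
    have h1 := hin (4 + 3 * k) (by omega)
    have h2 := hin (4 + 3 * k + 1) (by omega)
    have h3 := hin (4 + 3 * k + 2) (by omega)
    rw [show 4 + 3 * k + 1 = 5 + 3 * k by omega] at *
    rw [show 4 + 3 * k + 2 = 6 + 3 * k by omega] at *
    have h4 := hans _ hs
    have h5 := hans _ hd
    rw [← h1] at h4
    rw [← h2] at h5
    simp only [Expr.eval, Expr.eval_ne, ne_eq, Nat.reduceEqDiff, not_false_eq_true,
      Function.update_of_ne, Function.update_self, h10]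
    simp (disch := omega) only [Nat.mod_eq_of_lt]
    rw [← h1, ← h2, ← h3]
    rw [← h1] at hs
    rw [← h2] at hd
    rw [h4, h5]
    by_cases ha : E.ans r v (μ' (4 + 3 * k)) = 0 <;> by_cases hb : E.ans r v (μ' (5 + 3 * k)) = 0 <;>
      simp [ha, hb] <;> exact Nat.mod_eq_of_lt (by omega)
  · simp [Expr.cost, Expr.ne]
  · rw [← hcv]
    exact hP
  · intro σ' t r' ht hr' hσ
    refine ⟨?_, by omega, hσ⟩
    simp only [Expr.cost, readAt]
    omega

/-! ### Merging classes and splitting parts -/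

/-- Merges the linked class of the current node with the one of its representative. -/
def mergeCmd : Cmd :=
  .seq (.assign 22 (readAt 6 (.var 17))) <|
  .seq (.assign 23 (readAt 6 (.var 18))) <|
  .fill 30 (.var 6) (.var 0)
    (.sel (.eq (readAt 6 (.var 30)) (.var 22)) (.var 23) (readAt 6 (.var 30)))

theorem merge_spec (E : Env) {V : ℕ → ℕ} {μ : Mem} {τ : List ℕ} {r v : ℕ} {P : State → Prop}
    (hR : E.Regs V) (hv : v < E.N.n) (hr : r < E.N.n) (h17 : V 17 = v) (h18 : V 18 = r)
    (hmg : ∀ x < E.N.n, μ (E.MG + x) ≤ E.N.n)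
    (hP : P ⟨Function.update (Function.update (Function.update V 22 (μ (E.MG + v))) 23
        (μ (E.MG + r))) 30 E.N.n,
      writeArr μ E.MG E.N.n fun x => if μ (E.MG + x) = μ (E.MG + v) then μ (E.MG + r)
        else μ (E.MG + x), τ⟩) :
    Run E.w E.O mergeCmd ⟨V, μ, τ⟩ (50 * (E.N.n + 1)) 0 P := by
  obtain ⟨l1, l2, l3, l4, l5, l6, l7, l8, l9⟩ := E.layout
  refine wp_seq.2 (wp_assign.2 (wp_seq.2 (wp_assign.2 ?_)))
  simp only [readAt, Expr.eval, ne_eq, Nat.reduceEqDiff, not_false_eq_true, Function.update_of_ne,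
    hR.r6, h17, h18]
  simp (disch := omega) only [Nat.mod_eq_of_lt]
  refine Run.wp (T := 35 * (E.N.n + 1)) (R := 0) (P := P) (Run.fill (base := E.MG) (cnt := E.N.n)
    (fun x => if μ (E.MG + x) = μ (E.MG + v) then μ (E.MG + r) else μ (E.MG + x))
    (by omega) ?_ ?_ ?_ ?_ hP) ?_
  · intro k M; simp [Expr.eval, hR.r6]
  · intro k M; simp [Expr.eval, hR.r0]
  · intro k hk
    have h1 : writeArr μ E.MG k (fun x => if μ (E.MG + x) = μ (E.MG + v) then μ (E.MG + r)
        else μ (E.MG + x)) (E.MG + k) = μ (E.MG + k) := writeArr_of_ge le_rfl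
    have := hmg k hk
    have := hmg r hr
    rw [Expr.eval_sel (p := μ (E.MG + k) = μ (E.MG + v)) (by omega)]
    · simp only [Expr.eval, ne_eq, Nat.reduceEqDiff, not_false_eq_true, Function.update_of_ne,
        Function.update_self, hR.r6]
      simp (disch := omega) only [Nat.mod_eq_of_lt, h1]
    · simp only [Expr.eval, ne_eq, Nat.reduceEqDiff, not_false_eq_true, Function.update_of_ne,
        Function.update_self, hR.r6]
      simp (disch := omega) only [Nat.mod_eq_of_lt, h1]
    · intro _
      simp only [Expr.eval, ne_eq, Nat.reduceEqDiff, not_false_eq_true, Function.update_of_ne,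
        Function.update_self]
      omega
    · intro _
      simp only [Expr.eval, ne_eq, Nat.reduceEqDiff, not_false_eq_true, Function.update_of_ne,
        Function.update_self, hR.r6]
      simp (disch := omega) only [Nat.mod_eq_of_lt, h1]
      omega
  · simp [Expr.cost, Expr.sel]
  · intro σ' t r' ht hr' hσ
    refine ⟨?_, by omega, hσ⟩
    simp only [Expr.cost]
    omega

theorem idx_lt {n a b : ℕ} (ha : a < n) (hb : b < n) : a * n + b < n * n := by
  nlinarith

theorem idx_inj {n a b a' b' : ℕ} (hb : b < n) (hb' : b' < n) (h : a * n + b = a' * n + b') :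
    a = a' ∧ b = b' := by
  have hn : 0 < n := by omega
  have h1 : (a * n + b) / n = a := by
    rw [mul_comm, Nat.mul_add_div hn, Nat.div_eq_of_lt hb, add_zero]
  have h2 : (a' * n + b') / n = a' := by
    rw [mul_comm, Nat.mul_add_div hn, Nat.div_eq_of_lt hb', add_zero]
  have h3 : a = a' := by rw [← h1, h, h2]
  subst h3
  exact ⟨rfl, by omega⟩

/-- `memory[b + 2 + i]`, where `b` is in register `10`. -/
def readSide (i : Expr) : Expr := .load (.add (.add (.var 10) (.const 2)) i)

/-- Replaces the entry `i` of the pointer matrix if the new cut has a smaller capacity. -/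
def improveCmd (i : Expr) : Cmd :=
  .ite (.lt (.var 19) (.load (readAt 9 i))) (.store (.add (.var 9) i) (.var 10)) .skip

/-- Improves the entries for the current node of the loop and all listed nodes. -/
def improveAllCmd : Cmd :=
  .for 31 (.var 20)
    (.seq (improveCmd (.add (.mul (readAt 7 (.var 31)) (.var 0)) (.var 30)))
      (improveCmd (.add (.mul (.var 30) (.var 0)) (readAt 7 (.var 31)))))

/-- Lists the nodes in the part of the representative that are on its side. -/
def listCmd : Cmd :=
  .seq (.assign 20 (.const 0)) <|
  .for 30 (.var 0) <| .seq (.store (.add (.var 7) (.var 20)) (.var 30))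
    (.assign 20 (.add (.var 20) (.mul (.eq (readAt 5 (.var 30)) (.var 18))
      (.eq (.eq (readSide (.var 30)) (.const 0)) (.var 21)))))

/-- Moves the nodes on the other side to the part of the current node. -/
def moveCmd : Cmd :=
  .for 30 (.var 0) <|
    .ite (.mul (.eq (readAt 5 (.var 30)) (.var 18))
        (.ne (.eq (readSide (.var 30)) (.const 0)) (.var 21)))
      (.seq (.store (.add (.var 5) (.var 30)) (.var 17)) improveAllCmd) .skip

/-- Keeps the cut just computed and splits the part of the current node with it. -/
def splitCmd : Cmd :=
  .seq (.store (.var 10) (.var 19)) <|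
  .seq (.store (.add (.var 10) (.const 1)) (.const 0)) <|
  .seq (.assign 21 (.eq (readSide (.var 18)) (.const 0))) <|
  .seq listCmd <|
  .seq moveCmd <|
  .assign 10 (.add (.var 10) (.add (.var 0) (.const 2)))

namespace Env

variable (E : Env)

/-- The pointer matrix after improving the entries in `D`, where `ptr` are the old pointers and
`cap` the capacities of the old cuts. -/
def Improved (H c : ℕ) (ptr cap : ℕ → ℕ → ℕ) (D : ℕ → ℕ → Prop) (μ : Mem) : Prop :=
  ∀ a < E.N.n, ∀ b < E.N.n,
    (D a b ∧ c < cap a b → μ (E.PR + (a * E.N.n + b)) = H) ∧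
    (¬ (D a b ∧ c < cap a b) → μ (E.PR + (a * E.N.n + b)) = ptr a b)

variable {E}

theorem Improved.congr {H c : ℕ} {ptr cap : ℕ → ℕ → ℕ} {D D' : ℕ → ℕ → Prop} {μ μ' : Mem}
    (h : E.Improved H c ptr cap D μ)
    (hμ : ∀ a, E.PR ≤ a → a < E.PR + E.N.n * E.N.n → μ' a = μ a)
    (hD : ∀ a < E.N.n, ∀ b < E.N.n, (D a b ↔ D' a b)) : E.Improved H c ptr cap D' μ' := by
  intro a ha b hb
  have := idx_lt ha hb
  rw [hμ _ (by omega) (by omega), ← hD a ha b hb]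
  exact h a ha b hb

end Env

/-- An entry already redirected to the record `H` has current capacity `c`, and the strict
comparison leaves it alone. So revisiting an entry is harmless and the set of improved entries is
described exactly. -/
theorem improve_spec (E : Env) {V : ℕ → ℕ} {μ : Mem} {τ : List ℕ} {a b H c : ℕ} {i : Expr}
    {ptr cap : ℕ → ℕ → ℕ} {D : ℕ → ℕ → Prop}
    (hR : E.Regs V) (ha : a < E.N.n) (hb : b < E.N.n) (h10 : V 10 = H) (h19 : V 19 = c)
    (hi : i.eval E.w ⟨V, μ, τ⟩ = a * E.N.n + b)
    (hH : μ H = c) (hcap : μ (ptr a b) = cap a b)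
    (hD : E.Improved H c ptr cap D μ) :
    Run E.w E.O (improveCmd i) ⟨V, μ, τ⟩ (2 * i.cost + 12) 0 fun σ =>
      σ.vars = V ∧ σ.tape = τ ∧
      (∀ x, ¬ (E.PR ≤ x ∧ x < E.PR + E.N.n * E.N.n) → σ.mem x = μ x) ∧
      E.Improved H c ptr cap (fun x y => D x y ∨ (x = a ∧ y = b)) σ.mem := by
  obtain ⟨l1, l2, l3, l4, l5, l6, l7, l8, l9⟩ := E.layout
  have hlt := idx_lt ha hb
  have hcur := hD a ha b hb
  have e1 : (Expr.lt (.var 19) (.load (readAt 9 i))).eval E.w ⟨V, μ, τ⟩ =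
      if c < μ (μ (E.PR + (a * E.N.n + b))) then 1 else 0 := by
    simp only [Expr.eval, readAt, hi, h19, hR.r9]
    simp (disch := omega) only [Nat.mod_eq_of_lt]
  refine wp_ite.2 ⟨fun h => ?_, fun h => ?_⟩
  · rw [e1] at h
    have hlt' : c < μ (μ (E.PR + (a * E.N.n + b))) := by by_contra h'; simp [h'] at h
    have hnD : ¬ (D a b ∧ c < cap a b) := by
      intro h'
      rw [hcur.1 h', hH] at hlt'
      omega
    rw [hcur.2 hnD, hcap] at hlt'
    refine wp_store.2 ?_
    simp only [Expr.eval, hR.r9, hi, h10]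
    simp (disch := omega) only [Nat.mod_eq_of_lt]
    refine ⟨by simp only [Expr.cost, readAt]; omega, le_rfl, by simp, by simp, ?_, ?_⟩
    · intro x hx
      exact Function.update_of_ne (by omega) _ _
    · intro x hx y hy
      by_cases hxy : x = a ∧ y = b
      · obtain ⟨rfl, rfl⟩ := hxy
        simp [hlt']
      · rw [Function.update_of_ne]
        · simpa [hxy] using hD x hx y hy
        · intro h'
          exact hxy (idx_inj hy hb (by omega))
  · rw [e1] at h
    have hlt' : ¬ c < μ (μ (E.PR + (a * E.N.n + b))) := by by_contra h'; simp [h'] at h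
    refine wp_skip.2 ⟨by simp only [Expr.cost, readAt]; omega, le_rfl, rfl, rfl, fun _ _ => rfl, ?_⟩
    intro x hx y hy
    by_cases hxy : x = a ∧ y = b
    · obtain ⟨rfl, rfl⟩ := hxy
      by_cases hd : D x y ∧ c < cap x y
      · simpa [hd] using hcur
      · rw [hcur.2 hd, hcap] at hlt'
        simpa [hlt'] using hcur.2 hd
    · simpa [hxy] using hD x hx y hy

theorem improveAll_spec (E : Env) {V : ℕ → ℕ} {μ : Mem} {τ : List ℕ} {x H c la : ℕ}
    {ptr cap : ℕ → ℕ → ℕ} {D : ℕ → ℕ → Prop}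
    (hR : E.Regs V) (hx : x < E.N.n) (h30 : V 30 = x) (h10 : V 10 = H) (h19 : V 19 = c)
    (h20 : V 20 = la) (hla : la ≤ E.N.n) (hlist : ∀ i < la, μ (E.LA + i) < E.N.n)
    (hH0 : E.H0 ≤ H) (hH : μ H = c)
    (hptr : ∀ a < E.N.n, ∀ b < E.N.n, E.H0 ≤ ptr a b)
    (hcap : ∀ a < E.N.n, ∀ b < E.N.n, μ (ptr a b) = cap a b)
    (hD : E.Improved H c ptr cap D μ) :
    Run E.w E.O improveAllCmd ⟨V, μ, τ⟩ (80 * (la + 1)) 0 fun σ =>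
      (∀ y, y ≠ 31 → σ.vars y = V y) ∧ σ.tape = τ ∧
      (∀ y, ¬ (E.PR ≤ y ∧ y < E.PR + E.N.n * E.N.n) → σ.mem y = μ y) ∧
      E.Improved H c ptr cap (fun a b => D a b ∨
        ∃ i < la, (a = μ (E.LA + i) ∧ b = x) ∨ (a = x ∧ b = μ (E.LA + i))) σ.mem := by
  obtain ⟨l1, l2, l3, l4, l5, l6, l7, l8, l9⟩ := E.layout
  refine Run.for (cnt := la) (fun k σ => σ.vars = Function.update V 31 k ∧ σ.tape = τ ∧
      (∀ y, ¬ (E.PR ≤ y ∧ y < E.PR + E.N.n * E.N.n) → σ.mem y = μ y) ∧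
      E.Improved H c ptr cap (fun a b => D a b ∨
        ∃ i < k, (a = μ (E.LA + i) ∧ b = x) ∨ (a = x ∧ b = μ (E.LA + i))) σ.mem)
    (fun _ => 72) (by omega) ⟨rfl, rfl, fun _ _ => rfl, ?_⟩ ?_ ?_ ?_ ?_
  · exact hD.congr (fun _ _ _ => rfl) (by simp)
  · rintro k hk ⟨V', μ', τ'⟩ ⟨rfl, -, -, -⟩
    simp [Expr.eval, h20]
  · rintro k hk ⟨V', μ', τ'⟩ ⟨rfl, rfl, hf, hD'⟩
    have hR' : E.Regs (Function.update V 31 k) := hR.update 31 k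
    have ha := hlist k hk
    have e1 : ∀ μ'' : Mem, (∀ y, ¬ (E.PR ≤ y ∧ y < E.PR + E.N.n * E.N.n) → μ'' y = μ y) →
        (readAt 7 (.var 31)).eval E.w ⟨Function.update V 31 k, μ'', τ'⟩ = μ (E.LA + k) := by
      intro μ'' h
      simp only [readAt, Expr.eval, ne_eq, Nat.reduceEqDiff, not_false_eq_true,
        Function.update_of_ne, Function.update_self, hR.r7]
      simp (disch := omega) only [Nat.mod_eq_of_lt]
      exact h _ (by omega)
    have hi1 := idx_lt ha hx
    have hi2 := idx_lt hx ha
    refine Run.seq (T₁ := 34) (R₁ := 0) (T₂ := 34) (R₂ := 0)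
      ((improve_spec E (a := μ (E.LA + k)) (b := x) (H := H) (c := c) (ptr := ptr) (cap := cap)
        hR' ha hx (by simp [h10]) (by simp [h19]) ?_ ?_ ?_ hD').mono ?_ le_rfl fun _ h => h) ?_
      (by omega) le_rfl
    · simp only [Expr.eval, e1 μ' hf, ne_eq, Nat.reduceEqDiff, not_false_eq_true,
        Function.update_of_ne, hR.r0, h30]
      simp (disch := omega) only [Nat.mod_eq_of_lt]
    · rw [hf _ (by omega), hH]
    · have := hptr _ ha _ hx
      rw [hf _ (by omega), hcap _ ha _ hx]
    · simp [Expr.cost, readAt]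
    rintro ⟨V₁, μ₁, τ₁⟩ ⟨hV₁, hτ₁, hf₁, hD₁⟩
    simp only at hV₁ hτ₁ hf₁ hD₁
    subst hV₁ hτ₁
    have hf₂ : ∀ y, ¬ (E.PR ≤ y ∧ y < E.PR + E.N.n * E.N.n) → μ₁ y = μ y :=
      fun y hy => (hf₁ y hy).trans (hf y hy)
    refine (improve_spec E (a := x) (b := μ (E.LA + k)) (H := H) (c := c) (ptr := ptr) (cap := cap)
        hR' hx ha (by simp [h10]) (by simp [h19]) ?_ ?_ ?_ hD₁).mono ?_ le_rfl ?_
    · simp only [Expr.eval, e1 μ₁ hf₂, ne_eq, Nat.reduceEqDiff, not_false_eq_true,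
        Function.update_of_ne, hR.r0, h30]
      simp (disch := omega) only [Nat.mod_eq_of_lt]
    · rw [hf₂ _ (by omega), hH]
    · have := hptr _ hx _ ha
      rw [hf₂ _ (by omega), hcap _ hx _ ha]
    · simp [Expr.cost, readAt]
    rintro ⟨V₂, μ₂, τ₂⟩ ⟨hV₂, hτ₂, hf₃, hD₂⟩
    simp only at hV₂ hτ₂ hf₃ hD₂
    subst hV₂ hτ₂
    refine ⟨by simp, by simp, rfl, fun y hy => (hf₃ y hy).trans (hf₂ y hy), ?_⟩
    refine hD₂.congr (fun _ _ _ => rfl) fun a _ b _ => ?_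
    constructor
    · rintro (((h | ⟨i, hi, h⟩) | h) | h)
      · exact Or.inl h
      · exact Or.inr ⟨i, by omega, h⟩
      · exact Or.inr ⟨k, by omega, Or.inl h⟩
      · exact Or.inr ⟨k, by omega, Or.inr h⟩
    · rintro (h | ⟨i, hi, h⟩)
      · exact Or.inl (Or.inl (Or.inl h))
      · rcases Nat.lt_succ_iff_lt_or_eq.1 hi with hi | rfl
        · exact Or.inl (Or.inl (Or.inr ⟨i, hi, h⟩))
        · rcases h with h | h
          · exact Or.inl (Or.inr h)
          · exact Or.inr h
  · simp only [Finset.sum_const, Finset.card_range, smul_eq_mul, Expr.cost]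
    omega
  · rintro ⟨V', μ', τ'⟩ ⟨rfl, rfl, hf, hD'⟩
    exact ⟨fun y hy => by simp [hy], rfl, hf, hD'⟩

/-! ### Splitting a part on the machine -/

section Split

/-- The crossing pairs whose far endpoint is `k` are `k` together with the nodes on the side of the
representative, in both orders. These are the entries visited when `k` is moved. -/
theorem Net.crossing_lt_succ {part : ℕ → ℕ} {r k : ℕ} {S : ℕ → Prop}
    (hc : part k = r ∧ ¬ (S k ↔ S r)) (a b : ℕ) :
    ((Net.Crossing part r S a b ∧ ((¬ (S a ↔ S r) ∧ a < k) ∨ (¬ (S b ↔ S r) ∧ b < k))) ∨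
      ((part a = r ∧ (S a ↔ S r)) ∧ b = k) ∨ (a = k ∧ (part b = r ∧ (S b ↔ S r)))) ↔
    Net.Crossing part r S a b ∧ ((¬ (S a ↔ S r) ∧ a < k + 1) ∨ (¬ (S b ↔ S r) ∧ b < k + 1)) := by
  simp only [Net.Crossing]
  constructor
  · rintro (⟨h1, h2⟩ | ⟨h1, rfl⟩ | ⟨rfl, h1⟩)
    · exact ⟨h1, h2.imp (fun h => ⟨h.1, by omega⟩) (fun h => ⟨h.1, by omega⟩)⟩
    · exact ⟨⟨h1.1, hc.1, by tauto⟩, Or.inr ⟨hc.2, by omega⟩⟩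
    · exact ⟨⟨hc.1, h1.1, by tauto⟩, Or.inl ⟨hc.2, by omega⟩⟩
  · rintro ⟨h1, ⟨h2, h3⟩ | ⟨h2, h3⟩⟩
    · rcases Nat.lt_succ_iff_lt_or_eq.1 h3 with h3 | rfl
      · exact Or.inl ⟨h1, Or.inl ⟨h2, h3⟩⟩
      · exact Or.inr (Or.inr ⟨rfl, h1.2.1, by tauto⟩)
    · rcases Nat.lt_succ_iff_lt_or_eq.1 h3 with h3 | rfl
      · exact Or.inl ⟨h1, Or.inr ⟨h2, h3⟩⟩
      · exact Or.inr (Or.inl ⟨⟨h1.1, by tauto⟩, rfl⟩)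

theorem Net.crossing_lt_succ_of_not {part : ℕ → ℕ} {r k : ℕ} {S : ℕ → Prop}
    (hc : ¬ (part k = r ∧ ¬ (S k ↔ S r))) (a b : ℕ) :
    (Net.Crossing part r S a b ∧ ((¬ (S a ↔ S r) ∧ a < k) ∨ (¬ (S b ↔ S r) ∧ b < k))) ↔
    Net.Crossing part r S a b ∧ ((¬ (S a ↔ S r) ∧ a < k + 1) ∨ (¬ (S b ↔ S r) ∧ b < k + 1)) := by
  simp only [Net.Crossing]
  constructor
  · rintro ⟨h1, h2⟩
    exact ⟨h1, h2.imp (fun h => ⟨h.1, by omega⟩) (fun h => ⟨h.1, by omega⟩)⟩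
  · rintro ⟨h1, ⟨h2, h3⟩ | ⟨h2, h3⟩⟩
    · rcases Nat.lt_succ_iff_lt_or_eq.1 h3 with h3 | rfl
      · exact ⟨h1, Or.inl ⟨h2, h3⟩⟩
      · exact absurd ⟨h1.1, h2⟩ hc
    · rcases Nat.lt_succ_iff_lt_or_eq.1 h3 with h3 | rfl
      · exact ⟨h1, Or.inr ⟨h2, h3⟩⟩
      · exact absurd ⟨h1.2.1, h2⟩ hc

-- Each node is stored behind the list unconditionally, and the counter advances by the indicator of
-- membership. A rejected node is overwritten by the next one or stays beyond the end; since the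
-- counter is at most the number of earlier nodes, all writes stay in the block.
open Classical in
theorem list_spec (E : Env) {V : ℕ → ℕ} {μ : Mem} {τ : List ℕ} {r H : ℕ} {part : ℕ → ℕ}
    {S : ℕ → Prop}
    (hR : E.Regs V) (hr : r < E.N.n) (h18 : V 18 = r) (h10 : V 10 = H)
    (hH0 : E.H0 ≤ H) (hH : H ≤ E.hmax) (hS : ∀ x < E.N.n, (S x ↔ μ (H + 2 + x) ≠ 0))
    (h21 : V 21 = if S r then 0 else 1) (hpart : ∀ x < E.N.n, μ (E.PT + x) = part x) :
    Run E.w E.O listCmd ⟨V, μ, τ⟩ (70 * (E.N.n + 1)) 0 fun σ =>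
      (∀ y, y ≠ 20 → y ≠ 30 → σ.vars y = V y) ∧ σ.tape = τ ∧
      σ.vars 20 = ((Finset.range E.N.n).filter fun x => part x = r ∧ (S x ↔ S r)).card ∧
      (∀ y, ¬ (E.LA ≤ y ∧ y < E.LA + E.N.n) → σ.mem y = μ y) ∧
      (∀ a, (∃ i < σ.vars 20, σ.mem (E.LA + i) = a) ↔ a < E.N.n ∧ part a = r ∧ (S a ↔ S r)) := by
  obtain ⟨l1, l2, l3, l4, l5, l6, l7, l8, l9⟩ := E.layout
  refine wp_seq.2 (wp_assign.2 ?_)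
  simp only [Expr.eval, Nat.zero_mod]
  set cnt : ℕ → ℕ := fun k => ((Finset.range k).filter fun x => part x = r ∧ (S x ↔ S r)).card
    with hcnt
  have hcs : ∀ k, cnt (k + 1) = cnt k + if part k = r ∧ (S k ↔ S r) then 1 else 0 := by
    intro k
    simp only [hcnt, Finset.range_add_one, Finset.filter_insert]
    split_ifs <;> simp
  have hcle : ∀ k, cnt k ≤ k := fun k =>
    (Finset.card_filter_le _ _).trans (Finset.card_range k).le
  refine Run.wp (T := 60 * (E.N.n + 1)) (R := 0) (P := fun σ =>
      (∀ y, y ≠ 20 → y ≠ 30 → σ.vars y = V y) ∧ σ.tape = τ ∧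
      σ.vars 20 = cnt E.N.n ∧
      (∀ y, ¬ (E.LA ≤ y ∧ y < E.LA + E.N.n) → σ.mem y = μ y) ∧
      (∀ a, (∃ i < σ.vars 20, σ.mem (E.LA + i) = a) ↔ a < E.N.n ∧ part a = r ∧ (S a ↔ S r))) ?_ ?_
  · refine Run.for (cnt := E.N.n) (fun k σ =>
      (∀ y, y ≠ 20 → y ≠ 30 → σ.vars y = V y) ∧ σ.tape = τ ∧
      σ.vars 20 = cnt k ∧ σ.vars 30 = k ∧
      (∀ y, ¬ (E.LA ≤ y ∧ y < E.LA + E.N.n) → σ.mem y = μ y) ∧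
      (∀ a, (∃ i < σ.vars 20, σ.mem (E.LA + i) = a) ↔ a < k ∧ part a = r ∧ (S a ↔ S r)))
      (fun _ => 50) (by omega) ?_ ?_ ?_ ?_ ?_
    · refine ⟨?_, rfl, ?_, by simp, fun _ _ => rfl, ?_⟩
      · intro y hy hy'; simp [hy, hy']
      · simp [hcnt]
      · intro a; simp
    · rintro k hk ⟨V', μ', τ'⟩ ⟨hV, -, -, h30, -, -⟩
      simp only at hV h30
      refine ⟨?_, h30⟩
      simp only [Expr.eval]
      rw [hV 0 (by decide) (by decide), hR.r0]
    · rintro k hk ⟨V', μ', τ'⟩ ⟨hV, rfl, h20, h30, hf, hL⟩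
      simp only at hV h20 h30 hf hL
      have hck := hcle k
      have h5 : V' 5 = E.PT := by rw [hV 5 (by decide) (by decide), hR.r5]
      have h7 : V' 7 = E.LA := by rw [hV 7 (by decide) (by decide), hR.r7]
      have h10' : V' 10 = H := by rw [hV 10 (by decide) (by decide), h10]
      have h18' : V' 18 = r := by rw [hV 18 (by decide) (by decide), h18]
      have h21' : V' 21 = if S r then 0 else 1 := by rw [hV 21 (by decide) (by decide), h21]
      refine wp_seq.2 (wp_store.2 (wp_assign.2 ?_))
      simp only [Expr.eval, readAt, readSide, h7, h20, h30, h5, h10', h18', h21']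
      simp (disch := omega) only [Nat.mod_eq_of_lt]
      have hm1 : Function.update μ' (E.LA + cnt k) k (E.PT + k) = part k := by
        rw [Function.update_of_ne (by omega), hf _ (by omega), hpart k hk]
      have hm2 : Function.update μ' (E.LA + cnt k) k (H + 2 + k) = μ (H + 2 + k) := by
        rw [Function.update_of_ne (by omega), hf _ (by omega)]
      have hval : (cnt k + ((if part k = r then 1 else 0) *
          if (if μ (H + 2 + k) = 0 then 1 else 0) = if S r then 0 else 1 then 1 else 0) % 2 ^ E.w)
          % 2 ^ E.w = cnt (k + 1) := by
        have hSk := hS k hk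
        rw [hcs]
        by_cases h1 : part k = r <;> by_cases h2 : μ (H + 2 + k) = 0 <;> by_cases h3 : S r <;>
          simp only [h1, h2, h3, hSk, ne_eq, not_true_eq_false, not_false_eq_true, if_true,
            if_false, true_and, false_and, and_self, iff_self, iff_true, iff_false, true_iff,
            false_iff, one_ne_zero, zero_ne_one, mul_one, mul_zero, zero_mul, Nat.zero_mod,
            and_true, and_false] <;>
          simp (disch := omega) only [Nat.mod_eq_of_lt]
      simp only [hm1, hm2, hval]
      refine ⟨by simp [Expr.cost], by simp, by simp [h30], ?_, by simp, by simp, by simp, ?_, ?_⟩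
      · intro y hy hy'; simp [hy, hy', hV y hy hy']
      · intro y hy
        rw [Function.update_of_ne (by omega), hf y hy]
      · intro a
        simp only [ne_eq, Nat.reduceEqDiff, not_false_eq_true, Function.update_of_ne,
          Function.update_self]
        have hold : ∀ i < cnt k, Function.update μ' (E.LA + cnt k) k (E.LA + i) = μ' (E.LA + i) :=
          fun i hi => Function.update_of_ne (by omega) _ _
        rw [h20] at hL
        constructor
        · rintro ⟨i, hi, rfl⟩
          by_cases hik : i < cnt k
          · rw [hold i hik]
            obtain ⟨h1, h2⟩ := (hL (μ' (E.LA + i))).1 ⟨i, hik, rfl⟩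
            exact ⟨by omega, h2⟩
          · have hcs' := hcs k
            split_ifs at hcs' with h
            · obtain rfl : i = cnt k := by omega
              rw [Function.update_self]
              exact ⟨by omega, h⟩
            · omega
        · rintro ⟨h1, h2⟩
          have hcs' := hcs k
          rcases Nat.lt_succ_iff_lt_or_eq.1 h1 with h1 | rfl
          · obtain ⟨i, hi, he⟩ := (hL a).2 ⟨h1, h2⟩
            exact ⟨i, by omega, by rw [hold i hi, he]⟩
          · rw [if_pos h2] at hcs'
            exact ⟨cnt a, by omega, Function.update_self ..⟩
    · simp only [Finset.sum_const, Finset.card_range, smul_eq_mul, Expr.cost]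
      omega
    · rintro ⟨V', μ', τ'⟩ ⟨hV, hτ, h20, -, hf, hL⟩
      exact ⟨hV, hτ, h20, hf, hL⟩
  · intro σ' t r' ht hr' hσ
    refine ⟨?_, by omega, hσ⟩
    simp only [Expr.cost]
    omega

-- A round costs a constant plus, for a moved node, the length of the list. The sum contains the
-- product of the two sides, which `Refining.openPairs_split` pays for.
set_option maxHeartbeats 1000000 in
open Classical in
theorem move_spec (E : Env) {V : ℕ → ℕ} {μ : Mem} {τ : List ℕ} {r v H c la : ℕ} {part : ℕ → ℕ}
    {S : ℕ → Prop} {ptr cap : ℕ → ℕ → ℕ}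
    (hR : E.Regs V) (hr : r < E.N.n) (hv : v < E.N.n) (h17 : V 17 = v)
    (h18 : V 18 = r) (h10 : V 10 = H) (h19 : V 19 = c) (h20 : V 20 = la) (hla : la ≤ E.N.n)
    (hH0 : E.H0 ≤ H) (hHm : H ≤ E.hmax) (hS : ∀ x < E.N.n, (S x ↔ μ (H + 2 + x) ≠ 0))
    (h21 : V 21 = if S r then 0 else 1) (hpart : ∀ x < E.N.n, μ (E.PT + x) = part x)
    (hlist : ∀ a, (∃ i < la, μ (E.LA + i) = a) ↔ a < E.N.n ∧ part a = r ∧ (S a ↔ S r))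
    (hH : μ H = c)
    (hptr : ∀ a < E.N.n, ∀ b < E.N.n, E.H0 ≤ ptr a b)
    (hcap : ∀ a < E.N.n, ∀ b < E.N.n, μ (ptr a b) = cap a b)
    (hD : E.Improved H c ptr cap (fun _ _ => False) μ) :
    Run E.w E.O moveCmd ⟨V, μ, τ⟩ (150 * (E.N.n + 1) + 80 * (la *
        ((Finset.range E.N.n).filter fun x => part x = r ∧ ¬ (S x ↔ S r)).card)) 0 fun σ =>
      (∀ y, y ≠ 30 → y ≠ 31 → σ.vars y = V y) ∧ σ.tape = τ ∧
      (∀ y, ¬ (E.PT ≤ y ∧ y < E.PT + E.N.n) → ¬ (E.PR ≤ y ∧ y < E.PR + E.N.n * E.N.n) →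
        σ.mem y = μ y) ∧
      (∀ x < E.N.n, σ.mem (E.PT + x) = Net.splitPart part r v S x) ∧
      E.Improved H c ptr cap (Net.Crossing part r S) σ.mem := by
  obtain ⟨l1, l2, l3, l4, l5, l6, l7, l8, l9⟩ := E.layout
  refine Run.for (cnt := E.N.n) (fun k σ =>
      (∀ y, y ≠ 30 → y ≠ 31 → σ.vars y = V y) ∧ σ.tape = τ ∧ σ.vars 30 = k ∧
      (∀ y, ¬ (E.PT ≤ y ∧ y < E.PT + E.N.n) → ¬ (E.PR ≤ y ∧ y < E.PR + E.N.n * E.N.n) →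
        σ.mem y = μ y) ∧
      (∀ x < E.N.n, σ.mem (E.PT + x) = if x < k then Net.splitPart part r v S x else part x) ∧
      E.Improved H c ptr cap (fun a b => Net.Crossing part r S a b ∧
        ((¬ (S a ↔ S r) ∧ a < k) ∨ (¬ (S b ↔ S r) ∧ b < k))) σ.mem)
      (fun k => 120 + if part k = r ∧ ¬ (S k ↔ S r) then 80 * la else 0) (by omega) ?_ ?_ ?_ ?_ ?_
  · refine ⟨?_, rfl, by simp, fun _ _ _ => rfl, ?_, hD.congr (fun _ _ _ => rfl) (by simp)⟩
    · intro y hy hy'; simp [hy]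
    · intro x hx; simp [hpart x hx]
  · rintro k hk ⟨V', μ', τ'⟩ ⟨hV, -, h30, -, -, -⟩
    simp only at hV h30
    refine ⟨?_, h30⟩
    simp only [Expr.eval]
    rw [hV 0 (by decide) (by decide), hR.r0]
  · rintro k hk ⟨V', μ', τ'⟩ ⟨hV, rfl, h30, hf, hP, hD'⟩
    simp only at hV h30 hf hP hD'
    have hR' : E.Regs V' := by
      constructor <;> rw [hV _ (by decide) (by decide)]
      exacts [hR.r0, hR.r1, hR.r2, hR.r3, hR.r4, hR.r5, hR.r6, hR.r7, hR.r9]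
    have h10' : V' 10 = H := by rw [hV 10 (by decide) (by decide), h10]
    have h17' : V' 17 = v := by rw [hV 17 (by decide) (by decide), h17]
    have h18' : V' 18 = r := by rw [hV 18 (by decide) (by decide), h18]
    have h19' : V' 19 = c := by rw [hV 19 (by decide) (by decide), h19]
    have h20' : V' 20 = la := by rw [hV 20 (by decide) (by decide), h20]
    have h21' : V' 21 = if S r then 0 else 1 := by rw [hV 21 (by decide) (by decide), h21]
    have hSk := hS k hk
    have hPk := hP k hk
    have hw : 0 < E.w := by
      rcases Nat.eq_zero_or_pos E.w with h | h
      · simp [h] at l8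
      · exact h
    rw [if_neg (by omega)] at hPk
    have e1 : (Expr.mul (.eq (readAt 5 (.var 30)) (.var 18))
        (.ne (.eq (readSide (.var 30)) (.const 0)) (.var 21))).eval E.w ⟨V', μ', τ'⟩ =
        if part k = r ∧ ¬ (S k ↔ S r) then 1 else 0 := by
      simp only [Expr.eval, Expr.eval_ne, readAt, readSide, h30, hR'.r5, h10', h18', h21']
      simp (disch := omega) only [Nat.mod_eq_of_lt]
      rw [hPk, hf (H + 2 + k) (by omega) (by omega)]
      by_cases h1 : part k = r <;> by_cases h2 : μ (H + 2 + k) = 0 <;> by_cases h3 : S r <;>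
        simp [h1, h2, h3, hSk] <;> omega
    refine wp_ite.2 ⟨fun h => ?_, fun h => ?_⟩
    · rw [e1] at h
      have hc : part k = r ∧ ¬ (S k ↔ S r) := by by_contra h'; simp [h'] at h
      simp only [if_pos hc]
      refine wp_seq.2 (wp_store.2 ?_)
      simp only [Expr.eval, h30, hR'.r5, h17']
      simp (disch := omega) only [Nat.mod_eq_of_lt]
      have hf1 : ∀ y, ¬ (E.PT ≤ y ∧ y < E.PT + E.N.n) →
          ¬ (E.PR ≤ y ∧ y < E.PR + E.N.n * E.N.n) →
          Function.update μ' (E.PT + k) v y = μ y := by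
        intro y hy hy'
        rw [Function.update_of_ne (by omega), hf y hy hy']
      have hLA : ∀ i < la, Function.update μ' (E.PT + k) v (E.LA + i) = μ (E.LA + i) :=
        fun i hi => hf1 _ (by omega) (by omega)
      refine Run.wp (improveAll_spec E (x := k) (H := H) (c := c) (la := la) (ptr := ptr)
        (cap := cap) (D := fun a b => Net.Crossing part r S a b ∧
        ((¬ (S a ↔ S r) ∧ a < k) ∨ (¬ (S b ↔ S r) ∧ b < k))) hR' hk h30 h10' h19' h20' hla ?_ hH0
        ?_ hptr ?_ ?_) ?_
      · intro i hi
        rw [hLA i hi]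
        exact ((hlist _).1 ⟨i, hi, rfl⟩).1
      · rw [hf1 _ (by omega) (by omega), hH]
      · intro a ha b hb
        have := hptr a ha b hb
        rw [hf1 _ (by omega) (by omega), hcap a ha b hb]
      · exact hD'.congr (fun a h1 h2 => Function.update_of_ne (by omega) _ _) (fun _ _ _ _ => Iff.rfl)
      · rintro ⟨V₁, μ₁, τ₁⟩ t r' ht hr' ⟨hV₁, hτ₁, hf₁, hD₁⟩
        simp only at hV₁ hτ₁ hf₁ hD₁
        subst hτ₁
        refine ⟨?_, by omega, ?_, ?_, by simp, by simp, ?_, ?_, ?_⟩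
        · simp only [Expr.cost, Expr.ne, readAt, readSide]; omega
        · simp only; rw [hV₁ 30 (by decide), h30]
        · intro y hy hy'
          simp only [ne_eq, hy, not_false_eq_true, Function.update_of_ne]
          rw [hV₁ y hy', hV y hy hy']
        · intro y hy hy'
          simp only
          rw [hf₁ y hy', hf1 y hy hy']
        · intro x hx
          simp only
          rw [hf₁ _ (by omega)]
          by_cases hxk : x = k
          · subst hxk
            rw [Function.update_self, if_pos (by omega), Net.splitPart_eq hc.1 hc.2]
          · rw [Function.update_of_ne (by omega), hP x hx]
            by_cases hxk' : x < k
            · rw [if_pos hxk', if_pos (by omega)]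
            · rw [if_neg hxk', if_neg (by omega)]
        · refine hD₁.congr (fun _ _ _ => rfl) fun a ha b hb => ?_
          have hex : (∃ i < la, (a = Function.update μ' (E.PT + k) v (E.LA + i) ∧ b = k) ∨
              (a = k ∧ b = Function.update μ' (E.PT + k) v (E.LA + i))) ↔
              ((part a = r ∧ (S a ↔ S r)) ∧ b = k) ∨ (a = k ∧ (part b = r ∧ (S b ↔ S r))) := by
            constructor
            · rintro ⟨i, hi, h | h⟩
              · rw [hLA i hi] at h
                exact Or.inl ⟨((hlist a).1 ⟨i, hi, h.1.symm⟩).2, h.2⟩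
              · rw [hLA i hi] at h
                exact Or.inr ⟨h.1, ((hlist b).1 ⟨i, hi, h.2.symm⟩).2⟩
            · rintro (⟨h1, h2⟩ | ⟨h1, h2⟩)
              · obtain ⟨i, hi, he⟩ := (hlist a).2 ⟨ha, h1⟩
                exact ⟨i, hi, Or.inl ⟨by rw [hLA i hi, he], h2⟩⟩
              · obtain ⟨i, hi, he⟩ := (hlist b).2 ⟨hb, h2⟩
                exact ⟨i, hi, Or.inr ⟨h1, by rw [hLA i hi, he]⟩⟩
          rw [hex]
          exact Net.crossing_lt_succ hc a b
    · rw [e1] at h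
      have hc : ¬ (part k = r ∧ ¬ (S k ↔ S r)) := by by_contra h'; simp [h'] at h
      simp only [if_neg hc]
      refine wp_skip.2 ⟨?_, le_rfl, h30, ?_, by simp, by simp, hf, ?_, ?_⟩
      · simp only [Expr.cost, Expr.ne, readAt, readSide]; omega
      · intro y hy hy'
        simp only [ne_eq, hy, not_false_eq_true, Function.update_of_ne]
        rw [hV y hy hy']
      · intro x hx
        simp only
        rw [hP x hx]
        by_cases hxk : x = k
        · subst hxk
          rw [if_neg (by omega), if_pos (by omega), Net.splitPart_eq_self hc]
        · by_cases hxk' : x < k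
          · rw [if_pos hxk', if_pos (by omega)]
          · rw [if_neg hxk', if_neg (by omega)]
      · refine hD'.congr (fun _ _ _ => rfl) fun a ha b hb => ?_
        exact Net.crossing_lt_succ_of_not hc a b
  · rw [Finset.sum_add_distrib, ← Finset.sum_filter]
    simp only [Finset.sum_const, Finset.card_range, smul_eq_mul, Expr.cost]
    rw [mul_comm la]
    ring_nf
    omega
  · rintro ⟨V', μ', τ'⟩ ⟨hV, hτ, -, hf, hP, hD'⟩
    refine ⟨hV, hτ, hf, ?_, ?_⟩
    · intro x hx
      rw [hP x hx, if_pos hx]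
    · refine hD'.congr (fun _ _ _ => rfl) fun a ha b hb => ?_
      simp only [Net.Crossing]
      constructor
      · exact fun h => h.1
      · intro h
        refine ⟨h, ?_⟩
        by_cases h1 : S a ↔ S r
        · exact Or.inr ⟨by tauto, hb⟩
        · exact Or.inl ⟨h1, ha⟩

open Classical in
theorem split_spec (E : Env) {V : ℕ → ℕ} {μ : Mem} {τ : List ℕ} {r v H c : ℕ} {part : ℕ → ℕ}
    {S : ℕ → Prop} {ptr cap : ℕ → ℕ → ℕ}
    (hR : E.Regs V) (hr : r < E.N.n) (hv : v < E.N.n) (h17 : V 17 = v)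
    (h18 : V 18 = r) (h10 : V 10 = H) (h19 : V 19 = c)
    (hH0 : E.H0 ≤ H) (hHm : H ≤ E.hmax) (hS : ∀ x < E.N.n, (S x ↔ μ (H + 2 + x) ≠ 0))
    (hpart : ∀ x < E.N.n, μ (E.PT + x) = part x)
    (hptr0 : ∀ a < E.N.n, ∀ b < E.N.n, μ (E.PR + (a * E.N.n + b)) = ptr a b)
    (hptr : ∀ a < E.N.n, ∀ b < E.N.n, E.H0 ≤ ptr a b ∧ ptr a b < H)
    (hcap : ∀ a < E.N.n, ∀ b < E.N.n, μ (ptr a b) = cap a b) :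
    Run E.w E.O splitCmd ⟨V, μ, τ⟩ (300 * (E.N.n + 1) + 80 * (
        ((Finset.range E.N.n).filter fun x => part x = r ∧ (S x ↔ S r)).card *
        ((Finset.range E.N.n).filter fun x => part x = r ∧ ¬ (S x ↔ S r)).card)) 0 fun σ =>
      (∀ y < 20, y ≠ 10 → σ.vars y = V y) ∧ σ.vars 10 = H + (E.N.n + 2) ∧
      σ.mem H = c ∧ σ.mem (H + 1) = 0 ∧
      (∀ y, ¬ (E.PT ≤ y ∧ y < E.PT + E.N.n) → ¬ (E.LA ≤ y ∧ y < E.LA + E.N.n) →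
        ¬ (E.PR ≤ y ∧ y < E.PR + E.N.n * E.N.n) → y ≠ H → y ≠ H + 1 → σ.mem y = μ y) ∧
      (∀ x < E.N.n, σ.mem (E.PT + x) = Net.splitPart part r v S x) ∧
      E.Improved H c ptr cap (Net.Crossing part r S) σ.mem := by
  obtain ⟨l1, l2, l3, l4, l5, l6, l7, l8, l9⟩ := E.layout
  refine wp_seq.2 (wp_store.2 (wp_seq.2 (wp_store.2 (wp_seq.2 (wp_assign.2 ?_)))))
  simp only [Expr.eval, h10, h19, h18, Nat.zero_mod, readSide]
  simp (disch := omega) only [Nat.mod_eq_of_lt]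
  set μ₁ := Function.update (Function.update μ H c) (H + 1) 0 with hμ₁
  have hf1 : ∀ y, y ≠ H → y ≠ H + 1 → μ₁ y = μ y := by
    intro y h1 h2
    rw [hμ₁, Function.update_of_ne h2, Function.update_of_ne h1]
  have hH1 : μ₁ H = c := by
    rw [hμ₁, Function.update_of_ne (by omega), Function.update_self]
  have hH2 : μ₁ (H + 1) = 0 := by rw [hμ₁, Function.update_self]
  clear_value μ₁
  rw [hf1 (H + 2 + r) (by omega) (by omega)]
  have hsr : (if μ (H + 2 + r) = 0 then 1 else 0) = if S r then 0 else 1 := by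
    have := hS r hr
    by_cases h : S r
    · rw [if_pos h, if_neg (this.1 h)]
    · rw [if_neg h, if_pos (by tauto)]
  rw [hsr]
  refine wp_seq.2 (Run.wp (list_spec E (r := r) (H := H) (part := part) (S := S) (hR.update 21 _) hr
    (by simp [h18]) (by simp [h10]) hH0 hHm ?_ (by simp) ?_) ?_)
  · intro x hx
    rw [hf1 _ (by omega) (by omega)]; exact hS x hx
  · intro x hx
    rw [hf1 _ (by omega) (by omega)]; exact hpart x hx
  rintro ⟨V₂, μ₂, τ₂⟩ t₂ r₂ ht₂ hr₂ ⟨hV₂, hτ₂, h20, hf2, hL⟩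
  simp only at hV₂ hτ₂ h20 hf2 hL
  have hR₂ : E.Regs V₂ := by
    have hR' := hR.update 21 (if S r then 0 else 1)
    constructor <;> rw [hV₂ _ (by decide) (by decide)]
    exacts [hR'.r0, hR'.r1, hR'.r2, hR'.r3, hR'.r4, hR'.r5, hR'.r6, hR'.r7, hR'.r9]
  have hVV : ∀ y < 20, V₂ y = V y := by
    intro y hy
    rw [hV₂ y (by omega) (by omega), Function.update_of_ne (by omega)]
  refine wp_seq.2 (Run.wp (move_spec E (r := r) (v := v) (H := H) (c := c) (la := V₂ 20)
    (part := part) (S := S) (ptr := ptr) (cap := cap) hR₂ hr hv (by rw [hVV 17 (by decide), h17])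
    (by rw [hVV 18 (by decide), h18]) (by rw [hVV 10 (by decide), h10])
    (by rw [hVV 19 (by decide), h19]) rfl ?_ hH0 hHm ?_ ?_ ?_ hL ?_ (fun a ha b hb =>
      (hptr a ha b hb).1) ?_ ?_) ?_)
  · rw [h20]
    exact (Finset.card_filter_le _ _).trans (Finset.card_range _).le
  · intro x hx
    rw [hf2 _ (by omega), hf1 _ (by omega) (by omega)]; exact hS x hx
  · rw [hV₂ 21 (by decide) (by decide), Function.update_self]
  · intro x hx
    rw [hf2 _ (by omega), hf1 _ (by omega) (by omega)]; exact hpart x hx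
  · rw [hf2 _ (by omega), hH1]
  · intro a ha b hb
    have := hptr a ha b hb
    rw [hf2 _ (by omega), hf1 _ (by omega) (by omega)]; exact hcap a ha b hb
  · intro a ha b hb
    have := idx_lt ha hb
    refine ⟨fun h => h.1.elim, fun _ => ?_⟩
    rw [hf2 _ (by omega), hf1 _ (by omega) (by omega)]; exact hptr0 a ha b hb
  rintro ⟨V₃, μ₃, τ₃⟩ t₃ r₃ ht₃ hr₃ ⟨hV₃, hτ₃, hf3, hP, hD⟩
  simp only at hV₃ hτ₃ hf3 hP hD
  refine wp_assign.2 ⟨?_, by omega, ?_, ?_, ?_, ?_, ?_, hP, hD⟩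
  · rw [← h20]
    simp only [Expr.cost]
    omega
  · intro y hy hy'
    simp only
    rw [Function.update_of_ne hy', hV₃ y (by omega) (by omega), hVV y hy]
  · simp only [Expr.eval, Function.update_self]
    rw [hV₃ 10 (by decide) (by decide), hV₃ 0 (by decide) (by decide), hVV 10 (by decide),
      hVV 0 (by decide), h10, hR.r0]
    simp (disch := omega) only [Nat.mod_eq_of_lt]
  · simp only
    rw [hf3 _ (by omega) (by omega), hf2 _ (by omega), hH1]
  · simp only
    rw [hf3 _ (by omega) (by omega), hf2 _ (by omega), hH2]
  · intro y h1 h2 h3 h4 h5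
    simp only
    rw [hf3 _ h1 h3, hf2 _ h2, hf1 _ h4 h5]

end Split

/-! ### The refinement loop of one task -/

namespace Env

variable (E : Env)

/-- The answers of the subroutine are approximate minimum cuts. -/
structure Sound : Prop where
  sep : ∀ {r v}, r < E.N.n → v < E.N.n → r ≠ v → ¬ (E.ans r v v ≠ 0 ↔ E.ans r v r ≠ 0)
  cap : ∀ {r v}, r < E.N.n → v < E.N.n → r ≠ v →
    E.N.q * E.cutVal (fun x => E.ans r v x ≠ 0) ≤ (E.N.p + E.N.q) * E.N.lam r v
  lam_le : ∀ (S : ℕ → Prop) {u v}, u < E.N.n → v < E.N.n → ¬ (S u ↔ S v) →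
    E.N.lam u v ≤ E.cutVal S

theorem cutVal_congr {S S' : ℕ → Prop} (h : ∀ x < E.N.n, (S x ↔ S' x)) :
    E.cutVal S = E.cutVal S' := by
  unfold cutVal
  refine Finset.sum_congr rfl fun i hi => ?_
  have hi := Finset.mem_range.1 hi
  have h1 := h _ (E.src_lt i hi)
  have h2 := h _ (E.dst_lt i hi)
  by_cases h3 : S (loadList E.inp (4 + 3 * i)) ↔ S (loadList E.inp (4 + 3 * i + 1))
  · rw [if_pos h3, if_pos (by rwa [← h1, ← h2])]
  · rw [if_neg h3, if_neg (by rwa [← h1, ← h2])]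

/-- The entry of the pointer matrix. -/
def ptr (μ : Mem) (u v : ℕ) : ℕ := μ (E.PR + (u * E.N.n + v))

/-- The capacity of the best cut found for `u` and `v`. -/
def val (μ : Mem) (u v : ℕ) : ℕ := μ (E.ptr μ u v)

/-- The side of the cut stored in the record at `a`. -/
def side (μ : Mem) (a : ℕ) : ℕ → Prop := fun x => μ (a + 2 + x) ≠ 0

/-- The pointers point to records below `H`; a record that is not the dummy record holds a
separating cut and its capacity. -/
structure HeapOK (μ : Mem) (H : ℕ) : Prop where
  input : E.HasInput μ
  ge : E.H0 ≤ H
  le : H ≤ E.hmax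
  mul : ∃ k, H = E.H0 + (E.N.n + 2) * k
  ptr_lt : ∀ {u v}, u < E.N.n → v < E.N.n → E.ptr μ u v + (E.N.n + 2) ≤ H
  ptr_mul : ∀ {u v}, u < E.N.n → v < E.N.n → ∃ k, E.ptr μ u v = E.H0 + (E.N.n + 2) * k
  cut : ∀ {u v}, u < E.N.n → v < E.N.n → u ≠ v → E.val μ u v = E.N.tot + 1 ∨
    (E.val μ u v = E.cutVal (side μ (E.ptr μ u v)) ∧
      ¬ (side μ (E.ptr μ u v) u ↔ side μ (E.ptr μ u v) v))

variable {E}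

theorem HeapOK.ptr_ge {μ : Mem} {H u v : ℕ} (h : E.HeapOK μ H) (hu : u < E.N.n) (hv : v < E.N.n) :
    E.H0 ≤ E.ptr μ u v := by
  obtain ⟨k, hk⟩ := h.ptr_mul hu hv
  omega

/-- Apart from the input, the invariant only reads the pointer matrix and the records below `H`.
Arrays below `PR` may therefore change freely and the heap may be extended. -/
theorem HeapOK.frame {μ μ' : Mem} {H H' : ℕ} (h : E.HeapOK μ H) (hH : H ≤ H') (hH' : H' ≤ E.hmax)
    (hm : ∃ k, H' = E.H0 + (E.N.n + 2) * k) (hI : E.HasInput μ')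
    (hP : ∀ a, E.PR ≤ a → a < H → μ' a = μ a) :
    E.HeapOK μ' H' ∧ ∀ {u v}, u < E.N.n → v < E.N.n → E.val μ' u v = E.val μ u v := by
  obtain ⟨l1, l2, l3, l4, l5, l6, l7, l8, l9⟩ := E.layout
  have hge := h.ge
  have hptr : ∀ {u v}, u < E.N.n → v < E.N.n → E.ptr μ' u v = E.ptr μ u v := by
    intro u v hu hv
    have := idx_lt hu hv
    exact hP _ (by omega) (by omega)
  have hval : ∀ {u v}, u < E.N.n → v < E.N.n → E.val μ' u v = E.val μ u v := by
    intro u v hu hv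
    have h1 := h.ptr_lt hu hv
    have h2 := h.ptr_ge hu hv
    rw [val, hptr hu hv, hP _ (by omega) (by omega), val]
  refine ⟨⟨hI, hge.trans hH, hH', hm, ?_, ?_, ?_⟩, hval⟩
  · intro u v hu hv
    rw [hptr hu hv]; exact (h.ptr_lt hu hv).trans hH
  · intro u v hu hv
    rw [hptr hu hv]; exact h.ptr_mul hu hv
  · intro u v hu hv huv
    have h1 := h.ptr_lt hu hv
    have h2 := h.ptr_ge hu hv
    have hs : ∀ x < E.N.n, (side μ' (E.ptr μ u v) x ↔ side μ (E.ptr μ u v) x) := by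
      intro x hx
      simp only [side]
      rw [hP _ (by omega) (by omega)]
    rw [hval hu hv, hptr hu hv, E.cutVal_congr hs, hs u hu, hs v hv]
    exact h.cut hu hv huv

/-- The record at `a` holds the task `τ`. -/
def HoldsRec (n : ℕ) (μ : Mem) (a : ℕ) (τ : RefTask) : Prop :=
  μ a = τ.lo ∧ μ (a + 1) = τ.hi ∧ ∀ x < n, μ (a + 2 + x) = τ.lab x

/-- The records from `a` on hold the tasks in the list. -/
def HoldsRecs (n : ℕ) (μ : Mem) : ℕ → List RefTask → Prop
  | _, [] => True
  | a, τ :: l => HoldsRec n μ a τ ∧ HoldsRecs n μ (a + (n + 2)) l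

theorem HoldsRec.frame {n a : ℕ} {μ μ' : Mem} {τ : RefTask} (h : HoldsRec n μ a τ)
    (hf : ∀ x, a ≤ x → x < a + (n + 2) → μ' x = μ x) : HoldsRec n μ' a τ := by
  refine ⟨?_, ?_, fun x hx => ?_⟩
  · rw [hf _ (by omega) (by omega), h.1]
  · rw [hf _ (by omega) (by omega), h.2.1]
  · rw [hf _ (by omega) (by omega), h.2.2 x hx]

theorem HoldsRecs.frame {n : ℕ} {μ μ' : Mem} {l : List RefTask} : ∀ {a : ℕ}, HoldsRecs n μ a l →
    (∀ x, a ≤ x → x < a + (n + 2) * l.length → μ' x = μ x) → HoldsRecs n μ' a l := by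
  induction l with
  | nil => intros; trivial
  | cons τ l ih =>
    rintro a ⟨h1, h2⟩ hf
    simp only [List.length_cons, mul_add, mul_one] at hf
    exact ⟨h1.frame fun x hx hx' => hf x hx (by omega),
      ih h2 fun x hx hx' => hf x (by omega) (by omega)⟩

theorem HoldsRecs.append {n : ℕ} {μ : Mem} {l l' : List RefTask} : ∀ {a : ℕ}, HoldsRecs n μ a l →
    HoldsRecs n μ (a + (n + 2) * l.length) l' → HoldsRecs n μ a (l ++ l') := by
  induction l with
  | nil => intro a _ h; simpa using h
  | cons τ l ih =>
    rintro a ⟨h1, h2⟩ h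
    refine ⟨h1, ih h2 ?_⟩
    convert h using 1
    simp only [List.length_cons]
    ring

end Env

/-- Scans the nodes; whenever a node is not linked to its representative, queries this pair, and
merges classes or splits the part. -/
def scanCmd : Cmd :=
  .loop (.lt (.var 17) (.var 0)) <|
    .ite (.ne (readAt 6 (.var 17)) (.load (.add (.var 6) (readAt 5 (.var 17)))))
      (.seq queryCmd <| .seq (.ite (.lt (.var 15) (.var 19)) mergeCmd splitCmd) <|
        .seq (.assign 17 (.const 0)) (.assign 16 (.const 1)))
      (.assign 17 (.add (.var 17) (.const 1)))

/-! ### The scan of one task -/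

namespace Env

/-- The invariant of `scanCmd`; the scan started on the memory `μ₀` with the heap ending at `H₀`,
`l` are the records appended since. -/
structure Scan (E : Env) (τ : RefTask) (mid : ℕ) (V₀ : ℕ → ℕ) (μ₀ : Mem) (H₀ : ℕ)
    (mg part : ℕ → ℕ) (l : List RefTask) (σ : State) : Prop where
  regs : E.Regs σ.vars
  cur_eq : σ.vars 11 = V₀ 11
  lo_eq : σ.vars 13 = V₀ 13
  hi_eq : σ.vars 14 = V₀ 14
  mid_eq : σ.vars 15 = mid
  mg_eq : ∀ x < E.N.n, σ.mem (E.MG + x) = mg x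
  mg_le : ∀ x < E.N.n, mg x ≤ E.N.n
  part_eq : ∀ x < E.N.n, σ.mem (E.PT + x) = part x
  heap : E.HeapOK σ.mem (H₀ + (E.N.n + 2) * l.length)
  hp : σ.vars 10 = H₀ + (E.N.n + 2) * l.length
  recs : HoldsRecs E.N.n σ.mem H₀ l
  skip : ∀ τ' ∈ l, τ'.hi = 0
  frame : ∀ a, E.H0 ≤ a → a < H₀ → σ.mem a = μ₀ a
  mono : ∀ {u v}, u < E.N.n → v < E.N.n → E.val σ.mem u v ≤ E.val μ₀ u v
  ref : Net.Refining E.N τ mid mg part (E.val σ.mem)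
  -- With register `16` still `0` there has been no query and classes and parts are as at the start;
  -- then a settled task has no pair left and needs no subtasks.
  flag : σ.vars 16 = 0 → l = [] ∧ (∀ x < E.N.n, mg x = τ.lab x) ∧
    ∀ x < E.N.n, ∀ y < E.N.n, τ.lab x ≠ 0 → τ.lab y ≠ 0 → part x = part y
  two_le : σ.vars 16 ≠ 0 → 2 ≤ Net.numLab E.N.n τ.lab
  -- Each appended record is paid for by a new part, and one part exists from the beginning. So at
  -- most `numLab - 1` cuts are stored.
  len : l.length + (Net.numLab E.N.n τ.lab - (Net.reps E.N.n τ.lab part).card) ≤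
    Net.numLab E.N.n τ.lab - 1

/-- An entry changes only if its pair crosses the cut and the new capacity is smaller. So values
never increase, every crossing pair ends with at most `c`, and the new record separates each pair
that points to it. -/
theorem improved_update {E : Env} {μ μ' : Mem} {H c r : ℕ} {part : ℕ → ℕ}
    {S : ℕ → Prop}
    (h : E.HeapOK μ H) (hH : H + (E.N.n + 2) ≤ E.hmax) (hI : E.HasInput μ')
    (hf : ∀ a, E.H0 ≤ a → a < H → μ' a = μ a) (hc : μ' H = c)
    (hSv : ∀ x < E.N.n, (S x ↔ μ' (H + 2 + x) ≠ 0)) (hcS : c = E.cutVal S)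
    (hD : E.Improved H c (E.ptr μ) (E.val μ) (Net.Crossing part r S) μ') :
    E.HeapOK μ' (H + (E.N.n + 2)) ∧
    (∀ {a b}, a < E.N.n → b < E.N.n → E.val μ' a b ≤ E.val μ a b) ∧
    (∀ {a b}, a < E.N.n → b < E.N.n → Net.Crossing part r S a b → E.val μ' a b ≤ c) := by
  have hcases : ∀ {a b}, a < E.N.n → b < E.N.n →
      (Net.Crossing part r S a b ∧ c < E.val μ a b ∧ E.ptr μ' a b = H ∧ E.val μ' a b = c) ∨
      (¬ (Net.Crossing part r S a b ∧ c < E.val μ a b) ∧ E.ptr μ' a b = E.ptr μ a b ∧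
        E.val μ' a b = E.val μ a b) := by
    intro a b ha hb
    have h1 := h.ptr_lt ha hb
    have h2 := h.ptr_ge ha hb
    by_cases hcr : Net.Crossing part r S a b ∧ c < E.val μ a b
    · left
      have h3 : E.ptr μ' a b = H := (hD a ha b hb).1 hcr
      exact ⟨hcr.1, hcr.2, h3, by rw [val, h3, hc]⟩
    · right
      have h3 : E.ptr μ' a b = E.ptr μ a b := (hD a ha b hb).2 hcr
      exact ⟨hcr, h3, by rw [val, h3, hf _ (by omega) (by omega), val]⟩
  refine ⟨⟨hI, by have := h.ge; omega, hH, ?_, ?_, ?_, ?_⟩, ?_, ?_⟩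
  · obtain ⟨k, hk⟩ := h.mul
    exact ⟨k + 1, by rw [hk]; ring⟩
  · intro a b ha hb
    have h1 := h.ptr_lt ha hb
    rcases hcases ha hb with ⟨-, -, h3, -⟩ | ⟨-, h3, -⟩ <;> omega
  · intro a b ha hb
    rcases hcases ha hb with ⟨-, -, h3, -⟩ | ⟨-, h3, -⟩
    · rw [h3]; exact h.mul
    · rw [h3]; exact h.ptr_mul ha hb
  · intro a b ha hb hab
    have h1 := h.ptr_lt ha hb
    have h2 := h.ptr_ge ha hb
    rcases hcases ha hb with ⟨hcr, -, h3, h4⟩ | ⟨-, h3, h4⟩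
    · right
      rw [h4, h3]
      refine ⟨?_, ?_⟩
      · rw [hcS]
        exact E.cutVal_congr hSv
      · have := hcr.2.2
        rw [hSv a ha, hSv b hb] at this
        exact this
    · have hs : ∀ x < E.N.n, (side μ' (E.ptr μ a b) x ↔ side μ (E.ptr μ a b) x) := by
        intro x hx
        simp only [side]
        rw [hf _ (by omega) (by omega)]
      rw [h4, h3, E.cutVal_congr hs, hs a ha, hs b hb]
      exact h.cut ha hb hab
  · intro a b ha hb
    rcases hcases ha hb with ⟨-, h3, -, h4⟩ | ⟨-, -, h4⟩ <;> omega
  · intro a b ha hb hcr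
    rcases hcases ha hb with ⟨-, -, -, h4⟩ | ⟨h3, -, h4⟩
    · omega
    · rw [h4]
      by_contra h5
      exact h3 ⟨hcr, by omega⟩

end Env

namespace Env

open Net

/-- The possible queries of a refinement that has reached the labels `mg` and the parts `part`. -/
def queriesLeft (n : ℕ) (lab mg part : ℕ → ℕ) : ℕ :=
  (numLab n mg - 1) + (numLab n lab - (reps n lab part).card)

theorem HasInput.frame {E : Env} {μ μ' : Mem} (h : E.HasInput μ)
    (hf : ∀ a, a < E.AB ∨ (E.AB + 2 ≤ a ∧ a < E.PT) → μ' a = μ a) : E.HasInput μ' := by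
  obtain ⟨l1, l2, -⟩ := E.layout
  intro i hi
  rw [hf _ (Or.inl (by omega)), hf _ (Or.inr ⟨by omega, by omega⟩)]
  exact h i hi

theorem _root_.Net.Refining.val_mono {N : Net} {τ : RefTask} {mid : ℕ} {mg part : ℕ → ℕ}
    {val val' : ℕ → ℕ → ℕ} (h : Refining N τ mid mg part val)
    (hv : ∀ {u v}, u < N.n → v < N.n → val' u v ≤ val u v) : Refining N τ mid mg part val' :=
  { h with val_le := fun hu hv' h1 h2 h3 => (hv hu hv').trans (h.val_le hu hv' h1 h2 h3) }

section Step

variable {E : Env} {τ : RefTask} {mid : ℕ} {V₀ : ℕ → ℕ} {μ₀ : Mem} {H₀ : ℕ} {mg part : ℕ → ℕ}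
  {l : List RefTask} {σ : State} {v : ℕ}

-- The number `x` of updated pairs is `0` for a merge and the product of the two sides for a split;
-- it is charged to `openPairs`. The query is charged to `queriesLeft`, where a merge removes a
-- class and a split adds a representative.
set_option maxHeartbeats 1000000 in
theorem Scan.query (h : E.Scan τ mid V₀ μ₀ H₀ mg part l σ) (hS : E.Sound) (hτ : E.N.TaskOK τ)
    (hmid : mid ≤ τ.hi) (hH₀ : E.H0 ≤ H₀)
    (hH : H₀ + (E.N.n + 2) * (numLab E.N.n τ.lab - 1) ≤ E.hmax)
    (hv : v < E.N.n) (h17 : σ.vars 17 = v) (hne : mg v ≠ mg (part v)) :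
    ∃ x, Run E.w E.O (.seq queryCmd <| .seq (.ite (.lt (.var 15) (.var 19)) mergeCmd splitCmd) <|
        .seq (.assign 17 (.const 0)) (.assign 16 (.const 1))) σ
      (E.tA + 400 * (E.N.n + E.m + 1) + 80 * x) 1 fun σ' =>
      ∃ mg' part' l', E.Scan τ mid V₀ μ₀ H₀ mg' part' l' σ' ∧ σ'.vars 17 = 0 ∧
        queriesLeft E.N.n τ.lab mg' part' + 1 ≤ queriesLeft E.N.n τ.lab mg part ∧
        openPairs E.N.n τ.lab part' + x ≤ openPairs E.N.n τ.lab part := by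
  obtain ⟨l1, l2, l3, l4, l5, l6, l7, l8, l9⟩ := E.layout
  obtain ⟨V, μ, tape⟩ := σ
  have hr := h.ref.part_lt hv
  have hrv : part v ≠ v := fun h' => hne (by rw [h'])
  have hvp := h.ref.present_of_ne hv hne
  have hmv0 : mg v ≠ 0 := fun h' => hvp ((h.ref.mg_zero hv).1 h')
  have hmr0 : mg (part v) ≠ 0 := fun h' => h.ref.part_present hv hvp ((h.ref.mg_zero hr).1 h')
  have hreps := h.ref.card_reps_le
  have hlen := h.len
  set r := part v with hrdef
  have h2lab : 2 ≤ numLab E.N.n τ.lab := by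
    refine Finset.one_lt_card.2 ⟨τ.lab v, ?_, τ.lab r, ?_, fun h' => hne (h.ref.mg_lab hv hr h')⟩
    · exact Finset.mem_erase.2 ⟨hvp, Finset.mem_image_of_mem _ (Finset.mem_range.2 hv)⟩
    · exact Finset.mem_erase.2 ⟨h.ref.part_present hv hvp,
        Finset.mem_image_of_mem _ (Finset.mem_range.2 hr)⟩
  set H := H₀ + (E.N.n + 2) * l.length with hHdef
  have hheap := h.heap
  have hge : E.H0 ≤ H := hheap.ge
  have hle : H ≤ E.hmax := hheap.le
  set S : ℕ → Prop := fun x => E.ans r v x ≠ 0 with hSdef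
  have hsep : ¬ (S v ↔ S r) := hS.sep hr hv hrv
  set c := E.cutVal S with hcdef
  have hcle : c ≤ E.N.tot := E.cutVal_le S
  have hmidle : mid ≤ E.N.tot := hmid.trans hτ.hi_le
  have ltot := E.tot_lt
  -- the state after the query
  have hquery : ∀ (x : ℕ) (Q : State → Prop),
      (∀ V₁ μ₁, (∀ y < 18, V₁ y = V y) → V₁ 18 = r → V₁ 19 = c →
        (∀ a, a < H → a ≠ E.AB → a ≠ E.AB + 1 → μ₁ a = μ a) →
        (∀ y < E.N.n, (S y ↔ μ₁ (H + 2 + y) ≠ 0)) →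
        Run E.w E.O (.seq (.ite (.lt (.var 15) (.var 19)) mergeCmd splitCmd) <|
          .seq (.assign 17 (.const 0)) (.assign 16 (.const 1))) ⟨V₁, μ₁, tape⟩
          (320 * (E.N.n + E.m + 1) + 80 * x) 0 Q) →
      Run E.w E.O (.seq queryCmd <| .seq (.ite (.lt (.var 15) (.var 19)) mergeCmd splitCmd) <|
        .seq (.assign 17 (.const 0)) (.assign 16 (.const 1))) ⟨V, μ, tape⟩
      (E.tA + 400 * (E.N.n + E.m + 1) + 80 * x) 1 Q := by
    intro x Q hQ
    refine Run.seq (T₁ := E.tA + 80 * (E.N.n + E.m + 1)) (R₁ := 1)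
      (P' := fun σ => σ = ⟨Function.update (Function.update (Function.update V 18 r) 19 c) 30 E.m,
        writeArr (Function.update (Function.update μ E.AB r) (E.AB + 1) v) (H + 2) E.N.n
          (E.ans r v), tape⟩) ?_ ?_ (T₂ := 320 * (E.N.n + E.m + 1) + 80 * x) (R₂ := 0)
      (by omega) le_rfl
    · exact query_spec E h.regs hheap.input hv hr hrv h17 h.hp hle hge (h.part_eq v hv) rfl
    rintro _ rfl
    refine hQ _ _ ?_ ?_ ?_ ?_ ?_
    · intro y hy
      rw [Function.update_of_ne (by omega), Function.update_of_ne (by omega),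
        Function.update_of_ne (by omega)]
    · simp
    · simp
    · intro a ha h1 h2
      rw [writeArr_of_lt (by omega), Function.update_of_ne h2, Function.update_of_ne h1]
    · intro y hy
      rw [writeArr_at hy]
  have hregs : ∀ V₁ : ℕ → ℕ, (∀ y < 18, V₁ y = V y) → E.Regs V₁ := by
    intro V₁ hV
    have hR := h.regs
    constructor <;> rw [hV _ (by decide)]
    exacts [hR.r0, hR.r1, hR.r2, hR.r3, hR.r4, hR.r5, hR.r6, hR.r7, hR.r9]
  by_cases hc : mid < c
  · -- merging
    refine ⟨0, hquery 0 _ ?_⟩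
    intro V₁ μ₁ hV h18 h19 hf _
    have hR₁ := hregs V₁ hV
    have hmg₁ : ∀ y < E.N.n, μ₁ (E.MG + y) = mg y := fun y hy => by
      rw [hf _ (by omega) (by omega) (by omega)]; exact h.mg_eq y hy
    refine Run.seq (T₁ := 60 * (E.N.n + 1)) (R₁ := 0) (P' := fun σ =>
      σ = ⟨Function.update (Function.update (Function.update V₁ 22 (μ₁ (E.MG + v))) 23
        (μ₁ (E.MG + r))) 30 E.N.n,
      writeArr μ₁ E.MG E.N.n fun x => if μ₁ (E.MG + x) = μ₁ (E.MG + v) then μ₁ (E.MG + r)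
        else μ₁ (E.MG + x), tape⟩) ?_ ?_ (T₂ := 20) (R₂ := 0) (by omega) le_rfl
    · refine wp_ite.2 ⟨fun _ => ?_, fun h' => ?_⟩
      · refine Run.wp (merge_spec E hR₁ hv hr (by rw [hV 17 (by decide)]; exact h17) h18 ?_ rfl) ?_
        · intro y hy
          rw [hmg₁ y hy]; exact h.mg_le y hy
        · intro σ' t r' ht hr' hσ
          refine ⟨?_, by omega, hσ.symm⟩
          simp only [Expr.cost]; omega
      · exfalso
        have h15 : V 15 = mid := h.mid_eq
        simp only [Expr.eval, h19, hV 15 (by decide), h15, if_pos hc] at h'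
        exact one_ne_zero h'
    rintro _ rfl
    refine wp_seq.2 (wp_assign.2 (wp_assign.2 ⟨by simp [Expr.cost], le_rfl, ?_⟩))
    simp only [Expr.eval, Nat.zero_mod, Nat.mod_eq_of_lt (show 1 < 2 ^ E.w by omega)]
    set μ₂ := writeArr μ₁ E.MG E.N.n fun x => if μ₁ (E.MG + x) = μ₁ (E.MG + v) then μ₁ (E.MG + r)
        else μ₁ (E.MG + x) with hμ₂
    have hf2 : ∀ a, a < H → a ≠ E.AB → a ≠ E.AB + 1 → ¬ (E.MG ≤ a ∧ a < E.MG + E.N.n) →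
        μ₂ a = μ a := by
      intro a h1 h2 h3 h4
      rw [← hf a h1 h2 h3, hμ₂, writeArr, if_neg h4]
    have hmg2 : ∀ y < E.N.n, μ₂ (E.MG + y) = if mg y = mg v then mg r else mg y := by
      intro y hy
      rw [hμ₂, writeArr_at hy, hmg₁ y hy, hmg₁ v hv, hmg₁ r hr]
    clear_value μ₂
    obtain ⟨hheap2, hval2⟩ := hheap.frame (μ' := μ₂) le_rfl hle hheap.mul
      (hheap.input.frame fun a ha => hf2 a (by omega) (by omega) (by omega) (by omega))
      (fun a h1 h2 => hf2 a h2 (by omega) (by omega) (by omega))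
    refine ⟨fun y => if mg y = mg v then mg r else mg y, part, l,
      { regs := ?_, cur_eq := ?_, lo_eq := ?_, hi_eq := ?_, mid_eq := ?_, mg_eq := hmg2,
        mg_le := ?_, part_eq := ?_, heap := hheap2, hp := ?_, recs := ?_, skip := h.skip,
        frame := ?_, mono := ?_, ref := ?_, flag := ?_, two_le := fun _ => h2lab, len := hlen }, ?_, ?_, by omega⟩
    · exact ((((hR₁.update 22 _).update 23 _).update 30 _).update 17 _).update 16 _
    · have := h.cur_eq; simpa [hV] using this
    · have := h.lo_eq; simpa [hV] using this
    · have := h.hi_eq; simpa [hV] using this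
    · have := h.mid_eq; simpa [hV] using this
    · intro y hy
      have h1 := h.mg_le y hy
      have h2 := h.mg_le r hr
      split_ifs <;> assumption
    · intro y hy
      simp only
      rw [hf2 _ (by omega) (by omega) (by omega) (by omega)]; exact h.part_eq y hy
    · have := h.hp; simpa [hV] using this
    · exact h.recs.frame fun a h1 h2 =>
        hf2 a (by omega) (by omega) (by omega) (by omega)
    · intro a h1 h2
      simp only
      rw [hf2 _ (by omega) (by omega) (by omega) (by omega)]; exact h.frame a h1 h2
    · intro a b ha hb
      simp only
      rw [hval2 ha hb]; exact h.mono ha hb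
    · exact (h.ref.merge hv hne hc hcle (hS.cap hr hv hrv)).val_mono fun ha hb =>
        (hval2 ha hb).le
    · intro h'; simp at h'
    · simp
    · have h1 := numLab_merge_lt hr hv hmv0 hne
      have h2 : 1 ≤ numLab E.N.n (fun x => if mg x = mg v then mg r else mg x) := by
        refine Finset.card_pos.2 ⟨mg r, ?_⟩
        simp only [Finset.mem_erase, Finset.mem_image, Finset.mem_range]
        exact ⟨hmr0, v, hv, by simp⟩
      simp only [queriesLeft]
      omega
  · -- splitting
    classical
    have hc' : c ≤ mid := not_lt.1 hc
    have hlam : ∀ {a b}, a < E.N.n → b < E.N.n → ¬ (S a ↔ S b) → E.N.lam a b ≤ c :=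
      fun ha hb hab => hS.lam_le S ha hb hab
    have hrl := h.ref.reps_lt_split hv hne hsep
    have hop := h.ref.openPairs_split hτ hmid hv hne hc' hlam
    have hcard : (reps E.N.n τ.lab (splitPart part r v S)).card ≤ numLab E.N.n τ.lab :=
      (h.ref.split hτ hmid hv hne hc' hlam hsep (val' := fun _ _ => 0)
        (fun _ _ => Nat.zero_le _) (fun _ _ _ => Nat.zero_le _)).card_reps_le
    rw [← hrdef] at hrl hop
    refine ⟨_, hquery (((Finset.range E.N.n).filter fun x => part x = r ∧ (S x ↔ S r)).card *
        ((Finset.range E.N.n).filter fun x => part x = r ∧ ¬ (S x ↔ S r)).card) _ ?_⟩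
    intro V₁ μ₁ hV h18 h19 hf hans
    have hR₁ := hregs V₁ hV
    obtain ⟨hheap1, hval1⟩ := hheap.frame (μ' := μ₁) le_rfl hle hheap.mul
      (hheap.input.frame fun a ha => hf a (by omega) (by omega) (by omega))
      (fun a h1 h2 => hf a h2 (by omega) (by omega))
    set K := ((Finset.range E.N.n).filter fun x => part x = r ∧ (S x ↔ S r)).card *
        ((Finset.range E.N.n).filter fun x => part x = r ∧ ¬ (S x ↔ S r)).card with hK
    have hsplit := split_spec E (S := S) (part := part) (c := c) (ptr := E.ptr μ₁)
        (cap := E.val μ₁) (V := V₁) (μ := μ₁) (τ := tape) hR₁ hr hv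
        (by rw [hV 17 (by decide)]; exact h17) h18
        (by rw [hV 10 (by decide)]; exact h.hp) h19 hge hle hans (fun y hy => by
          rw [hf _ (by omega) (by omega) (by omega)]; exact h.part_eq y hy)
        (fun a _ b _ => rfl) (fun a ha b hb =>
          ⟨hheap1.ptr_ge ha hb, by have := hheap1.ptr_lt ha hb; omega⟩)
        (fun a _ b _ => rfl)
    refine Run.seq (T₁ := 310 * (E.N.n + 1) + 80 * K) (R₁ := 0) (P' := fun σ =>
      (∀ y < 20, y ≠ 10 → σ.vars y = V₁ y) ∧ σ.vars 10 = H + (E.N.n + 2) ∧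
      σ.mem H = c ∧ σ.mem (H + 1) = 0 ∧
      (∀ y, ¬ (E.PT ≤ y ∧ y < E.PT + E.N.n) → ¬ (E.LA ≤ y ∧ y < E.LA + E.N.n) →
        ¬ (E.PR ≤ y ∧ y < E.PR + E.N.n * E.N.n) → y ≠ H → y ≠ H + 1 → σ.mem y = μ₁ y) ∧
      (∀ x < E.N.n, σ.mem (E.PT + x) = Net.splitPart part r v S x) ∧
      E.Improved H c (E.ptr μ₁) (E.val μ₁) (Net.Crossing part r S) σ.mem) (wp_ite.2 ⟨fun h' => ?_, fun _ => ?_⟩) ?_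
      (T₂ := 20) (R₂ := 0) ?_ le_rfl
    rotate_left
    · refine Run.wp hsplit ?_
      intro σ' t r' ht hr' hσ
      refine ⟨?_, by omega, hσ⟩
      have ht' : t ≤ 300 * (E.N.n + 1) + 80 * K := by
        refine ht.trans (le_of_eq ?_)
        rw [hK]
        congr!
      simp only [Expr.cost]
      omega
    · rintro ⟨V₂, μ₂, tape₂⟩ ⟨hV2, h10, hH1, hH2, hf2, hpart2, hD⟩
      simp only at hV2 h10 hH1 hH2 hf2 hpart2 hD
      -- By `hrl` and `hcard` there were fewer parts than labels before the split, so `hlen` leaves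
      -- room for one more record.
      have hH' : H + (E.N.n + 2) ≤ E.hmax := by
        refine le_trans ?_ hH
        have h1 : l.length + 1 ≤ numLab E.N.n τ.lab - 1 := by
          omega
        have := Nat.mul_le_mul_left (E.N.n + 2) h1
        rw [hHdef]
        rw [mul_add, mul_one] at this
        omega
      have hf3 : ∀ a, a < H → a ≠ E.AB → a ≠ E.AB + 1 → ¬ (E.PT ≤ a ∧ a < E.PT + E.N.n) →
          ¬ (E.LA ≤ a ∧ a < E.LA + E.N.n) → ¬ (E.PR ≤ a ∧ a < E.PR + E.N.n * E.N.n) →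
          μ₂ a = μ a := by
        intro a h1 h2 h3 h4 h5 h6
        rw [hf2 a h4 h5 h6 (by omega) (by omega), hf a h1 h2 h3]
      obtain ⟨hheap2, hval2, hval2'⟩ := improved_update (S := S) (r := r) (part := part) hheap1 hH'
        (hheap.input.frame fun a ha => hf3 a (by omega) (by omega) (by omega) (by omega)
          (by omega) (by omega))
        (fun a h1 h2 => hf2 a (by omega) (by omega) (by omega) (by omega) (by omega)) hH1
        (fun x hx => by
          rw [hans x hx, hf2 _ (by omega) (by omega) (by omega) (by omega) (by omega)]) rfl hD
      have hval3 : ∀ {a b}, a < E.N.n → b < E.N.n → E.val μ₂ a b ≤ E.val μ a b :=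
        fun ha hb => (hval2 ha hb).trans (hval1 ha hb).le
      -- The stored cut is read as a task with its capacity as `lo` and with `hi = 0`, so its range
      -- is empty and the main loop passes over it.
      have hHl : H + (E.N.n + 2) = H₀ + (E.N.n + 2) *
          (l ++ [(⟨c, 0, fun x => μ₂ (H + 2 + x)⟩ : RefTask)]).length := by
        rw [List.length_append, List.length_singleton, hHdef]; ring
      refine wp_seq.2 (wp_assign.2 (wp_assign.2 ⟨by simp [Expr.cost], le_rfl, ?_⟩))
      simp only [Expr.eval, Nat.zero_mod, Nat.mod_eq_of_lt (show 1 < 2 ^ E.w by omega)]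
      refine ⟨mg, splitPart part r v S, l ++ [⟨c, 0, fun x => μ₂ (H + 2 + x)⟩],
        { regs := ?_, cur_eq := ?_, lo_eq := ?_, hi_eq := ?_, mid_eq := ?_, mg_eq := ?_,
          mg_le := h.mg_le, part_eq := hpart2, heap := by rw [← hHl]; exact hheap2, hp := ?_, recs := ?_, skip := ?_,
          frame := ?_, mono := ?_, ref := ?_, flag := ?_, two_le := fun _ => h2lab, len := ?_ }, ?_, ?_, ?_⟩
      · have hR₂ : E.Regs V₂ := by
          constructor <;> rw [hV2 _ (by decide) (by decide)]
          exacts [hR₁.r0, hR₁.r1, hR₁.r2, hR₁.r3, hR₁.r4, hR₁.r5, hR₁.r6, hR₁.r7, hR₁.r9]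
        exact (hR₂.update 17 _).update 16 _
      · have := h.cur_eq; simpa [hV, hV2] using this
      · have := h.lo_eq; simpa [hV, hV2] using this
      · have := h.hi_eq; simpa [hV, hV2] using this
      · have := h.mid_eq; simpa [hV, hV2] using this
      · intro y hy
        simp only
        rw [hf3 _ (by omega) (by omega) (by omega) (by omega) (by omega) (by omega)]
        exact h.mg_eq y hy
      · rw [← hHl]; simpa using h10
      · refine HoldsRecs.append (h.recs.frame fun a h1 h2 => ?_) (show HoldsRecs E.N.n μ₂ H [_] from ⟨⟨hH1, hH2, fun _ _ => rfl⟩, trivial⟩)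
        simp only
        rw [hf3 _ (by omega) (by omega) (by omega) (by omega) (by omega) (by omega)]
      · intro τ' hτ'
        rcases List.mem_append.1 hτ' with h' | h'
        · exact h.skip τ' h'
        · rw [List.mem_singleton.1 h']
      · intro a h1 h2
        simp only
        rw [hf3 _ (by omega) (by omega) (by omega) (by omega) (by omega) (by omega)]
        exact h.frame a h1 h2
      · intro a b ha hb
        exact (hval3 ha hb).trans (h.mono ha hb)
      · exact h.ref.split hτ hmid hv hne hc' hlam hsep hval3 hval2'
      · intro h'; simp at h'
      · rw [List.length_append, List.length_singleton]
        omega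
      · simp
      · simp only [queriesLeft]
        omega
      · refine le_trans (le_of_eq ?_) hop
        rw [hK]
        congr!
    · omega
    · exfalso
      have h15 : V 15 = mid := h.mid_eq
      simp only [Expr.eval, h19, hV 15 (by decide), h15, if_neg hc] at h'
      exact h' rfl

end Step

end Env

namespace Env

open Net

/-- The scan restarts at node `0` after each query. The repeated sweep costs at most `30 * n`, which
is covered by the difference between the `500` per query here and the `400` in `Scan.query`. -/
theorem scan_spec {E : Env} {τ : RefTask} {mid : ℕ} {V₀ : ℕ → ℕ} {μ₀ : Mem} {H₀ : ℕ}
    {mg part : ℕ → ℕ} {l : List RefTask} {σ : State}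
    (h : E.Scan τ mid V₀ μ₀ H₀ mg part l σ) (hS : E.Sound) (hτ : E.N.TaskOK τ)
    (hmid : mid ≤ τ.hi) (hH₀ : E.H0 ≤ H₀)
    (hH : H₀ + (E.N.n + 2) * (numLab E.N.n τ.lab - 1) ≤ E.hmax) (h17 : σ.vars 17 = 0) :
    Run E.w E.O scanCmd σ
      ((E.tA + 500 * (E.N.n + E.m + 1)) * queriesLeft E.N.n τ.lab mg part +
        80 * openPairs E.N.n τ.lab part + 30 * E.N.n + 10) (queriesLeft E.N.n τ.lab mg part) fun σ' =>
      ∃ mg' part' l', E.Scan τ mid V₀ μ₀ H₀ mg' part' l' σ' ∧ Settled E.N mg' part' := by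
  obtain ⟨l1, l2, l3, l4, l5, l6, l7, l8, l9⟩ := E.layout
  refine Run.loop (fun σ T R => ∃ mg part l v, E.Scan τ mid V₀ μ₀ H₀ mg part l σ ∧
    σ.vars 17 = v ∧ v ≤ E.N.n ∧ (∀ x < v, mg x = mg (part x)) ∧
    T = (E.tA + 500 * (E.N.n + E.m + 1)) * queriesLeft E.N.n τ.lab mg part +
        80 * openPairs E.N.n τ.lab part + 30 * (E.N.n - v) + 10 ∧
    R = queriesLeft E.N.n τ.lab mg part) ?_
    ⟨mg, part, l, 0, h, h17, Nat.zero_le _, by simp, rfl, rfl⟩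
  rintro ⟨V, μ, tape⟩ T R ⟨mg, part, l, v, h, h17, hv, hset, rfl, rfl⟩
  have hR := h.regs
  simp only at h17 hR
  rcases hv.eq_or_lt with rfl | hv
  · left
    refine ⟨by simp [Expr.eval, h17, hR.r0], by simp [Expr.cost], mg, part, l, h, hset⟩
  right
  refine ⟨by simp [Expr.eval, h17, hR.r0, hv], ?_⟩
  have hp := h.ref.part_lt hv
  have e1 : (readAt 6 (.var 17)).eval E.w ⟨V, μ, tape⟩ = mg v := by
    simp (disch := omega) only [readAt, Expr.eval, hR.r6, h17, Nat.mod_eq_of_lt]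
    exact h.mg_eq v hv
  have e2 : (Expr.load (.add (.var 6) (readAt 5 (.var 17)))).eval E.w ⟨V, μ, tape⟩
      = mg (part v) := by
    have := h.part_eq v hv
    simp only at this
    simp (disch := omega) only [readAt, Expr.eval, hR.r5, hR.r6, h17, Nat.mod_eq_of_lt, this]
    exact h.mg_eq _ hp
  by_cases hne : mg v = mg (part v)
  · refine ⟨20, 0, wp_ite.2 ⟨fun h' => ?_, fun _ => ?_⟩⟩
    · rw [Expr.eval_ne, e1, e2] at h'
      simp [hne] at h'
    refine wp_assign.2 ⟨by simp [Expr.cost, Expr.ne, readAt], le_rfl, _, _, ⟨mg, part, l, v + 1,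
      ?_, ?_, hv, ?_, rfl, rfl⟩, ?_, by omega⟩
    · exact { h with
        regs := hR.update 17 _
        cur_eq := by simpa using h.cur_eq
        lo_eq := by simpa using h.lo_eq
        hi_eq := by simpa using h.hi_eq
        mid_eq := by simpa using h.mid_eq
        hp := by simpa using h.hp
        flag := by simpa using h.flag
        two_le := by simpa using h.two_le }
    · simp (disch := omega) only [Expr.eval, Function.update_self, h17, Nat.mod_eq_of_lt]
    · intro x hx
      rcases (Nat.lt_succ_iff.1 hx).eq_or_lt with rfl | hx
      · exact hne
      · exact hset x hx
    · simp only [Expr.cost]; omega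
  · obtain ⟨x, hrun⟩ := h.query hS hτ hmid hH₀ hH hv h17 hne
    refine ⟨E.tA + 400 * (E.N.n + E.m + 1) + 80 * x + 16, 1, wp_ite.2 ⟨fun _ => ?_, fun h' => ?_⟩⟩
    · refine hrun.wp ?_
      rintro σ' t r ht hr ⟨mg', part', l', h', h17', hq, ho⟩
      refine ⟨?_, hr, _, _, ⟨mg', part', l', 0, h', h17', Nat.zero_le _, by simp, rfl, rfl⟩, ?_, ?_⟩
      · simp only [Expr.cost, Expr.ne, readAt]; omega
      · have : (E.tA + 500 * (E.N.n + E.m + 1)) * (queriesLeft E.N.n τ.lab mg' part' + 1) ≤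
          (E.tA + 500 * (E.N.n + E.m + 1)) * queriesLeft E.N.n τ.lab mg part :=
          Nat.mul_le_mul_left _ hq
        rw [mul_add, mul_one] at this
        simp only [Expr.cost]
        omega
      · omega
    · rw [Expr.eval_ne, e1, e2] at h'
      simp [hne] at h'

end Env

/-- Prepares the scan for the task at the current record: copies its labels and makes all its nodes
one part. -/
def prepareCmd : Cmd :=
  .seq (.assign 15 (.div (.add (.add (.var 13) (.var 14)) (.const 1)) (.const 2))) <|
  .seq (.fill 30 (.var 6) (.var 0) (.load (.add (.add (.var 11) (.const 2)) (.var 30)))) <|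
  .seq (.assign 18 (.const 0)) <|
  .seq (.for 30 (.var 0) (.ite (readAt 6 (.var 30)) (.assign 18 (.var 30)) .skip)) <|
  .seq (.fill 30 (.var 5) (.var 0)
    (.sel (.eq (readAt 6 (.var 30)) (.const 0)) (.var 30) (.var 18))) <|
  .seq (.assign 16 (.const 0)) (.assign 17 (.const 0))

/-! ### Starting the scan -/

namespace Net

theorem exists_of_numLab_pos {n : ℕ} {f : ℕ → ℕ} (h : 0 < numLab n f) : ∃ v < n, f v ≠ 0 := by
  obtain ⟨y, hy⟩ := Finset.card_pos.1 h
  simp only [Finset.mem_erase, Finset.mem_image, Finset.mem_range] at hy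
  obtain ⟨hy0, x, hx, rfl⟩ := hy
  exact ⟨x, hx, hy0⟩

theorem reps_pos {n r : ℕ} {lab : ℕ → ℕ} (hr : r < n) (hr0 : (∃ v < n, lab v ≠ 0) → lab r ≠ 0)
    (h : 0 < numLab n lab) : 0 < (reps n lab fun v => if lab v = 0 then v else r).card := by
  refine Finset.card_pos.2 ⟨r, ?_⟩
  simp only [reps, Finset.mem_filter, Finset.mem_range]
  exact ⟨hr, hr0 (exists_of_numLab_pos h), by simp⟩

end Net

namespace Env

open Net

/-- A nonempty task starts with a single part and with its clusters as classes, so at most `numLab -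
1` merges and `numLab - 1` splits lie ahead. -/
theorem prepare_spec {E : Env} {V : ℕ → ℕ} {μ : Mem} {tape : List ℕ} {τ : RefTask} {cur H : ℕ}
    (hR : E.Regs V) (hheap : E.HeapOK μ H) (hcur : V 11 = cur) (hhp : V 10 = H)
    (h13 : V 13 = τ.lo) (h14 : V 14 = τ.hi)
    (hcurge : E.H0 ≤ cur) (hcurle : cur + (E.N.n + 2) ≤ H) (hrec : HoldsRec E.N.n μ cur τ)
    (hτ : E.N.TaskOK τ) (hlab : ∀ x < E.N.n, τ.lab x ≤ E.N.n) (hlt : τ.lo < τ.hi) :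
    Run E.w E.O prepareCmd ⟨V, μ, tape⟩ (100 * (E.N.n + 1)) 0 fun σ => σ.vars 17 = 0 ∧
      ∃ part, E.Scan τ ((τ.lo + τ.hi + 1) / 2) V μ H τ.lab part [] σ ∧
      queriesLeft E.N.n τ.lab τ.lab part ≤ 2 * (numLab E.N.n τ.lab - 1) := by
  obtain ⟨l1, l2, l3, l4, l5, l6, l7, l8, l9⟩ := E.layout
  have hle := hheap.le
  have htot := hτ.hi_le
  -- The midpoint is computed from `lo + hi + 1 ≤ 2 * tot`, which must fit into a word; `q ≥ 1`
  -- turns `word_mul` into this bound.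
  have hpw : 2 * (E.N.tot + 2) < 2 ^ E.w := by
    refine lt_of_le_of_lt ?_ E.word_mul
    rw [mul_comm]
    exact Nat.mul_le_mul_left _ (by have := E.N.q_pos; omega)
  have hlabrec : ∀ x < E.N.n, μ (cur + 2 + x) = τ.lab x := hrec.2.2
  set mid := (τ.lo + τ.hi + 1) / 2 with hmid
  have hmidlt : mid ≤ τ.hi := by omega
  refine wp_seq.2 (wp_assign.2 (wp_seq.2 ?_))
  have e1 : (Expr.div (.add (.add (.var 13) (.var 14)) (.const 1)) (.const 2)).eval E.w
      ⟨V, μ, tape⟩ = mid := by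
    simp (disch := omega) only [Expr.eval, h13, h14, Nat.mod_eq_of_lt, hmid]
  simp only [e1]
  refine Run.wp (R := 0) (T := 18 * (E.N.n + 1)) (Run.fill (base := E.MG) (cnt := E.N.n) τ.lab
    (by omega) ?_ ?_ ?_ ?_ (P := fun σ => σ = _) rfl) ?_
  · intro k M; simp [Expr.eval, hR.r6]
  · intro k M; simp [Expr.eval, hR.r0]
  · intro k hk
    simp only [Expr.eval, ne_eq, Nat.reduceEqDiff, not_false_eq_true, Function.update_of_ne, hcur,
      Function.update_self]
    simp (disch := omega) only [Nat.mod_eq_of_lt]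
    rw [writeArr_of_ge (by omega), hlabrec k hk]
  · simp [Expr.cost]
  rintro _ t₁ r₁ ht₁ hr₁ rfl
  set μ₁ := writeArr μ E.MG E.N.n τ.lab with hμ₁
  have hmg₁ : ∀ x < E.N.n, μ₁ (E.MG + x) = τ.lab x := fun x hx => writeArr_at hx
  have hf₁ : ∀ a, ¬ (E.MG ≤ a ∧ a < E.MG + E.N.n) → μ₁ a = μ a := fun a ha => if_neg ha
  clear_value μ₁
  refine wp_seq.2 (wp_assign.2 (wp_seq.2 ?_))
  simp only [Expr.eval, Nat.zero_mod]
  set V₁ := Function.update (Function.update (Function.update V 15 mid) 30 E.N.n) 18 0 with hV₁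
  have hR₁ : E.Regs V₁ := (((hR.update 15 _).update 30 _).update 18 _)
  have hV₁' : ∀ y, y ≠ 15 → y ≠ 30 → y ≠ 18 → V₁ y = V y := by
    intro y h1 h2 h3
    rw [hV₁, Function.update_of_ne h3, Function.update_of_ne h2, Function.update_of_ne h1]
  have h15 : V₁ 15 = mid := by simp [hV₁]
  have h18 : V₁ 18 = 0 := by simp [hV₁]
  clear_value V₁
  refine Run.wp (R := 0) (T := 18 * (E.N.n + 1)) (Run.for (cnt := E.N.n)
    (P := fun σ => ∃ s < E.N.n, ((∃ x < E.N.n, τ.lab x ≠ 0) → τ.lab s ≠ 0) ∧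
      σ = ⟨Function.update (Function.update V₁ 18 s) 30 E.N.n, μ₁, tape⟩)
    (fun k σ => ∃ s < E.N.n, ((∃ x < k, τ.lab x ≠ 0) → τ.lab s ≠ 0) ∧
      σ = ⟨Function.update (Function.update V₁ 18 s) 30 k, μ₁, tape⟩) (fun _ => 10)
    (by omega) ?_ ?_ ?_ ?_ ?_) ?_
  -- Before a node of the task has been met, the candidate is `0` and the condition on it is
  -- vacuous.
  · refine ⟨0, by omega, by simp, ?_⟩
    congr 2
    rw [← h18]; simp
  · rintro k hk _ ⟨s, hs, hs', rfl⟩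
    exact ⟨by simp [Expr.eval, hR₁.r0], by simp⟩
  · rintro k hk _ ⟨s, hs, hs', rfl⟩
    have e2 : (readAt 6 (.var 30)).eval E.w
        ⟨Function.update (Function.update V₁ 18 s) 30 k, μ₁, tape⟩ = τ.lab k := by
      simp only [readAt, Expr.eval, ne_eq, Nat.reduceEqDiff, not_false_eq_true,
        Function.update_of_ne, hR₁.r6, Function.update_self]
      simp (disch := omega) only [Nat.mod_eq_of_lt]
      exact hmg₁ k hk
    refine wp_ite.2 ⟨fun h' => ?_, fun h' => ?_⟩
    · rw [e2] at h'
      refine wp_assign.2 ⟨by simp [Expr.cost, readAt], le_rfl, by simp, k, hk, fun _ => h', ?_⟩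
      congr 1
      funext y
      simp only [Expr.eval, Function.update_apply]
      split_ifs <;> simp_all
    · rw [e2] at h'
      refine wp_skip.2 ⟨by simp [Expr.cost, readAt], le_rfl, by simp, s, hs, ?_, by simp⟩
      rintro ⟨x, hx, hx0⟩
      rcases (Nat.lt_succ_iff.1 hx).eq_or_lt with rfl | hx
      · exact absurd h' hx0
      · exact hs' ⟨x, hx, hx0⟩
  · simp only [Finset.sum_const, Finset.card_range, smul_eq_mul, Expr.cost]; omega
  · exact fun _ h => h
  rintro _ t₂ r₂ ht₂ hr₂ ⟨s, hs, hs', rfl⟩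
  refine wp_seq.2 ?_
  refine Run.wp (R := 0) (T := 32 * (E.N.n + 1)) (Run.fill (base := E.PT) (cnt := E.N.n)
    (fun v => if τ.lab v = 0 then v else s)
    (by omega) ?_ ?_ ?_ ?_ (P := fun σ => σ = _) rfl) ?_
  · intro k M; simp [Expr.eval, hR₁.r5]
  · intro k M; simp [Expr.eval, hR₁.r0]
  · intro k hk
    rw [Expr.eval_sel (p := τ.lab k = 0) (by omega)]
    · simp [Expr.eval]
    · simp only [readAt, Expr.eval, ne_eq, Nat.reduceEqDiff, not_false_eq_true,
        Function.update_of_ne, hR₁.r6, Function.update_self]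
      simp (disch := omega) only [Nat.mod_eq_of_lt]
      rw [writeArr_of_ge (by omega), hmg₁ k hk]
    · intro _; simp [Expr.eval]; omega
    · intro _; simp [Expr.eval]; omega
  · simp [Expr.cost, Expr.sel, readAt]
  rintro _ t₃ r₃ ht₃ hr₃ rfl
  set part := fun v => if τ.lab v = 0 then v else s with hpart
  set μ₂ := writeArr μ₁ E.PT E.N.n part with hμ₂
  have hpt₂ : ∀ x < E.N.n, μ₂ (E.PT + x) = part x := fun x hx => writeArr_at hx
  have hf₂ : ∀ a, ¬ (E.MG ≤ a ∧ a < E.MG + E.N.n) → ¬ (E.PT ≤ a ∧ a < E.PT + E.N.n) →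
      μ₂ a = μ a := fun a h1 h2 => (if_neg h2).trans (hf₁ a h1)
  have hmg₂ : ∀ x < E.N.n, μ₂ (E.MG + x) = τ.lab x := fun x hx => by
    rw [hμ₂, writeArr_of_ge (by omega), hmg₁ x hx]
  clear_value μ₂
  refine wp_seq.2 (wp_assign.2 (wp_assign.2 ⟨?_, by omega, by simp [Expr.eval], part, ?_, ?_⟩))
  · simp only [Expr.cost]; omega
  · simp only [Expr.eval, Nat.zero_mod]
    obtain ⟨hheap₂, hval₂⟩ := hheap.frame (μ' := μ₂) le_rfl hle hheap.mul
      (hheap.input.frame fun a ha => hf₂ a (by omega) (by omega))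
      (fun a h1 h2 => hf₂ a (by omega) (by omega))
    exact
      { regs := ((((hR₁.update 18 _).update 30 _).update 30 _).update 16 _).update 17 _
        cur_eq := by simp [hV₁']
        lo_eq := by simp [hV₁']
        hi_eq := by simp [hV₁']
        mid_eq := by simp [h15]
        mg_eq := hmg₂
        mg_le := hlab
        part_eq := hpt₂
        heap := by simpa using hheap₂
        hp := by simp [hV₁', hhp]
        recs := trivial
        skip := by simp
        frame := fun a h1 h2 => hf₂ a (by omega) (by omega)
        mono := fun ha hb => (hval₂ ha hb).le
        ref := Refining.init hτ hmidlt hs hs' _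
        flag := by
          intro _
          refine ⟨rfl, fun _ _ => rfl, fun x _ y _ hx hy => by simp [hpart, hx, hy]⟩
        two_le := by simp
        len := by
          rcases Nat.eq_zero_or_pos (numLab E.N.n τ.lab) with h0 | h0
          · simp [h0]
          · have : 0 < (reps E.N.n τ.lab part).card := reps_pos hs hs' h0
            simp only [List.length_nil]
            omega }
  · rcases Nat.eq_zero_or_pos (numLab E.N.n τ.lab) with h0 | h0
    · simp [queriesLeft, h0]
    · have : 0 < (reps E.N.n τ.lab part).card := reps_pos hs hs' h0
      simp only [queriesLeft]
      omega

end Env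

/-- Appends a record to the heap. -/
def pushRecCmd (lo hi lab : Expr) : Cmd :=
  .seq (.store (.var 10) lo) <|
  .seq (.store (.add (.var 10) (.const 1)) hi) <|
  .seq (.fill 30 (.add (.var 10) (.const 2)) (.var 0) lab)
    (.assign 10 (.add (.var 10) (.add (.var 0) (.const 2))))

/-- Appends the subtasks of the current task to the heap. -/
def pushAllCmd : Cmd :=
  .seq (pushRecCmd (.var 13)
    (.div (.sub (.mul (.var 15) (.var 3)) (.const 1)) (.add (.var 2) (.var 3)))
    (.sel (.eq (readAt 6 (.var 30)) (.const 0)) (.const 0)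
      (.add (readAt 5 (.var 30)) (.const 1)))) <|
  .for 18 (.var 0) <|
    .ite (.mul (.ne (readAt 6 (.var 18)) (.const 0)) (.eq (readAt 5 (.var 18)) (.var 18)))
      (pushRecCmd (.var 15) (.var 14) (.mul (.eq (readAt 5 (.var 30)) (.var 18))
        (.load (.add (.add (.var 11) (.const 2)) (.var 30))))) .skip

/-! ### Writing the subtasks to the heap -/

namespace Env

open Net

/-- `hi` and `lab` are evaluated while the record is being written; it suffices that they depend
only on the registers and on memory below `H`, whence the quantification over `M`. -/
theorem pushRec_spec {E : Env} {lo hi lab : Expr} {V : ℕ → ℕ} {μ : Mem} {tape : List ℕ} {H T : ℕ}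
    {τ : RefTask} {P : State → Prop}
    (h0 : V 0 = E.N.n) (h10 : V 10 = H) (hH : H + (E.N.n + 2) ≤ E.hmax)
    (hlo : lo.eval E.w ⟨V, μ, tape⟩ = τ.lo)
    (hhi : ∀ M : Mem, (∀ a < H, M a = μ a) → hi.eval E.w ⟨V, M, tape⟩ = τ.hi)
    (hlab : ∀ M : Mem, (∀ a < H, M a = μ a) → ∀ x < E.N.n,
      lab.eval E.w ⟨Function.update V 30 x, M, tape⟩ = τ.lab x)
    (hT : lo.cost + hi.cost + (lab.cost + 20) * (E.N.n + 1) ≤ T)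
    (hP : ∀ M : Mem, (∀ a < H, M a = μ a) → HoldsRec E.N.n M H τ →
      P ⟨Function.update (Function.update V 30 E.N.n) 10 (H + (E.N.n + 2)), M, tape⟩) :
    Run E.w E.O (pushRecCmd lo hi lab) ⟨V, μ, tape⟩ T 0 P := by
  obtain ⟨l1, l2, l3, l4, l5, l6, l7, l8, l9⟩ := E.layout
  refine wp_seq.2 (wp_store.2 (wp_seq.2 (wp_store.2 (wp_seq.2 ?_))))
  have e1 : (Expr.add (.var 10) (.const 1)).eval E.w
      ⟨V, Function.update μ ((Expr.var 10).eval E.w ⟨V, μ, tape⟩) τ.lo, tape⟩ = H + 1 := by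
    simp (disch := omega) only [Expr.eval, h10, Nat.mod_eq_of_lt]
  simp only [hlo, e1]
  simp only [Expr.eval, h10]
  rw [hhi _ fun a ha => Function.update_of_ne (by omega) _ _]
  have hfr : ∀ k, ∀ a < H, writeArr (Function.update (Function.update μ H τ.lo) (H + 1) τ.hi)
      (H + 2) k τ.lab a = μ a := by
    intro k a ha
    rw [writeArr_of_lt (by omega), Function.update_of_ne (by omega),
      Function.update_of_ne (by omega)]
  refine Run.wp (R := 0) (T := (lab.cost + 14) * (E.N.n + 1)) (Run.fill (base := H + 2)
    (cnt := E.N.n) τ.lab (by omega) ?_ ?_ ?_ ?_ (P := fun σ => σ = _) rfl) ?_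
  · intro k M
    simp only [Expr.eval, ne_eq, Nat.reduceEqDiff, not_false_eq_true, Function.update_of_ne, h10]
    simp (disch := omega) only [Nat.mod_eq_of_lt]
  · intro k M; simp [Expr.eval, h0]
  · intro k hk
    exact hlab _ (hfr k) k hk
  · simp only [Expr.cost]; gcongr ?_ * _; omega
  rintro _ t r ht hr rfl
  refine wp_assign.2 ⟨?_, by omega, ?_⟩
  · simp only [Expr.cost]
    have : (lab.cost + 20) * (E.N.n + 1) = (lab.cost + 14) * (E.N.n + 1) + 6 * (E.N.n + 1) := by
      ring
    omega
  · have e3 : (Expr.add (.var 10) (.add (.var 0) (.const 2))).eval E.w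
        ⟨Function.update V 30 E.N.n, writeArr (Function.update (Function.update μ H τ.lo) (H + 1) τ.hi)
          (H + 2) E.N.n τ.lab, tape⟩ = H + (E.N.n + 2) := by
      simp only [Expr.eval, ne_eq, Nat.reduceEqDiff, not_false_eq_true, Function.update_of_ne, h10,
        h0]
      simp (disch := omega) only [Nat.mod_eq_of_lt]
    rw [e3]
    refine hP _ (hfr _) ⟨?_, ?_, fun x hx => ?_⟩
    · simp only
      rw [writeArr_of_lt (by omega), Function.update_of_ne (by omega), Function.update_self]
    · simp only
      rw [writeArr_of_lt (by omega), Function.update_self]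
    · simp only
      rw [writeArr_at hx]

/-- The subtasks for the parts with representatives below `k`. -/
def uppers (τ : RefTask) (mid : ℕ) (part : ℕ → ℕ) (k : ℕ) : List RefTask :=
  ((List.range k).filter fun r => τ.lab r ≠ 0 ∧ part r = r).map (upperTask τ mid part)

theorem uppers_succ {τ : RefTask} {mid : ℕ} {part : ℕ → ℕ} {k : ℕ} :
    uppers τ mid part (k + 1) = uppers τ mid part k ++
      if τ.lab k ≠ 0 ∧ part k = k then [upperTask τ mid part k] else [] := by
  by_cases h : τ.lab k ≠ 0 ∧ part k = k
  · simp only [uppers, List.range_succ, List.filter_append, List.map_append, if_pos h]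
    simp [h]
  · simp only [uppers, List.range_succ, List.filter_append, List.map_append, if_neg h]
    simpa using h

theorem sum_uppers {τ : RefTask} {mid : ℕ} {part : ℕ → ℕ} {n : ℕ} (f : RefTask → ℕ) :
    ((uppers τ mid part n).map f).sum = ∑ r ∈ reps n τ.lab part, f (upperTask τ mid part r) := by
  rw [reps, Finset.sum_filter]
  induction n with
  | zero => simp [uppers]
  | succ n ih =>
    rw [uppers_succ, List.map_append, List.sum_append, ih, Finset.sum_range_succ]
    split_ifs <;> simp

theorem length_uppers {τ : RefTask} {mid : ℕ} {part : ℕ → ℕ} {n : ℕ} :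
    (uppers τ mid part n).length = (reps n τ.lab part).card := by
  have := sum_uppers (τ := τ) (mid := mid) (part := part) (n := n) fun _ => 1
  simpa using this

theorem length_uppers_mono {τ : RefTask} {mid : ℕ} {part : ℕ → ℕ} {k n : ℕ} (h : k ≤ n) :
    (uppers τ mid part k).length ≤ (uppers τ mid part n).length := by
  induction h with
  | refl => exact le_rfl
  | step _ ih =>
    refine ih.trans ?_
    rw [uppers_succ, List.length_append]; omega

-- Only representatives trigger the push of a record, at cost `O(n)`; any other node costs a
-- constant. The time is thus `O(n)` per subtask, not `O(n²)` per task.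
set_option maxHeartbeats 1000000 in
theorem pushAll_spec {E : Env} {V : ℕ → ℕ} {μ : Mem} {tape : List ℕ} {τ : RefTask}
    {cur H mid : ℕ} {mg part : ℕ → ℕ} {val : ℕ → ℕ → ℕ}
    (hR : E.Regs V) (hcur : V 11 = cur) (hhp : V 10 = H)
    (h13 : V 13 = τ.lo) (h14 : V 14 = τ.hi) (h15 : V 15 = mid)
    (hcurge : E.H0 ≤ cur) (hcurle : cur + (E.N.n + 2) ≤ H) (hrec : HoldsRec E.N.n μ cur τ)
    (hτ : E.N.TaskOK τ) (hlab : ∀ x < E.N.n, τ.lab x ≤ E.N.n) (hmid : mid ≤ τ.hi)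
    (href : E.N.Refining τ mid mg part val)
    (hmg : ∀ x < E.N.n, μ (E.MG + x) = mg x) (hpt : ∀ x < E.N.n, μ (E.PT + x) = part x)
    (hspace : H + (E.N.n + 2) * ((reps E.N.n τ.lab part).card + 1) ≤ E.hmax) :
    Run E.w E.O pushAllCmd ⟨V, μ, tape⟩
      (200 * (E.N.n + 1) * ((reps E.N.n τ.lab part).card + 1)) 0 fun σ =>
      (∀ y < 18, y ≠ 10 → σ.vars y = V y) ∧
      σ.vars 10 = H + (E.N.n + 2) * (lowerTask E.N τ mid part :: uppers τ mid part E.N.n).length ∧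
      (∀ a < H, σ.mem a = μ a) ∧
      HoldsRecs E.N.n σ.mem H (lowerTask E.N τ mid part :: uppers τ mid part E.N.n) := by
  obtain ⟨l1, l2, l3, l4, l5, l6, l7, l8, l9⟩ := E.layout
  have hq := E.N.q_pos
  have htot := hτ.hi_le
  have hpq : E.N.p + E.N.q < 2 ^ E.w := by
    refine lt_of_lt_of_le ?_ E.word_mul.le
    nlinarith
  have hmq : mid * E.N.q < 2 ^ E.w := by
    refine lt_of_le_of_lt ?_ E.word_mul
    exact Nat.mul_le_mul (by omega) (by omega)
  have hplt : ∀ x < E.N.n, part x < E.N.n := fun x hx => href.part_lt hx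
  have hlen := @length_uppers τ mid part E.N.n
  have hmono : ∀ k ≤ E.N.n, (uppers τ mid part k).length ≤ _ := fun k hk =>
    length_uppers_mono (τ := τ) (mid := mid) (part := part) hk
  set c := (reps E.N.n τ.lab part).card with hc
  have hsp : ∀ j ≤ c, H + (E.N.n + 2) * (j + 1) ≤ E.hmax := fun j hj =>
    le_trans (by gcongr) hspace
  have hMG : ∀ (V' : ℕ → ℕ) (M : Mem) (i x : ℕ), V' 6 = E.MG → V' i = x → x < E.N.n →
      (∀ a < H, M a = μ a) → (readAt 6 (.var i)).eval E.w ⟨V', M, tape⟩ = mg x := by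
    intro V' M i x h1 h2 h3 h4
    simp (disch := omega) only [readAt, Expr.eval, h1, h2, Nat.mod_eq_of_lt]
    rw [h4 _ (by omega), hmg x h3]
  have hPT : ∀ (V' : ℕ → ℕ) (M : Mem) (i x : ℕ), V' 5 = E.PT → V' i = x → x < E.N.n →
      (∀ a < H, M a = μ a) → (readAt 5 (.var i)).eval E.w ⟨V', M, tape⟩ = part x := by
    intro V' M i x h1 h2 h3 h4
    simp (disch := omega) only [readAt, Expr.eval, h1, h2, Nat.mod_eq_of_lt]
    rw [h4 _ (by omega), hpt x h3]
  refine wp_seq.2 (Run.wp (R := 0) (T := 80 * (E.N.n + 1)) (pushRec_spec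
    (τ := lowerTask E.N τ mid part) (H := H)
    (P := fun σ => ∃ M : Mem, (∀ a < H, M a = μ a) ∧ HoldsRec E.N.n M H (lowerTask E.N τ mid part) ∧
      σ = ⟨Function.update (Function.update V 30 E.N.n) 10 (H + (E.N.n + 2)), M, tape⟩)
    hR.r0 hhp (by have := hsp 0 (Nat.zero_le _); omega) h13 ?_ ?_ ?_ ?_) ?_)
  · intro M hM
    simp only [Expr.eval, h15, hR.r2, hR.r3, lowerTask]
    rw [Nat.mod_eq_of_lt hmq, Nat.mod_eq_of_lt hpq, Nat.mod_eq_of_lt (by omega)]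
  · intro M hM x hx
    rw [Expr.eval_sel (p := τ.lab x = 0) (by omega)]
    · simp only [Expr.eval, lowerTask, Nat.zero_mod]
      rw [hPT _ M 30 x (by simp [hR.r5]) (by simp) hx hM]
      have := hplt x hx
      simp (disch := omega) only [Nat.mod_eq_of_lt]
    · simp only [Expr.eval, Nat.zero_mod]
      rw [hMG _ M 30 x (by simp [hR.r6]) (by simp) hx hM]
      simp only [href.mg_zero hx]
    · intro _; simp [Expr.eval]
    · intro _; exact Nat.mod_lt _ (by omega)
  · simp only [Expr.cost, Expr.sel, readAt]; omega
  · exact fun M h1 h2 => ⟨M, h1, h2, rfl⟩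
  rintro _ t₁ r₁ ht₁ hr₁ ⟨M₁, hM₁, hrec₁, rfl⟩
  refine Run.wp (R := 0) (T := (60 * c + 40) * (E.N.n + 1)) (Run.for (cnt := E.N.n)
    (P := fun σ => (∀ y < 18, y ≠ 10 → σ.vars y = V y) ∧
      σ.vars 10 = H + (E.N.n + 2) * (lowerTask E.N τ mid part :: uppers τ mid part E.N.n).length ∧
      (∀ a < H, σ.mem a = μ a) ∧
      HoldsRecs E.N.n σ.mem H (lowerTask E.N τ mid part :: uppers τ mid part E.N.n))
    (fun k σ => (∀ y < 18, y ≠ 10 → σ.vars y = V y) ∧ σ.vars 18 = k ∧ σ.tape = tape ∧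
      σ.vars 10 = H + (E.N.n + 2) * (lowerTask E.N τ mid part :: uppers τ mid part k).length ∧
      (∀ a < H, σ.mem a = μ a) ∧
      HoldsRecs E.N.n σ.mem H (lowerTask E.N τ mid part :: uppers τ mid part k))
    (fun k => 30 + if τ.lab k ≠ 0 ∧ part k = k then 60 * (E.N.n + 1) else 0)
    (by omega) ?_ ?_ ?_ ?_ ?_) ?_
  · refine ⟨fun y hy hy' => ?_, by simp, rfl, by simp [uppers], hM₁, hrec₁, by simp [uppers, HoldsRecs]⟩
    simp only
    rw [Function.update_of_ne (by omega), Function.update_of_ne hy', Function.update_of_ne (by omega)]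
  · rintro k hk ⟨V', M, tape'⟩ ⟨hV', h18, -⟩
    simp only at hV' h18
    exact ⟨by simp only [Expr.eval]; rw [hV' 0 (by omega) (by omega)]; exact hR.r0, h18⟩
  · rintro k hk ⟨V', M, tape'⟩ ⟨hV', h18, htape, h10, hM, hrecs⟩
    simp only at hV' h18 htape h10 hM hrecs
    subst htape
    set H' := H + (E.N.n + 2) * (lowerTask E.N τ mid part :: uppers τ mid part k).length with hH'
    have hHH' : H ≤ H' := by omega
    have hVr : ∀ y < 18, y ≠ 10 → ∀ z, Function.update V' 30 z y = V y := fun y h1 h2 z => by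
      rw [Function.update_of_ne (by omega), hV' y h1 h2]
    have ec : (Expr.mul (.ne (readAt 6 (.var 18)) (.const 0))
        (.eq (readAt 5 (.var 18)) (.var 18))).eval E.w ⟨V', M, tape'⟩
        = if τ.lab k ≠ 0 ∧ part k = k then 1 else 0 := by
      have h1 : (Expr.var 18).eval E.w ⟨V', M, tape'⟩ = k := h18
      have h2 : (Expr.const 0).eval E.w ⟨V', M, tape'⟩ = 0 := by simp [Expr.eval]
      have h3 : ∀ a b : Expr, (Expr.mul a b).eval E.w ⟨V', M, tape'⟩ =
        a.eval E.w ⟨V', M, tape'⟩ * b.eval E.w ⟨V', M, tape'⟩ % 2 ^ E.w := fun _ _ => rfl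
      have h4 : ∀ a b : Expr, (Expr.eq a b).eval E.w ⟨V', M, tape'⟩ =
        if a.eval E.w ⟨V', M, tape'⟩ = b.eval E.w ⟨V', M, tape'⟩ then 1 else 0 := fun _ _ => rfl
      rw [h3, h4, Expr.eval_ne, h1, h2,
        hMG _ M 18 k (by rw [hV' 6 (by omega) (by omega)]; exact hR.r6) h18 hk hM,
        hPT _ M 18 k (by rw [hV' 5 (by omega) (by omega)]; exact hR.r5) h18 hk hM]
      have h5 := href.mg_zero hk
      have h6 : 1 % 2 ^ E.w = 1 := Nat.mod_eq_of_lt (by omega)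
      by_cases ha : τ.lab k = 0 <;> by_cases hb : part k = k <;> simp [h5, ha, hb, h6]
    refine wp_ite.2 ⟨fun h' => ?_, fun h' => ?_⟩
    · rw [ec] at h'
      have hk' : τ.lab k ≠ 0 ∧ part k = k := by
        by_contra hn; rw [if_neg hn] at h'; exact h' rfl
      have hU := @uppers_succ τ mid part k
      rw [if_pos hk'] at hU
      have hlen' : (uppers τ mid part k).length + 1 ≤ c := by
        have := hmono (k + 1) hk
        rw [hU, List.length_append, List.length_singleton] at this
        omega
      refine Run.wp (R := 0) (T := 60 * (E.N.n + 1)) (pushRec_spec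
        (τ := upperTask τ mid part k) (H := H') (P := fun σ => ∃ M' : Mem, (∀ a < H', M' a = M a) ∧
          HoldsRec E.N.n M' H' (upperTask τ mid part k) ∧
          σ = ⟨Function.update (Function.update V' 30 E.N.n) 10 (H' + (E.N.n + 2)), M', tape'⟩)
        (by rw [hV' 0 (by omega) (by omega)]; exact hR.r0) h10 ?_ ?_ ?_ ?_ ?_ ?_) ?_
      · have := hsp _ hlen'
        rw [hH', List.length_cons]
        refine le_trans (le_of_eq ?_) this
        ring
      · simp only [Expr.eval, upperTask]; rw [hV' 15 (by omega) (by omega), h15]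
      · intro M' _
        simp only [Expr.eval, upperTask]; rw [hV' 14 (by omega) (by omega), h14]
      · intro M' hM' x hx
        have hM'' : ∀ a < H, M' a = μ a := fun a ha => (hM' a (by omega)).trans (hM a ha)
        have h1 : (Expr.var 18).eval E.w ⟨Function.update V' 30 x, M', tape'⟩ = k := by
          simp [Expr.eval, h18]
        have h2 : (Expr.load (.add (.add (.var 11) (.const 2)) (.var 30))).eval E.w
            ⟨Function.update V' 30 x, M', tape'⟩ = τ.lab x := by
          simp only [Expr.eval, Function.update_self]
          rw [hVr 11 (by omega) (by omega), hcur]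
          simp (disch := omega) only [Nat.mod_eq_of_lt]
          rw [hM'' _ (by omega), hrec.2.2 x hx]
        have h3 : ∀ a b : Expr, (Expr.mul a b).eval E.w ⟨Function.update V' 30 x, M', tape'⟩ =
          a.eval E.w ⟨Function.update V' 30 x, M', tape'⟩ *
          b.eval E.w ⟨Function.update V' 30 x, M', tape'⟩ % 2 ^ E.w := fun _ _ => rfl
        have h4 : ∀ a b : Expr, (Expr.eq a b).eval E.w ⟨Function.update V' 30 x, M', tape'⟩ =
          if a.eval E.w ⟨Function.update V' 30 x, M', tape'⟩ =
            b.eval E.w ⟨Function.update V' 30 x, M', tape'⟩ then 1 else 0 := fun _ _ => rfl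
        rw [h3, h4, h1, h2, hPT _ M' 30 x (by rw [hVr 5 (by omega) (by omega)]; exact hR.r5)
          (by simp) hx hM'']
        have h5 := hlab x hx
        simp only [upperTask]
        split_ifs
        · rw [one_mul, Nat.mod_eq_of_lt (by omega)]
        · simp
      · simp only [Expr.cost, readAt]; omega
      · exact fun M' h1 h2 => ⟨M', h1, h2, rfl⟩
      rintro _ t r ht hr ⟨M', hM', hrec', rfl⟩
      refine ⟨?_, by omega, ?_, ?_, by simp, rfl, ?_, ?_, ?_⟩
      · rw [if_pos hk']
        simp only [Expr.cost, Expr.ne, readAt]; omega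
      · simp [h18]
      · intro y hy hy'
        simp only
        rw [Function.update_of_ne (by omega), Function.update_of_ne hy', hVr y hy hy']
      · simp only
        rw [Function.update_of_ne (by omega), Function.update_self, hU, hH']
        simp only [List.length_cons, List.length_append, List.length_nil]
        ring
      · exact fun a ha => (hM' a (by omega)).trans (hM a ha)
      · rw [hU, ← List.cons_append]
        refine HoldsRecs.append (hrecs.frame fun a _ ha => hM' a ha) ?_
        exact ⟨hrec', trivial⟩
    · rw [ec] at h'
      have hk' : ¬ (τ.lab k ≠ 0 ∧ part k = k) := by
        intro hn; rw [if_pos hn] at h'; exact one_ne_zero h'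
      have hU := @uppers_succ τ mid part k
      rw [if_neg hk', List.append_nil] at hU
      refine wp_skip.2 ⟨?_, le_rfl, h18, ?_, by simp, rfl, ?_, ?_, ?_⟩
      · simp only [Expr.cost, Expr.ne, readAt]; omega
      · intro y hy hy'
        simp only
        rw [Function.update_of_ne (by omega), hV' y hy hy']
      · simp only
        rw [Function.update_of_ne (by omega), hU, h10]
      · exact hM
      · rw [hU]; exact hrecs
  · rw [Finset.sum_add_distrib, ← Finset.sum_filter, Finset.sum_const, Finset.sum_const,
      Finset.card_range]
    change E.N.n • 30 + c • _ + _ ≤ _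
    simp only [smul_eq_mul, Expr.cost]
    have h1 : (60 * c + 40) * (E.N.n + 1) = c * (60 * (E.N.n + 1)) + 40 * (E.N.n + 1) := by ring
    omega
  · rintro σ ⟨h1, -, -, h2⟩
    exact ⟨h1, h2⟩
  · rintro σ t r ht hr h
    refine ⟨?_, by omega, h⟩
    have h1 : 200 * (E.N.n + 1) * (c + 1) = 80 * (E.N.n + 1) + (60 * c + 40) * (E.N.n + 1) +
      (140 * c + 80) * (E.N.n + 1) := by ring
    omega

end Env

/-- Processes the task at the current record. -/
def processCmd : Cmd :=
  .seq (.assign 13 (.load (.var 11))) <|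
  .seq (.assign 14 (.load (.add (.var 11) (.const 1)))) <|
  .seq (.ite (.lt (.var 13) (.var 14))
      (.seq prepareCmd <| .seq scanCmd <| .ite (.var 16) pushAllCmd .skip) .skip) <|
    .assign 11 (.add (.var 11) (.add (.var 0) (.const 2)))

/-- Processes all tasks. -/
def refineCmd : Cmd := .loop (.lt (.var 11) (.var 10)) processCmd

/-! ### Halving the range of thresholds -/

namespace Net

/-- The number of halvings left times `f`. -/
def weight (f : RefTask → ℕ) (τ : RefTask) : ℕ := Nat.size (τ.hi - τ.lo) * f τ

/-- Halving removes a binary digit. -/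
theorem size_succ_le {d d' : ℕ} (h0 : 0 < d) (h : d' ≤ d / 2) : Nat.size d' + 1 ≤ Nat.size d := by
  have h1 : 0 < Nat.size d := Nat.size_pos.2 h0
  obtain ⟨s, hs⟩ : ∃ s, Nat.size d = s + 1 := ⟨Nat.size d - 1, by omega⟩
  have h2 : d < 2 ^ (s + 1) := Nat.size_le.1 hs.le
  rw [pow_succ] at h2
  have h3 : Nat.size d' ≤ s := Nat.size_le.2 (by omega)
  omega

/-- Every subtask has at least one digit less in the length of its range. With the additivity `hf`
of `f`, the total weight drops by at least `f τ`, which pays for the work on `τ`. The records of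
stored cuts have weight `0`. -/
theorem weight_subtasks {N : Net} {τ : RefTask} {part : ℕ → ℕ} {l : List RefTask}
    {f : RefTask → ℕ} {mid : ℕ} (hmid : mid = (τ.lo + τ.hi + 1) / 2) (hlt : τ.lo < τ.hi)
    (hl : ∀ τ' ∈ l, τ'.hi = 0)
    (hf : f (lowerTask N τ mid part) + ∑ r ∈ reps N.n τ.lab part, f (upperTask τ mid part r) ≤ f τ) :
    ((l ++ lowerTask N τ mid part :: Env.uppers τ mid part N.n).map (weight f)).sum + f τ
      ≤ weight f τ := by
  have h1 : (l.map (weight f)).sum = 0 := by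
    rw [List.sum_eq_zero_iff]
    simp only [List.mem_map]
    rintro x ⟨τ', hτ', rfl⟩
    simp [weight, hl τ' hτ']
  -- For a range of length `d`, rounding `mid` up leaves length `⌊d / 2⌋` above, and at most `⌊(d -
  -- 1) / 2⌋` below because the lower `hi` is strictly less than `mid`.
  have hlow := lower_hi_lt (N := N) (mid := mid) (by omega)
  have h2 : Nat.size ((lowerTask N τ mid part).hi - (lowerTask N τ mid part).lo) + 1 ≤
      Nat.size (τ.hi - τ.lo) := size_succ_le (by omega) (by simp only [lowerTask]; omega)
  have h3 : ∀ r, Nat.size ((upperTask τ mid part r).hi - (upperTask τ mid part r).lo) + 1 ≤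
      Nat.size (τ.hi - τ.lo) := fun r => size_succ_le (by omega) (by simp only [upperTask]; omega)
  rw [List.map_append, List.sum_append, h1, List.map_cons, List.sum_cons, Env.sum_uppers]
  obtain ⟨s, hs⟩ : ∃ s, Nat.size (τ.hi - τ.lo) = s + 1 := ⟨_, (Nat.sub_add_cancel (by omega)).symm⟩
  have h4 : weight f (lowerTask N τ mid part) ≤ s * f (lowerTask N τ mid part) :=
    Nat.mul_le_mul_right _ (by omega)
  have h5 : ∑ r ∈ reps N.n τ.lab part, weight f (upperTask τ mid part r) ≤
      s * ∑ r ∈ reps N.n τ.lab part, f (upperTask τ mid part r) := by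
    rw [Finset.mul_sum]
    exact Finset.sum_le_sum fun r _ => Nat.mul_le_mul_right _ (by have := h3 r; omega)
  have h6 := Nat.mul_le_mul_left s hf
  rw [mul_add] at h6
  simp only [weight, hs, add_mul, one_mul] at h4 h5 ⊢
  omega

theorem le_weight {f : RefTask → ℕ} {τ : RefTask} (hlt : τ.lo < τ.hi) : f τ ≤ weight f τ :=
  Nat.le_mul_of_pos_left _ (Nat.size_pos.2 (by omega))

end Net

/-! ### Processing the list of tasks -/

namespace Env

open Net

/-- The invariant of `refineCmd`. -/
structure Main (E : Env) (cur : ℕ) (todo : List RefTask) (σ : State) : Prop where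
  regs : E.Regs σ.vars
  cur_eq : σ.vars 11 = cur
  cur_ge : E.H0 ≤ cur
  hp : σ.vars 10 = cur + (E.N.n + 2) * todo.length
  heap : E.HeapOK σ.mem (cur + (E.N.n + 2) * todo.length)
  recs : HoldsRecs E.N.n σ.mem cur todo
  ok : ∀ τ ∈ todo, τ.lo < τ.hi → E.N.TaskOK τ ∧ ∀ x < E.N.n, τ.lab x ≤ E.N.n
  cover : ∀ u < E.N.n, ∀ v < E.N.n, u ≠ v → E.N.Done (E.val σ.mem u v) u v ∨
    ∃ τ ∈ todo, E.N.Pending τ (E.val σ.mem u v) u v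

/-- The number of labels, minus one. -/
def labels (E : Env) (τ : RefTask) : ℕ := numLab E.N.n τ.lab - 1

/-- The number of pairs with different labels. -/
def pairs (E : Env) (τ : RefTask) : ℕ := numPairs E.N.n τ.lab

-- For a nonempty range `x` is the number of labels minus one and `y` the number of pairs with
-- different labels; for an empty range both are `0`. The weights of the new records drop by these
-- amounts, so summing over all tasks telescopes.
set_option maxHeartbeats 1000000 in
theorem process_spec {E : Env} {cur : ℕ} {τ : RefTask} {todo : List RefTask} {σ : State}
    (h : E.Main cur (τ :: todo) σ) (hS : E.Sound)
    (hspace : cur + (E.N.n + 2) * (todo.length + 1) + (E.N.n + 2) *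
      (4 * ((τ :: todo).map (weight E.labels)).sum) ≤ E.hmax) :
    ∃ x y, Run E.w E.O processCmd σ
      ((2 * E.tA + 1600 * (E.N.n + E.m + 1)) * x + 80 * y + 150 * (E.N.n + 1)) (2 * x) fun σ' =>
      ∃ new, E.Main (cur + (E.N.n + 2)) (todo ++ new) σ' ∧ new.length ≤ 4 * x ∧
        (new.map (weight E.labels)).sum + x ≤ weight E.labels τ ∧
        (new.map (weight E.pairs)).sum + y ≤ weight E.pairs τ := by
  obtain ⟨l1, l2, l3, l4, l5, l6, l7, l8, l9⟩ := E.layout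
  obtain ⟨V, μ, tape⟩ := σ
  have hR := h.regs
  have hcur : V 11 = cur := h.cur_eq
  have hhp : V 10 = cur + (E.N.n + 2) * (todo.length + 1) := h.hp
  have hheap : E.HeapOK μ (cur + (E.N.n + 2) * (todo.length + 1)) := h.heap
  have hge := h.cur_ge
  have hrec : HoldsRec E.N.n μ cur τ := h.recs.1
  have hrecs : HoldsRecs E.N.n μ (cur + (E.N.n + 2)) todo := h.recs.2
  have hcover := h.cover
  simp only [List.map_cons, List.sum_cons] at hspace
  simp only at hR hcover
  set H := cur + (E.N.n + 2) * (todo.length + 1) with hH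
  have hHle := hheap.le
  have hcurle : cur + (E.N.n + 2) ≤ H := by
    rw [hH, mul_add, mul_one]; omega
  have hHeq : H = (cur + (E.N.n + 2)) + (E.N.n + 2) * todo.length := by rw [hH]; ring
  set V₁ := Function.update (Function.update V 13 τ.lo) 14 τ.hi with hV₁
  have hV₁' : ∀ y, y ≠ 13 → y ≠ 14 → V₁ y = V y := fun y h1 h2 => by
    rw [hV₁, Function.update_of_ne h2, Function.update_of_ne h1]
  have h13 : V₁ 13 = τ.lo := by simp [hV₁]
  have h14 : V₁ 14 = τ.hi := by simp [hV₁]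
  have hR₁ : E.Regs V₁ := (hR.update 13 _).update 14 _
  -- the commands around the conditional
  have hwrap : ∀ (T R : ℕ) (Q : State → Prop),
      Run E.w E.O (.ite (.lt (.var 13) (.var 14))
        (.seq prepareCmd <| .seq scanCmd <| .ite (.var 16) pushAllCmd .skip) .skip) ⟨V₁, μ, tape⟩ T R
        (fun σ => σ.vars 11 = cur ∧ σ.vars 0 = E.N.n ∧
          Q ⟨Function.update σ.vars 11 (cur + (E.N.n + 2)), σ.mem, σ.tape⟩) →
      Run E.w E.O processCmd ⟨V, μ, tape⟩ (T + 20) R Q := by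
    intro T R Q hQ
    refine wp_seq.2 (wp_assign.2 (wp_seq.2 (wp_assign.2 (wp_seq.2 ?_))))
    have e1 : (Expr.load (.var 11)).eval E.w ⟨V, μ, tape⟩ = τ.lo := by
      simp only [Expr.eval, hcur]; exact hrec.1
    have e2 : (Expr.load (.add (.var 11) (.const 1))).eval E.w
        ⟨Function.update V 13 τ.lo, μ, tape⟩ = τ.hi := by
      simp only [Expr.eval, ne_eq, Nat.reduceEqDiff, not_false_eq_true, Function.update_of_ne, hcur]
      simp (disch := omega) only [Nat.mod_eq_of_lt]
      exact hrec.2.1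
    simp only [e1, e2]
    refine hQ.wp ?_
    rintro ⟨V', μ', tape'⟩ t r ht hr ⟨h11, h0, hQ'⟩
    simp only at h11 h0 hQ'
    refine wp_assign.2 ⟨by simp only [Expr.cost]; omega, by omega, ?_⟩
    have e3 : (Expr.add (.var 11) (.add (.var 0) (.const 2))).eval E.w ⟨V', μ', tape'⟩
        = cur + (E.N.n + 2) := by
      simp (disch := omega) only [Expr.eval, h11, h0, Nat.mod_eq_of_lt]
    rw [e3]
    exact hQ'
  by_cases hlt : τ.lo < τ.hi
  · obtain ⟨hτ, hlab⟩ := h.ok τ (by simp) hlt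
    have hwt : E.labels τ ≤ weight E.labels τ := le_weight hlt
    refine ⟨E.labels τ, E.pairs τ, ?_⟩
    set x := E.labels τ with hx
    have hspx : H + (E.N.n + 2) * (4 * x) ≤ E.hmax := by
      refine le_trans ?_ hspace
      gcongr
      omega
    refine Run.mono (hwrap (100 * (E.N.n + 1) + (((E.tA + 500 * (E.N.n + E.m + 1)) * (2 * x) +
      80 * E.pairs τ + 30 * E.N.n + 10) + (600 * (E.N.n + 1) * x + 20)) + 10) (2 * x) _ ?_)
      ?_ le_rfl (fun _ h => h)
    swap
    · nlinarith [Nat.zero_le (E.m * x)]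
    refine wp_ite.2 ⟨fun _ => ?_, fun h' => ?_⟩
    swap
    · simp [Expr.eval, h13, h14, hlt] at h'
    refine wp_seq.2 (Run.wp (prepare_spec (H := H) (cur := cur) hR₁ hheap (by simp [hV₁, hcur])
      (by simp [hV₁, hhp]) h13 h14 hge hcurle hrec hτ hlab hlt) ?_)
    rintro σ₂ t₂ r₂ ht₂ hr₂ ⟨h17, part₀, hscan₀, hql⟩
    set mid := (τ.lo + τ.hi + 1) / 2 with hmid
    have hmidle : mid ≤ τ.hi := by omega
    refine wp_seq.2 (Run.wp (scan_spec hscan₀ hS hτ hmidle (by omega) ?_ h17) ?_)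
    · refine le_trans ?_ hspx
      gcongr
      simp only [hx, labels]
      omega
    rintro σ₃ t₃ r₃ ht₃ hr₃ ⟨mg, part, l, hscan, hset⟩
    have ht₃' : t₃ ≤ (E.tA + 500 * (E.N.n + E.m + 1)) * (2 * x) +
        80 * E.pairs τ + 30 * E.N.n + 10 := by
      refine ht₃.trans ?_
      have := openPairs_le E.N.n τ.lab part₀
      simp only [pairs, hx, labels]
      gcongr
    have hr₃' : r₃ ≤ 2 * x := hr₃.trans hql
    obtain ⟨V₃, μ₃, tape₃⟩ := σ₃
    have h11 : V₃ 11 = cur := hscan.cur_eq.trans (by simp [hV₁, hcur])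
    have hvalmono : ∀ {u v}, u < E.N.n → v < E.N.n → E.val μ₃ u v ≤ E.val μ u v := hscan.mono
    have hrec₃ : HoldsRec E.N.n μ₃ cur τ := hrec.frame fun a h1 h2 =>
      hscan.frame a (by omega) (by omega)
    have hrecs₃ : HoldsRecs E.N.n μ₃ (cur + (E.N.n + 2)) todo := hrecs.frame fun a h1 h2 =>
      hscan.frame a (by omega) (by omega)
    have hcover₃ : ∀ u < E.N.n, ∀ v < E.N.n, u ≠ v → E.N.Done (E.val μ₃ u v) u v ∨
        (∃ τ' ∈ todo, E.N.Pending τ' (E.val μ₃ u v) u v) ∨ E.N.Pending τ (E.val μ₃ u v) u v := by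
      intro u hu v hv huv
      have hm := hvalmono hu hv
      rcases hcover u hu v hv huv with h1 | ⟨τ', hτ', h1⟩
      · exact Or.inl (h1.mono hm)
      · rcases List.mem_cons.1 hτ' with rfl | hτ'
        · exact Or.inr (Or.inr (h1.mono hm))
        · exact Or.inr (Or.inl ⟨τ', hτ', h1.mono hm⟩)
    refine wp_ite.2 ⟨fun hflag => ?_, fun hflag => ?_⟩
    · -- subtasks
      have htwo := hscan.two_le hflag
      have hlen := hscan.len
      have hreps := hscan.ref.card_reps_le
      -- With `L` labels there are at most `L - 1` cuts, `L` upper tasks and one lower task. Their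
      -- number is at most `4 * (L - 1)` only because `L ≥ 2`, which is why subtasks are created
      -- only after a query.
      have hbig : l.length + ((reps E.N.n τ.lab part).card + 1) ≤ 4 * x := by
        simp only [hx, labels]; omega
      have hhp₃ := hscan.hp
      simp only at hhp₃
      refine Run.wp (pushAll_spec (H := H + (E.N.n + 2) * l.length) hscan.regs h11 hhp₃
        (hscan.lo_eq.trans h13) (hscan.hi_eq.trans h14) hscan.mid_eq hge (by omega) hrec₃ hτ hlab
        hmidle hscan.ref hscan.mg_eq hscan.part_eq ?_) ?_
      · refine le_trans ?_ hspx
        rw [add_assoc, ← mul_add]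
        gcongr
      rintro ⟨V₄, μ₄, tape₄⟩ t₄ r₄ ht₄ hr₄ ⟨hV₄, h10, hf₄, hrecs₄⟩
      simp only at hV₄ h10 hf₄ hrecs₄
      set subs := lowerTask E.N τ mid part :: uppers τ mid part E.N.n with hsubs
      have hsublen : subs.length = (reps E.N.n τ.lab part).card + 1 := by
        rw [hsubs, List.length_cons, length_uppers]
      have hHend : H + (E.N.n + 2) * l.length + (E.N.n + 2) * subs.length =
          (cur + (E.N.n + 2)) + (E.N.n + 2) * (todo ++ (l ++ subs)).length := by
        simp only [List.length_append]; rw [hHeq]; ring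
      have hend : (cur + (E.N.n + 2)) + (E.N.n + 2) * (todo ++ (l ++ subs)).length ≤ E.hmax := by
        rw [← hHend, hsublen, add_assoc, ← mul_add]
        refine le_trans ?_ hspx
        gcongr
      have hmul₄ : ∃ k, (cur + (E.N.n + 2)) + (E.N.n + 2) * (todo ++ (l ++ subs)).length =
          E.H0 + (E.N.n + 2) * k := by
        obtain ⟨k, hk⟩ := hscan.heap.mul
        exact ⟨k + subs.length, by rw [← hHend, hk]; ring⟩
      obtain ⟨hheap₄, hval₄⟩ := hscan.heap.frame (μ' := μ₄)
        (H' := (cur + (E.N.n + 2)) + (E.N.n + 2) * (todo ++ (l ++ subs)).length)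
        (by rw [← hHend]; omega) hend hmul₄
        (hscan.heap.input.frame fun a ha => hf₄ a (by omega))
        (fun a h1 h2 => hf₄ a h2)
      refine ⟨?_, by omega, (hV₄ 11 (by omega) (by omega)).trans h11,
        (hV₄ 0 (by omega) (by omega)).trans hscan.regs.r0, l ++ subs, ?_, ?_, ?_, ?_⟩
      · have h4 : t₄ ≤ 600 * (E.N.n + 1) * x := by
          refine ht₄.trans ?_
          calc 200 * (E.N.n + 1) * ((reps E.N.n τ.lab part).card + 1)
              ≤ 200 * (E.N.n + 1) * (3 * x) := by
                gcongr; simp only [hx, labels]; omega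
            _ = _ := by ring
        simp only [Expr.cost]
        omega
      · refine ⟨?_, by simp, by omega, ?_, hheap₄, ?_, ?_, ?_⟩
        · have hR₄ : E.Regs V₄ := by
            have hR₃ := hscan.regs
            constructor <;> rw [hV₄ _ (by decide) (by decide)]
            exacts [hR₃.r0, hR₃.r1, hR₃.r2, hR₃.r3, hR₃.r4, hR₃.r5, hR₃.r6, hR₃.r7, hR₃.r9]
          exact hR₄.update 11 _
        · simp only [ne_eq, Nat.reduceEqDiff, not_false_eq_true, Function.update_of_ne]
          rw [h10, ← hHend]
        · refine HoldsRecs.append (hrecs₃.frame fun a h1 h2 => hf₄ a (by omega)) ?_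
          simp only
          rw [← hHeq]
          exact HoldsRecs.append (hscan.recs.frame fun a h1 h2 => hf₄ a h2) hrecs₄
        · intro τ' hτ' hlt'
          rcases List.mem_append.1 hτ' with h1 | h1
          · exact h.ok τ' (List.mem_cons_of_mem _ h1) hlt'
          rcases List.mem_append.1 h1 with h1 | h1
          · have := hscan.skip τ' h1; omega
          rcases List.mem_cons.1 h1 with rfl | h1
          · refine ⟨hscan.ref.lower_ok hset hτ hmidle (by omega), fun z hz => ?_⟩
            simp only [lowerTask]
            have := hscan.ref.part_lt hz
            split_ifs <;> omega
          · simp only [uppers, List.mem_map] at h1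
            obtain ⟨r, -, rfl⟩ := h1
            refine ⟨hscan.ref.upper_ok hset hτ r, fun z hz => ?_⟩
            simp only [upperTask]
            have := hlab z hz
            split_ifs <;> omega
        · intro u hu v hv huv
          simp only
          rw [hval₄ hu hv]
          rcases hcover₃ u hu v hv huv with h1 | ⟨τ', hτ', h1⟩ | h1
          · exact Or.inl h1
          · exact Or.inr ⟨τ', List.mem_append_left _ hτ', h1⟩
          · right
            rcases hscan.ref.pending_sub hset hτ hmidle (by omega) hu hv h1 with h2 | ⟨r, hr, h0, h2, h3⟩
            · exact ⟨_, by simp [hsubs], h2⟩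
            · refine ⟨_, ?_, h3⟩
              simp only [hsubs, List.mem_append, List.mem_cons, uppers, List.mem_map, List.mem_filter,
                List.mem_range]
              right; right; right
              exact ⟨r, ⟨hr, by simp [h0, h2]⟩, rfl⟩
      · rw [List.length_append, hsublen]; exact hbig
      · exact weight_subtasks hmid hlt hscan.skip hscan.ref.sum_numLab
      · exact weight_subtasks hmid hlt hscan.skip hscan.ref.sum_numPairs
    · -- no pair is left
      obtain ⟨rfl, hmglab, hpart⟩ := hscan.flag hflag
      refine wp_skip.2 ⟨by simp only [Expr.cost]; omega, by omega, h11, hscan.regs.r0, [], ?_, by simp,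
        by simpa using hwt, by simpa using (le_weight (f := E.pairs) hlt)⟩
      rw [List.append_nil]
      have hheap₃ := hscan.heap
      have hhp₃ := hscan.hp
      simp only [List.length_nil, mul_zero, add_zero, hHeq] at hheap₃ hhp₃
      refine ⟨hscan.regs.update 11 _, by simp, by omega, by simp [hhp₃], hheap₃, hrecs₃,
        fun τ' hτ' => h.ok τ' (List.mem_cons_of_mem _ hτ'), ?_⟩
      intro u hu v hv huv
      -- A pair pending in `τ` itself would have different labels, but all nodes are in the class of
      -- the common representative and classes are still clusters.
      rcases hcover₃ u hu v hv huv with h1 | h1 | ⟨-, h2, h3, h4, -⟩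
      · exact Or.inl h1
      · exact Or.inr h1
      · exfalso
        apply h4
        rw [← hmglab u hu, ← hmglab v hv, hset u hu, hset v hv, hpart u hu v hv h2 h3]
  -- An empty range: a stored cut or a finished task. Pairs pending there are done by
  -- `Pending.done`.
  · refine ⟨0, 0, ?_⟩
    refine Run.mono (hwrap 10 0 _ ?_) (by omega) le_rfl (fun _ h => h)
    refine wp_ite.2 ⟨fun h' => ?_, fun _ => ?_⟩
    · simp [Expr.eval, h13, h14, hlt] at h'
    refine wp_skip.2 ⟨by simp [Expr.cost], le_rfl, by simp [hV₁, hcur], hR₁.r0, [], ?_, by simp, by simp,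
      by simp⟩
    rw [List.append_nil]
    refine ⟨hR₁.update 11 _, by simp, by omega, ?_, ?_, hrecs,
      fun τ' hτ' => h.ok τ' (List.mem_cons_of_mem _ hτ'), ?_⟩
    · simp [hV₁, hhp, hHeq]
    · rw [← hHeq]; exact hheap
    · intro u hu v hv huv
      rcases hcover u hu v hv huv with h1 | ⟨τ', hτ', h1⟩
      · exact Or.inl h1
      rcases List.mem_cons.1 hτ' with rfl | hτ'
      · exact Or.inl (h1.done hu hv (by omega))
      · exact Or.inr ⟨τ', hτ', h1⟩

/-- A bound on the time of `refineCmd`. -/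
def timeBound (E : Env) (todo : List RefTask) : ℕ :=
  (2 * E.tA + 2300 * (E.N.n + E.m + 1)) * (todo.map (weight E.labels)).sum +
    80 * (todo.map (weight E.pairs)).sum + 160 * (E.N.n + 1) * todo.length + 10

/-- The hypothesis `hspace` reserves room for all future records: a task that uses up `x` of the
weight appends at most `4 * x` records, so the reserve is preserved. -/
theorem refine_spec {E : Env} {cur : ℕ} {todo : List RefTask} {σ : State}
    (h : E.Main cur todo σ) (hS : E.Sound)
    (hspace : cur + (E.N.n + 2) * todo.length + (E.N.n + 2) *
      (4 * (todo.map (weight E.labels)).sum) ≤ E.hmax) :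
    Run E.w E.O refineCmd σ (E.timeBound todo) (2 * (todo.map (weight E.labels)).sum) fun σ' =>
      ∃ H, E.Main H [] σ' := by
  refine Run.loop (fun σ T R => ∃ cur todo, E.Main cur todo σ ∧
    cur + (E.N.n + 2) * todo.length + (E.N.n + 2) * (4 * (todo.map (weight E.labels)).sum) ≤ E.hmax ∧
    T = E.timeBound todo ∧ R = 2 * (todo.map (weight E.labels)).sum) ?_
    ⟨cur, todo, h, hspace, rfl, rfl⟩
  rintro σ T R ⟨cur, todo, h, hspace, rfl, rfl⟩
  cases todo with
  | nil =>
    left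
    have h1 := h.hp
    have h2 := h.cur_eq
    simp only [List.length_nil, mul_zero, add_zero] at h1
    refine ⟨by simp [Expr.eval, h1, h2], by simp [Expr.cost, timeBound], cur, h⟩
  | cons τ todo =>
    right
    obtain ⟨x, y, hrun⟩ := process_spec h hS hspace
    have h1 := h.hp
    have h2 := h.cur_eq
    refine ⟨by simp [Expr.eval, h1, h2], _, _, hrun.mono le_rfl le_rfl ?_⟩
    rintro σ' ⟨new, hmain, hlen, hw, hp⟩
    simp only [List.map_cons, List.sum_cons, List.length_cons] at hspace
    refine ⟨_, _, ⟨_, _, hmain, ?_, rfl, rfl⟩, ?_, ?_⟩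
    · refine le_trans ?_ hspace
      have h3 : (E.N.n + 2) * new.length + (E.N.n + 2) * (4 * (new.map (weight E.labels)).sum) ≤
          (E.N.n + 2) * (4 * weight E.labels τ) := by
        rw [← mul_add]
        exact Nat.mul_le_mul_left _ (by omega)
      simp only [List.map_append, List.sum_append, List.length_append]
      nlinarith
    · simp only [timeBound, List.map_append, List.sum_append, List.length_append, List.map_cons,
        List.sum_cons, List.length_cons, Expr.cost]
      -- The `2300` covers the `1600` of processing and the `4 * 160` set aside for visiting the new
      -- records later.
      have h3 := Nat.mul_le_mul_left (2 * E.tA + 2300 * (E.N.n + E.m + 1)) hw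
      have h4 := Nat.mul_le_mul_left (160 * (E.N.n + 1)) hlen
      have h5 : 0 ≤ E.N.n * x := Nat.zero_le _
      have h6 : 0 ≤ E.m * x := Nat.zero_le _
      linarith
    · simp only [List.map_append, List.sum_append, List.map_cons, List.sum_cons]
      omega

end Env

/-- Computes the addresses of the memory blocks. -/
def layoutCmd : Cmd :=
  .seq (.assign 0 (.load (.const 0))) <| .seq (.assign 1 (.load (.const 1))) <|
  .seq (.assign 2 (.load (.const 2))) <| .seq (.assign 3 (.load (.const 3))) <|
  .seq (.assign 4 (.add (.add (.const 4) (.mul (.const 3) (.var 1))) (.mul (.const 3) (.var 0)))) <|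
  .seq (.assign 5 (.add (.add (.var 4) (.const 6)) (.mul (.const 3) (.var 1)))) <|
  .seq (.assign 6 (.add (.var 5) (.var 0))) <| .seq (.assign 7 (.add (.var 6) (.var 0))) <|
  .seq (.assign 9 (.add (.var 7) (.var 0))) (.assign 11 (.add (.var 9) (.mul (.var 0) (.var 0))))

/-- Copies the input, computes the total capacity, and creates the dummy record, the pointer matrix
and the first task. -/
def setupCmd : Cmd :=
  .seq layoutCmd <|
  .seq (.fill 30 (.add (.var 4) (.const 2)) (.add (.const 4) (.mul (.const 3) (.var 1)))
    (.load (.var 30))) <|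
  .seq (.sum 30 14 (.var 1) (.load (.add (.const 6) (.mul (.const 3) (.var 30))))) <|
  .seq (.store (.var 11) (.add (.var 14) (.const 1))) <|
  .seq (.store (.add (.var 11) (.const 1)) (.const 0)) <|
  .seq (.fill 30 (.var 9) (.mul (.var 0) (.var 0)) (.var 11)) <|
  .seq (.assign 13 (.const 0)) <|
  .seq (.assign 10 (.add (.var 11) (.add (.var 0) (.const 2)))) <|
  pushRecCmd (.var 13) (.var 14) (.add (.var 30) (.const 1))

/-! ### The first task and the initial memory -/

namespace Net

/-- The task of refining the clusters of single nodes. -/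
def firstTask (N : Net) : RefTask := ⟨0, N.tot, fun v => v + 1⟩

/-- Clusters are single nodes, so the cluster condition is vacuous, and linkedness at threshold `1`
is the positivity of the cut values. -/
theorem firstTask_ok (N : Net) : N.TaskOK N.firstTask where
  hi_le := le_rfl
  lab_lam {u v} _ _ huv _ h := by simp only [firstTask] at h; omega
  linked {u v} hu hv _ _ huv := by
    have h1 := N.lam_pos hu hv huv
    have h2 := N.lam_le hu hv huv
    simp only [firstTask]
    refine ⟨by omega, ?_⟩
    calc (0 + 1) * N.q ≤ N.lam u v * (N.p + N.q) := Nat.mul_le_mul (by omega) (by omega)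
      _ = _ := by ring

end Net

namespace Env

open Net

/-- The initial contents of the heap. -/
def firstTodo (E : Env) (lab : ℕ → ℕ) : List RefTask := [⟨E.N.tot + 1, 0, lab⟩, E.N.firstTask]

theorem layout_spec (E : Env) {tape : List ℕ} {P : State → Prop}
    (hP : ∀ V, E.Regs V → V 11 = E.H0 → P ⟨V, loadList E.inp, tape⟩) :
    Run E.w E.O layoutCmd ⟨fun _ => 0, loadList E.inp, tape⟩ 100 0 P := by
  obtain ⟨l1, l2, l3, l4, l5, l6, l7, l8, l9⟩ := E.layout
  refine wp_seq.2 (wp_assign.2 (wp_seq.2 (wp_assign.2 (wp_seq.2 (wp_assign.2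
    (wp_seq.2 (wp_assign.2 ?_)))))))
  have h1 : 1 % 2 ^ E.w = 1 := Nat.mod_eq_of_lt (by omega)
  have h2 : 2 % 2 ^ E.w = 2 := Nat.mod_eq_of_lt (by omega)
  have h3 : 3 % 2 ^ E.w = 3 := Nat.mod_eq_of_lt (by omega)
  simp only [Expr.eval, Nat.zero_mod, E.inp_zero, h1, h2, h3, E.inp_one, E.inp_two, E.inp_three]
  set V := Function.update (Function.update (Function.update (Function.update (fun _ => 0) 0 E.N.n)
    1 E.m) 2 E.N.p) 3 E.N.q with hV
  have e0 : V 0 = E.N.n := by simp [hV]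
  have e1 : V 1 = E.m := by simp [hV]
  have e2 : V 2 = E.N.p := by simp [hV]
  have e3 : V 3 = E.N.q := by simp [hV]
  clear_value V
  have f4 : (Expr.add (.add (.const 4) (.mul (.const 3) (.var 1))) (.mul (.const 3) (.var 0))).eval
      E.w ⟨V, loadList E.inp, tape⟩ = E.AB := by
    simp (disch := omega) only [Expr.eval, e0, e1, Nat.mod_eq_of_lt, l1]
  refine wp_seq.2 (wp_assign.2 ?_)
  rw [f4]
  have f5 : (Expr.add (.add (.var 4) (.const 6)) (.mul (.const 3) (.var 1))).eval E.w
      ⟨Function.update V 4 E.AB, loadList E.inp, tape⟩ = E.PT := by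
    simp only [Expr.eval, ne_eq, Nat.reduceEqDiff, not_false_eq_true, Function.update_of_ne,
      Function.update_self, e1]
    simp (disch := omega) only [Nat.mod_eq_of_lt, l2]
  refine wp_seq.2 (wp_assign.2 ?_)
  rw [f5]
  refine wp_seq.2 (wp_assign.2 (wp_seq.2 (wp_assign.2 (wp_seq.2 (wp_assign.2 (wp_assign.2 ?_))))))
  simp only [Expr.eval, ne_eq, Nat.reduceEqDiff, not_false_eq_true, Function.update_of_ne,
    Function.update_self, e0, OfNat.zero_ne_ofNat]
  simp only [← l3, Nat.mod_eq_of_lt (show E.MG < 2 ^ E.w by omega)]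
  simp only [← l4, Nat.mod_eq_of_lt (show E.LA < 2 ^ E.w by omega)]
  simp only [← l5, Nat.mod_eq_of_lt (show E.PR < 2 ^ E.w by omega),
    Nat.mod_eq_of_lt (show E.N.n * E.N.n < 2 ^ E.w by omega)]
  simp only [← l6, Nat.mod_eq_of_lt (show E.H0 < 2 ^ E.w by omega)]
  refine ⟨by simp [Expr.cost], by simp, hP _ ?_ (by simp)⟩
  constructor <;> simp [e0, e1, e2, e3]

/-- All pointers start at a dummy record at `H0`. Its capacity `tot + 1` is beaten by every cut, and
its `hi = 0` makes the main loop skip it. Its labels are never written, so they are whatever the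
memory holds there, hence the existential `lab`. -/
theorem setup_spec (E : Env) {tape : List ℕ}
    (hspace : E.H0 + (E.N.n + 2) * 2 ≤ E.hmax) :
    Run E.w E.O setupCmd ⟨fun _ => 0, loadList E.inp, tape⟩ (200 * (E.N.n * E.N.n + E.m + 1)) 0
      fun σ => ∃ lab, E.Main E.H0 (E.firstTodo lab) σ := by
  obtain ⟨l1, l2, l3, l4, l5, l6, l7, l8, l9⟩ := E.layout
  have ltot := E.tot_lt
  refine wp_seq.2 (Run.wp (layout_spec E (P := fun σ => ∃ V, E.Regs V ∧ V 11 = E.H0 ∧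
    σ = ⟨V, loadList E.inp, tape⟩) fun V h1 h2 => ⟨V, h1, h2, rfl⟩) ?_)
  rintro _ t₁ r₁ ht₁ hr₁ ⟨V, hR, h11, rfl⟩
  refine wp_seq.2 (Run.wp (R := 0) (T := 20 * (4 + 3 * E.m + 1)) (Run.fill (base := E.AB + 2)
    (cnt := 4 + 3 * E.m) (loadList E.inp) (by omega) ?_ ?_ ?_ ?_ (P := fun σ => σ = _) rfl) ?_)
  · intro k M
    simp only [Expr.eval, ne_eq, Nat.reduceEqDiff, not_false_eq_true, Function.update_of_ne, hR.r4]
    simp (disch := omega) only [Nat.mod_eq_of_lt]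
  · intro k M
    simp only [Expr.eval, ne_eq, Nat.reduceEqDiff, not_false_eq_true, Function.update_of_ne, hR.r1]
    simp (disch := omega) only [Nat.mod_eq_of_lt]
  · intro k hk
    simp only [Expr.eval, Function.update_self]
    rw [writeArr_of_lt (by omega)]
  · simp [Expr.cost]
  rintro _ t₂ r₂ ht₂ hr₂ rfl
  set μ₁ := writeArr (loadList E.inp) (E.AB + 2) (4 + 3 * E.m) (loadList E.inp) with hμ₁
  have hI₁ : E.HasInput μ₁ := fun i hi => ⟨writeArr_of_lt (by omega), writeArr_at hi⟩
  clear_value μ₁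
  refine wp_seq.2 (Run.wp (R := 0) (T := 17 * (E.m + 1) + 3) (Run.sum (cnt := E.m)
    (fun i => loadList E.inp (4 + 3 * i + 2)) (by decide) (by omega) ?_ ?_ ?_ ?_
    (P := fun σ => σ = _) rfl) ?_)
  · rw [E.sum_cap]; omega
  · intro s k; simp [Expr.eval, hR.r1]
  · intro s k hk
    simp only [Expr.eval, Function.update_self]
    simp (disch := omega) only [Nat.mod_eq_of_lt]
    rw [show 6 + 3 * k = 4 + 3 * k + 2 by omega, (hI₁ _ (by omega)).1]
  · simp [Expr.cost]
  rintro _ t₃ r₃ ht₃ hr₃ rfl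
  rw [E.sum_cap]
  set V₁ := Function.update (Function.update (Function.update V 30 (4 + 3 * E.m)) 14 E.N.tot) 30 E.m
    with hV₁
  have hR₁ : E.Regs V₁ := ((hR.update 30 _).update 14 _).update 30 _
  have h11' : V₁ 11 = E.H0 := by simp [hV₁, h11]
  have h14 : V₁ 14 = E.N.tot := by simp [hV₁]
  clear_value V₁
  refine wp_seq.2 (wp_store.2 (wp_seq.2 (wp_store.2 ?_)))
  simp only [Expr.eval, h11', h14, Nat.zero_mod]
  simp only [Nat.mod_eq_of_lt (show 1 < 2 ^ E.w by omega),
    Nat.mod_eq_of_lt (show E.N.tot + 1 < 2 ^ E.w by omega),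
    Nat.mod_eq_of_lt (show E.H0 + 1 < 2 ^ E.w by omega)]
  set μ₂ := Function.update (Function.update μ₁ E.H0 (E.N.tot + 1)) (E.H0 + 1) 0 with hμ₂
  have hf₂ : ∀ a < E.H0, μ₂ a = μ₁ a := fun a ha => by
    rw [hμ₂, Function.update_of_ne (by omega), Function.update_of_ne (by omega)]
  have hH₂ : μ₂ E.H0 = E.N.tot + 1 := by
    rw [hμ₂, Function.update_of_ne (by omega), Function.update_self]
  have hH₂' : μ₂ (E.H0 + 1) = 0 := by rw [hμ₂, Function.update_self]
  clear_value μ₂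
  refine wp_seq.2 (Run.wp (R := 0) (T := 15 * (E.N.n * E.N.n + 1)) (Run.fill (base := E.PR)
    (cnt := E.N.n * E.N.n) (fun _ => E.H0) (by omega) ?_ ?_ ?_ ?_ (P := fun σ => σ = _) rfl) ?_)
  · intro k M; simp [Expr.eval, hR₁.r9]
  · intro k M
    simp only [Expr.eval, ne_eq, Nat.reduceEqDiff, not_false_eq_true, Function.update_of_ne, hR₁.r0,
      OfNat.zero_ne_ofNat]
    simp (disch := omega) only [Nat.mod_eq_of_lt]
  · intro k hk; simp [Expr.eval, h11']
  · simp [Expr.cost]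
  rintro _ t₄ r₄ ht₄ hr₄ rfl
  set μ₃ := writeArr μ₂ E.PR (E.N.n * E.N.n) (fun _ => E.H0) with hμ₃
  have hPR₃ : ∀ i < E.N.n * E.N.n, μ₃ (E.PR + i) = E.H0 := fun i hi => writeArr_at hi
  have hf₃ : ∀ a, ¬ (E.PR ≤ a ∧ a < E.PR + E.N.n * E.N.n) → μ₃ a = μ₂ a := fun a ha => if_neg ha
  clear_value μ₃
  refine wp_seq.2 (wp_assign.2 (wp_seq.2 (wp_assign.2 ?_)))
  have e10 : (Expr.add (.var 11) (.add (.var 0) (.const 2))).eval E.w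
      ⟨Function.update (Function.update V₁ 30 (E.N.n * E.N.n)) 13 0, μ₃, tape⟩
      = E.H0 + (E.N.n + 2) := by
    simp only [Expr.eval, ne_eq, Nat.reduceEqDiff, not_false_eq_true, Function.update_of_ne, hR₁.r0,
      OfNat.zero_ne_ofNat, h11']
    simp (disch := omega) only [Nat.mod_eq_of_lt]
  have e13 : (Expr.const 0).eval E.w ⟨Function.update V₁ 30 (E.N.n * E.N.n), μ₃, tape⟩ = 0 := by
    simp [Expr.eval]
  simp only [e13, e10]
  set V₂ := Function.update (Function.update (Function.update V₁ 30 (E.N.n * E.N.n)) 13 0) 10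
    (E.H0 + (E.N.n + 2)) with hV₂
  have hR₂ : E.Regs V₂ := ((hR₁.update 30 _).update 13 _).update 10 _
  have h11₂ : V₂ 11 = E.H0 := by simp [hV₂, h11']
  have h14₂ : V₂ 14 = E.N.tot := by simp [hV₂, h14]
  have h13₂ : V₂ 13 = 0 := by simp [hV₂]
  have h10₂ : V₂ 10 = E.H0 + (E.N.n + 2) := by simp [hV₂]
  clear_value V₂
  refine Run.wp (pushRec_spec (τ := E.N.firstTask) (T := 30 * (E.N.n + 1))
    (P := fun σ => ∃ M : Mem, (∀ a < E.H0 + (E.N.n + 2), M a = μ₃ a) ∧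
      HoldsRec E.N.n M (E.H0 + (E.N.n + 2)) E.N.firstTask ∧
      σ = ⟨Function.update (Function.update V₂ 30 E.N.n) 10
        (E.H0 + (E.N.n + 2) + (E.N.n + 2)), M, tape⟩)
    hR₂.r0 h10₂ (by omega) h13₂ (fun _ _ => h14₂) ?_ ?_ (fun M h1 h2 => ⟨M, h1, h2, rfl⟩)) ?_
  · intro M _ x hx
    simp only [Expr.eval, Function.update_self, firstTask]
    simp (disch := omega) only [Nat.mod_eq_of_lt]
  · simp only [Expr.cost]; omega
  rintro _ t₅ r₅ ht₅ hr₅ ⟨M, hM, hrec, rfl⟩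
  have hnn : 2 * E.N.n ≤ E.N.n * E.N.n := Nat.mul_le_mul_right _ l9
  refine ⟨?_, by omega, ?_⟩
  · simp only [Expr.cost]
    omega
  have hlow : ∀ a < E.PR, M a = μ₁ a := fun a ha => by
    rw [hM a (by omega), hf₃ a (by omega), hf₂ a (by omega)]
  have hhigh : M E.H0 = E.N.tot + 1 ∧ M (E.H0 + 1) = 0 := by
    rw [hM _ (by omega), hf₃ _ (by omega), hM _ (by omega), hf₃ _ (by omega)]
    exact ⟨hH₂, hH₂'⟩
  have hptr : ∀ {u v}, u < E.N.n → v < E.N.n → E.ptr M u v = E.H0 := by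
    intro u v hu hv
    have := idx_lt hu hv
    rw [ptr, hM _ (by omega), hPR₃ _ this]
  have hval : ∀ {u v}, u < E.N.n → v < E.N.n → E.val M u v = E.N.tot + 1 := by
    intro u v hu hv
    rw [val, hptr hu hv, hhigh.1]
  have hend : ∀ lab, E.H0 + (E.N.n + 2) * (E.firstTodo lab).length = E.H0 + (E.N.n + 2) + (E.N.n + 2) := by
    intro lab
    simp only [firstTodo, List.length_cons, List.length_nil]; ring
  refine ⟨fun x => M (E.H0 + 2 + x), (hR₂.update 30 _).update 10 _, by simp [h11₂], le_rfl, by rw [hend]; simp, ?_, ?_, ?_, ?_⟩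
  · rw [hend]
    refine ⟨hI₁.frame fun a ha => hlow a (by omega), by omega, by omega, ⟨2, by ring⟩, ?_, ?_, ?_⟩
    · intro u v hu hv; simp only [hptr hu hv]; omega
    · intro u v hu hv; exact ⟨0, by simp [hptr hu hv]⟩
    · intro u v hu hv _; exact Or.inl (hval hu hv)
  · refine ⟨⟨hhigh.1, hhigh.2, fun _ _ => rfl⟩, ?_⟩
    exact ⟨hrec, trivial⟩
  · intro τ hτ hlt
    simp only [firstTodo, List.mem_cons, List.not_mem_nil, or_false] at hτ
    rcases hτ with rfl | rfl
    · simp at hlt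
    · exact ⟨E.N.firstTask_ok, fun x hx => by simp only [firstTask]; omega⟩
  · intro u hu v hv huv
    refine Or.inr ⟨E.N.firstTask, by simp [firstTodo], E.N.firstTask_ok, by simp [firstTask],
      by simp [firstTask], by simpa [firstTask] using huv, Or.inl rfl⟩

end Env

/-- Fills the pointer matrix. -/
def buildCmd : Cmd := .seq setupCmd refineCmd

/-- Builds the data structure. -/
def cutAlgCmd : Cmd := .seq buildCmd (.store (.const 1) (.var 9))

/-- Looks up a pointer. -/
def lookupCmd : Cmd :=
  .assign 0 (.add (.load (.add (.load (.const 1))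
    (.add (.mul (.load (.const 0)) (.var 0)) (.var 1)))) (.const 2))

/-! ### The finished pointer matrix and its lookup -/

namespace Env

open Net

theorem Main.done {E : Env} {H u v : ℕ} {σ : State} (h : E.Main H [] σ) (hu : u < E.N.n)
    (hv : v < E.N.n) (huv : u ≠ v) : E.N.Done (E.val σ.mem u v) u v := by
  simpa using h.cover u hu v hv huv

theorem Main.heapOK {E : Env} {H : ℕ} {σ : State} (h : E.Main H [] σ) : E.HeapOK σ.mem H := by
  simpa using h.heap

/-- A value that is good enough is at most `tot`, which excludes the dummy value `tot + 1`; so the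
entry points to a genuine cut. -/
theorem Main.cut {E : Env} {H u v : ℕ} {σ : State} (h : E.Main H [] σ) (hu : u < E.N.n)
    (hv : v < E.N.n) (huv : u ≠ v) : E.val σ.mem u v = E.cutVal (side σ.mem (E.ptr σ.mem u v)) ∧
      ¬ (side σ.mem (E.ptr σ.mem u v) u ↔ side σ.mem (E.ptr σ.mem u v) v) := by
  rcases h.heapOK.cut hu hv huv with h1 | h1
  · have := (h.done hu hv huv).1; omega
  · exact h1

/-- The number of halvings of the range of thresholds. -/
def depth (E : Env) : ℕ := Nat.size E.N.tot

/-- A bound on the time of `buildCmd`. -/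
def buildTime (E : Env) : ℕ :=
  600 * (E.N.n * E.N.n + E.m + 1) + (2 * E.tA + 2300 * (E.N.n + E.m + 1)) * (E.depth * E.N.n) +
    80 * (E.depth * (E.N.n * E.N.n))

/-- The dummy record has weight `0`. The first task has range `tot` and at most `n` labels, so the
total weight is at most `depth * n`, and at most `depth * n²` for pairs. -/
theorem build_spec {E : Env} (hS : E.Sound)
    (hspace : E.H0 + (E.N.n + 2) * (2 + 4 * (E.depth * E.N.n)) ≤ E.hmax) {tape : List ℕ} :
    Run E.w E.O buildCmd ⟨fun _ => 0, loadList E.inp, tape⟩ E.buildTime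
      (2 * (E.depth * E.N.n)) fun σ => ∃ H, E.Main H [] σ := by
  have hn := E.n_ge
  have hw : ∀ lab, ((E.firstTodo lab).map (weight E.labels)).sum ≤ E.depth * E.N.n := by
    intro lab
    simp only [firstTodo, List.map_cons, List.map_nil, List.sum_cons, List.sum_nil, weight,
      firstTask, depth, Nat.zero_sub, Nat.size_zero, zero_mul, zero_add, add_zero, Nat.sub_zero]
    gcongr
    exact (Nat.sub_le _ _).trans (numLab_le _ _)
  have hp : ∀ lab, ((E.firstTodo lab).map (weight E.pairs)).sum ≤ E.depth * (E.N.n * E.N.n) := by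
    intro lab
    simp only [firstTodo, List.map_cons, List.map_nil, List.sum_cons, List.sum_nil, weight,
      firstTask, depth, Nat.zero_sub, Nat.size_zero, zero_mul, zero_add, add_zero, Nat.sub_zero]
    gcongr
    exact numPairs_le _ _
  refine Run.seq (E.setup_spec (le_trans ?_ hspace)) ?_ (T₂ := 400 * (E.N.n * E.N.n + E.m + 1) +
    (2 * E.tA + 2300 * (E.N.n + E.m + 1)) * (E.depth * E.N.n) + 80 * (E.depth * (E.N.n * E.N.n)))
    (R₂ := 2 * (E.depth * E.N.n)) ?_ (by omega)
  · gcongr; omega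
  · rintro σ ⟨lab, h⟩
    refine (refine_spec h hS ?_).mono ?_ ?_ fun _ h => h
    · refine le_trans ?_ hspace
      rw [add_assoc, ← mul_add]
      gcongr
      · simp [firstTodo]
      · exact hw lab
    · simp only [timeBound]
      have h1 := Nat.mul_le_mul_left (2 * E.tA + 2300 * (E.N.n + E.m + 1)) (hw lab)
      have h2 := hp lab
      have h3 : 2 * E.N.n ≤ E.N.n * E.N.n := Nat.mul_le_mul_right _ hn
      have h4 : (E.firstTodo lab).length = 2 := rfl
      rw [h4]
      omega
    · have := hw lab; omega
  · simp only [buildTime]; omega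

/-- The lookup program finds `n` in cell `0` and the address of the matrix in cell `1`, which
replaces the number of edges, no longer needed. The address returned is that of the record plus `2`,
where the indicator vector begins. -/
theorem cutAlg_spec {E : Env} (hS : E.Sound)
    (hspace : E.H0 + (E.N.n + 2) * (2 + 4 * (E.depth * E.N.n)) ≤ E.hmax) {tape : List ℕ} :
    Run E.w E.O cutAlgCmd ⟨fun _ => 0, loadList E.inp, tape⟩ (E.buildTime + 3)
      (2 * (E.depth * E.N.n)) fun σ => ∃ K, E.H0 + (E.N.n + 2) * K ≤ E.hmax ∧
        ∀ u < E.N.n, ∀ v < E.N.n, u ≠ v → ∃ k < K, (∃ t ≤ 20, QueryRunsTo E.w lookupCmd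
          (fun i => if i < E.H0 + (E.N.n + 2) * K then σ.mem i else 0) u v
          (E.H0 + (E.N.n + 2) * k + 2) t) ∧
        ¬ (side σ.mem (E.H0 + (E.N.n + 2) * k) u ↔ side σ.mem (E.H0 + (E.N.n + 2) * k) v) ∧
        E.cutVal (side σ.mem (E.H0 + (E.N.n + 2) * k)) * E.N.q ^ 2 ≤
          (E.N.p + E.N.q) ^ 2 * E.N.lam u v := by
  obtain ⟨l1, l2, l3, l4, l5, l6, l7, l8, l9⟩ := E.layout
  refine Run.seq (build_spec hS hspace) ?_ (T₂ := 3) (R₂ := 0) le_rfl le_rfl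
  rintro ⟨V, μ, tape'⟩ ⟨H, h⟩
  have hR := h.regs
  have hheap := h.heapOK
  simp only at hheap hR
  refine wp_store.2 ⟨by simp [Expr.cost], le_rfl, ?_⟩
  simp only [Expr.eval, hR.r9, Nat.mod_eq_of_lt (show 1 < 2 ^ E.w by omega)]
  obtain ⟨K, hK⟩ := hheap.mul
  have hle := hheap.le
  have hge := hheap.ge
  refine ⟨K, by omega, fun u hu v hv huv => ?_⟩
  obtain ⟨k, hk⟩ := hheap.ptr_mul hu hv
  have hlt := hheap.ptr_lt hu hv
  have hkK : k < K := by
    by_contra hc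
    have := Nat.mul_le_mul_left (E.N.n + 2) (not_lt.1 hc)
    omega
  obtain ⟨hcut, hsep⟩ := h.cut hu hv huv
  have hdone := (h.done hu hv huv).2
  simp only at hcut hsep hdone
  have hside : side (Function.update μ 1 E.PR) (E.H0 + (E.N.n + 2) * k)
      = side μ (E.ptr μ u v) := by
    funext x
    simp only [side, ← hk]
    rw [Function.update_of_ne (by omega)]
  refine ⟨k, hkK, ⟨13, by omega, ?_⟩, by rw [hside]; exact hsep, by rw [hside, ← hcut]; exact hdone⟩
  have hidx := idx_lt hu hv
  have hn0 : μ 0 = E.N.n := by rw [(hheap.input 0 (by omega)).1, E.inp_zero]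
  have hun : E.N.n * u < 2 ^ E.w := by rw [mul_comm]; omega
  have hex : (Expr.add (.load (.add (.load (.const 1))
      (.add (.mul (.load (.const 0)) (.var 0)) (.var 1)))) (.const 2)).eval E.w
      ⟨fun x => if x = 0 then u else if x = 1 then v else 0,
        fun i => if i < E.H0 + (E.N.n + 2) * K then Function.update μ 1 E.PR i else 0, []⟩
      = E.H0 + (E.N.n + 2) * k + 2 := by
    simp only [Expr.eval, Nat.zero_mod, Nat.mod_eq_of_lt (show 1 < 2 ^ E.w by omega),
      Nat.mod_eq_of_lt (show 2 < 2 ^ E.w by omega), ← hK, if_pos (show 1 < H by omega),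
      if_pos (show 0 < H by omega), Function.update_self]
    simp only [ne_eq, zero_ne_one, not_false_eq_true, Function.update_of_ne, hn0, if_true,
      one_ne_zero, if_false]
    rw [Nat.mod_eq_of_lt hun, mul_comm E.N.n u,
      Nat.mod_eq_of_lt (show u * E.N.n + v < 2 ^ E.w by omega),
      Nat.mod_eq_of_lt (show E.PR + (u * E.N.n + v) < 2 ^ E.w by omega), if_pos (by omega),
      Function.update_of_ne (by omega)]
    change (E.ptr μ u v + 2) % _ = _
    rw [← hk, Nat.mod_eq_of_lt (by omega)]
  refine ⟨_, Exec.assign _ _ _, ?_⟩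
  simp only [Function.update_self]
  exact hex

end Env

/-! ### A maximum spanning tree of the values found -/

/-- A maximal key and its position. -/
def findMaxCmd : Cmd :=
  .seq (.assign 17 (.const 0)) <| .seq (.assign 18 (.const 0)) <|
  .for 30 (.var 0) (.ite (.lt (.var 17) (readAt 6 (.var 30)))
    (.seq (.assign 17 (readAt 6 (.var 30))) (.assign 18 (.var 30))) .skip)

/-- The value of the best cut found for `u` and `v`. -/
def valExpr (u v : Expr) : Expr := .load (readAt 9 (.add (.mul u (.var 0)) v))

/-- Updates the keys after a node has joined the tree. -/
def relaxCmd : Cmd :=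
  .for 30 (.var 0) (.ite (.mul (.lt (readAt 6 (.var 30)) (valExpr (.var 18) (.var 30)))
      (.ne (readAt 6 (.var 30)) (.const 0)))
    (.seq (.store (.add (.var 6) (.var 30)) (valExpr (.var 18) (.var 30)))
      (.store (.add (.var 5) (.var 30)) (.var 18))) .skip)

/-- Adds a node to the tree and outputs its edge. -/
def growCmd : Cmd :=
  .seq findMaxCmd <|
  .seq (.store (.mul (.const 3) (.var 31)) (.var 18)) <|
  .seq (.store (.add (.mul (.const 3) (.var 31)) (.const 1)) (readAt 5 (.var 18))) <|
  .seq (.store (.add (.mul (.const 3) (.var 31)) (.const 2)) (.var 17)) <|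
  .seq (.store (.add (.var 6) (.var 18)) (.const 0)) relaxCmd

/-- Prim's algorithm. -/
def primCmd : Cmd :=
  .seq (.fill 30 (.var 6) (.var 0) (valExpr (.const 0) (.var 30))) <|
  .seq (.store (.var 6) (.const 0)) <|
  .seq (.fill 30 (.var 5) (.var 0) (.const 0)) <|
  .for 31 (.sub (.var 0) (.const 1)) growCmd

/-! ### Prim's algorithm, abstractly -/

namespace Env

/-- The state of Prim's algorithm: the nodes `ord 0, …, ord i` are in the tree, `ord j` has been
attached to `ord (par j)`; `key x` is `0` for nodes in the tree, otherwise the largest value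
between `x` and the tree, attained at the node `adj x`. -/
structure PrimInv (n : ℕ) (vl : ℕ → ℕ → ℕ) (ord par : ℕ → ℕ) (i : ℕ) (key adj : ℕ → ℕ) : Prop where
  ord_lt : ∀ j ≤ i, ord j < n
  ord_inj : ∀ j ≤ i, ∀ j' ≤ i, ord j = ord j' → j = j'
  par_lt : ∀ j ≤ i, 0 < j → par j < j
  key_zero : ∀ x < n, key x = 0 ↔ ∃ j ≤ i, ord j = x
  adj_eq : ∀ x < n, key x ≠ 0 → ∃ j ≤ i, adj x = ord j ∧ key x = vl (ord j) x
  key_ge : ∀ x < n, key x ≠ 0 → ∀ j ≤ i, vl (ord j) x ≤ key x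
  key_max : ∀ j ≤ i, 0 < j → ∀ a < j, ∀ x < n, (∀ b < j, ord b ≠ x) →
    vl (ord a) x ≤ vl (ord (par j)) (ord j)

theorem PrimInv.init {n : ℕ} {vl : ℕ → ℕ → ℕ} {key adj : ℕ → ℕ} (hn : 0 < n)
    (hpos : ∀ u < n, ∀ v < n, u ≠ v → 0 < vl u v) (h0 : key 0 = 0)
    (hkey : ∀ x < n, x ≠ 0 → key x = vl 0 x) (hadj : ∀ x < n, adj x = 0) :
    PrimInv n vl (fun _ => 0) (fun _ => 0) 0 key adj where
  ord_lt _ _ := hn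
  ord_inj j hj j' hj' _ := by omega
  par_lt j hj h := by omega
  key_zero x hx := by
    constructor
    · intro h
      by_contra hc
      have hx0 : x ≠ 0 := fun h' => hc ⟨0, le_rfl, h'.symm⟩
      have := hpos 0 hn x hx (Ne.symm hx0)
      rw [hkey x hx hx0] at h
      omega
    · rintro ⟨j, -, rfl⟩; exact h0
  adj_eq x hx h := ⟨0, le_rfl, hadj x hx, hkey x hx fun h' => h (by rw [h', h0])⟩
  key_ge x hx h j _ := (hkey x hx fun h' => h (by rw [h', h0])).ge
  key_max j hj h := by omega

theorem PrimInv.exists_key {n : ℕ} {vl : ℕ → ℕ → ℕ} {ord par key adj : ℕ → ℕ} {i : ℕ}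
    (h : PrimInv n vl ord par i key adj) (hi : i + 1 < n) : ∃ x < n, key x ≠ 0 := by
  by_contra! hc
  have h1 : Finset.range n ⊆ (Finset.range (i + 1)).image ord := by
    intro x hx
    have hx := Finset.mem_range.1 hx
    obtain ⟨j, hj, rfl⟩ := (h.key_zero x hx).1 (hc x hx)
    exact Finset.mem_image_of_mem _ (Finset.mem_range.2 (by omega))
  have h2 := (Finset.card_le_card h1).trans Finset.card_image_le
  simp only [Finset.card_range] at h2
  omega

/-- The node of maximal key joins the tree, and `key_max` for the new index is this maximality. The
key `0` can mark membership because all values are positive, so a node outside the tree never gets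
it. -/
theorem PrimInv.step {n : ℕ} {vl : ℕ → ℕ → ℕ} {ord par key adj key' adj' : ℕ → ℕ} {i w : ℕ}
    (h : PrimInv n vl ord par i key adj) (hpos : ∀ u < n, ∀ v < n, u ≠ v → 0 < vl u v)
    (hw : w < n) (hw0 : key w ≠ 0) (hmax : ∀ x < n, key x ≤ key w)
    (hkw : key' w = 0)
    (hupd : ∀ x < n, x ≠ w → key x ≠ 0 → key x < vl w x → key' x = vl w x ∧ adj' x = w)
    (hsame : ∀ x < n, x ≠ w → ¬ (key x ≠ 0 ∧ key x < vl w x) → key' x = key x ∧ adj' x = adj x) :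
    ∃ ord' par', PrimInv n vl ord' par' (i + 1) key' adj' ∧ (∀ j ≤ i, ord' j = ord j ∧
      par' j = par j) ∧ ord' (i + 1) = w ∧ ord' (par' (i + 1)) = adj w ∧ vl (adj w) w = key w := by
  obtain ⟨j₀, hj₀, hadj, hkey⟩ := h.adj_eq w hw hw0
  have ho : ∀ j ≤ i, Function.update ord (i + 1) w j = ord j := fun j hj =>
    Function.update_of_ne (by omega) _ _
  have hp : ∀ j ≤ i, Function.update par (i + 1) j₀ j = par j := fun j hj =>
    Function.update_of_ne (by omega) _ _
  have ho' : Function.update ord (i + 1) w (i + 1) = w := Function.update_self ..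
  have hp' : Function.update par (i + 1) j₀ (i + 1) = j₀ := Function.update_self ..
  have hnw : ∀ j ≤ i, ord j ≠ w := fun j hj hjw => hw0 ((h.key_zero w hw).2 ⟨j, hj, hjw⟩)
  have hkz : ∀ x < n, x ≠ w → (key' x = 0 ↔ key x = 0) := by
    intro x hx hxw
    by_cases hc : key x ≠ 0 ∧ key x < vl w x
    · rw [(hupd x hx hxw hc.1 hc.2).1]
      constructor
      · intro h'; omega
      · exact fun h' => absurd h' hc.1
    · rw [(hsame x hx hxw hc).1]
  generalize Function.update ord (i + 1) w = ord' at *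
  generalize Function.update par (i + 1) j₀ = par' at *
  refine ⟨ord', par', ⟨?_, ?_, ?_, ?_, ?_, ?_, ?_⟩, fun j hj => ⟨ho j hj, hp j hj⟩, ho', ?_, ?_⟩
  · intro j hj
    rcases Nat.le_succ_iff.1 hj with hj | rfl
    · rw [ho j hj]; exact h.ord_lt j hj
    · rw [ho']; exact hw
  · intro j hj j' hj' hjj
    rcases Nat.le_succ_iff.1 hj with hj | rfl <;> rcases Nat.le_succ_iff.1 hj' with hj' | rfl
    · rw [ho j hj, ho j' hj'] at hjj; exact h.ord_inj j hj j' hj' hjj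
    · rw [ho j hj, ho'] at hjj; exact absurd hjj (hnw j hj)
    · rw [ho j' hj', ho'] at hjj; exact absurd hjj.symm (hnw j' hj')
    · rfl
  · intro j hj hj0
    rcases Nat.le_succ_iff.1 hj with hj | rfl
    · rw [hp j hj]; exact h.par_lt j hj hj0
    · rw [hp']; omega
  · intro x hx
    by_cases hxw : x = w
    · subst hxw
      simp only [hkw, true_iff]
      exact ⟨i + 1, le_rfl, ho'⟩
    · rw [hkz x hx hxw, h.key_zero x hx]
      constructor
      · rintro ⟨j, hj, rfl⟩
        exact ⟨j, by omega, ho j hj⟩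
      · rintro ⟨j, hj, hjx⟩
        rcases Nat.le_succ_iff.1 hj with hj | rfl
        · exact ⟨j, hj, by rw [← ho j hj, hjx]⟩
        · exact absurd (by rw [← hjx, ho']) hxw
  · intro x hx hx0
    have hxw : x ≠ w := fun h' => hx0 (by rw [h', hkw])
    by_cases hc : key x ≠ 0 ∧ key x < vl w x
    · obtain ⟨h1, h2⟩ := hupd x hx hxw hc.1 hc.2
      exact ⟨i + 1, le_rfl, by rw [ho', h2], by rw [ho', h1]⟩
    · obtain ⟨h1, h2⟩ := hsame x hx hxw hc
      obtain ⟨j, hj, h3, h4⟩ := h.adj_eq x hx (by rwa [← h1])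
      exact ⟨j, by omega, by rw [ho j hj, h2, h3], by rw [ho j hj, h1, h4]⟩
  · intro x hx hx0 j hj
    have hxw : x ≠ w := fun h' => hx0 (by rw [h', hkw])
    have hk0 : key x ≠ 0 := fun h' => hx0 ((hkz x hx hxw).2 h')
    rcases Nat.le_succ_iff.1 hj with hj | rfl
    · have h1 := h.key_ge x hx hk0 j hj
      rw [ho j hj]
      by_cases hc : key x ≠ 0 ∧ key x < vl w x
      · rw [(hupd x hx hxw hc.1 hc.2).1]; omega
      · rw [(hsame x hx hxw hc).1]; exact h1
    · rw [ho']
      by_cases hc : key x ≠ 0 ∧ key x < vl w x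
      · rw [(hupd x hx hxw hc.1 hc.2).1]
      · rw [(hsame x hx hxw hc).1]
        by_contra h'
        exact hc ⟨hk0, by omega⟩
  · intro j hj hj0 a ha x hx hb
    rcases Nat.le_succ_iff.1 hj with hj | rfl
    · have := h.par_lt j hj hj0
      rw [ho a (by omega), hp j hj, ho _ (by omega), ho j hj]
      exact h.key_max j hj hj0 a ha x hx fun b hb' => by rw [← ho b (by omega)]; exact hb b hb'
    · have hk0 : key x ≠ 0 := fun h' => by
        obtain ⟨b, hb', hbx⟩ := (h.key_zero x hx).1 h'
        exact hb b (by omega) (by rw [ho b hb', hbx])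
      rw [ho a (by omega), hp', ho j₀ hj₀, ho', ← hkey]
      exact (h.key_ge x hx hk0 a (by omega)).trans (hmax x hx)
  · rw [hp', ho j₀ hj₀, hadj]
  · rw [hadj, hkey]

/-! ### Prim's algorithm on the machine -/

section Ram

variable {E : Env} {V : ℕ → ℕ} {μ : Mem} {tape : List ℕ}

theorem findMax_spec (hR : E.Regs V) :
    Run E.w E.O findMaxCmd ⟨V, μ, tape⟩ (40 * (E.N.n + 1)) 0 fun σ => ∃ s b,
      σ = ⟨Function.update (Function.update (Function.update V 17 b) 18 s) 30 E.N.n, μ, tape⟩ ∧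
      (∀ x < E.N.n, μ (E.MG + x) ≤ b) ∧ (b = 0 ∨ (s < E.N.n ∧ b = μ (E.MG + s))) := by
  obtain ⟨l1, l2, l3, l4, l5, l6, l7, l8, l9⟩ := E.layout
  refine wp_seq.2 (wp_assign.2 (wp_seq.2 (wp_assign.2 ?_)))
  simp only [Expr.eval, Nat.zero_mod]
  refine Run.wp (R := 0) (T := 30 * (E.N.n + 1)) (Run.for (cnt := E.N.n)
    (P := fun σ => ∃ s b,
      σ = ⟨Function.update (Function.update (Function.update V 17 b) 18 s) 30 E.N.n, μ, tape⟩ ∧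
      (∀ x < E.N.n, μ (E.MG + x) ≤ b) ∧ (b = 0 ∨ (s < E.N.n ∧ b = μ (E.MG + s))))
    (fun k σ => ∃ s b,
      σ = ⟨Function.update (Function.update (Function.update V 17 b) 18 s) 30 k, μ, tape⟩ ∧
      (∀ x < k, μ (E.MG + x) ≤ b) ∧ (b = 0 ∨ (s < E.N.n ∧ b = μ (E.MG + s)))) (fun _ => 20)
    (by omega) ?_ ?_ ?_ ?_ fun _ h => h) ?_
  · exact ⟨0, 0, rfl, by simp, Or.inl rfl⟩
  · rintro k hk _ ⟨s, b, rfl, -⟩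
    exact ⟨by simp [Expr.eval, hR.r0], by simp⟩
  · rintro k hk _ ⟨s, b, rfl, h1, h2⟩
    have e1 : (readAt 6 (.var 30)).eval E.w ⟨Function.update (Function.update (Function.update V 17 b)
        18 s) 30 k, μ, tape⟩ = μ (E.MG + k) := by
      simp only [readAt, Expr.eval, ne_eq, Nat.reduceEqDiff, not_false_eq_true,
        Function.update_of_ne, Function.update_self, hR.r6]
      simp (disch := omega) only [Nat.mod_eq_of_lt]
    have e2 : (Expr.var 17).eval E.w ⟨Function.update (Function.update (Function.update V 17 b)
        18 s) 30 k, μ, tape⟩ = b := by simp [Expr.eval]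
    have e3 : (Expr.lt (.var 17) (readAt 6 (.var 30))).eval E.w ⟨Function.update (Function.update
        (Function.update V 17 b) 18 s) 30 k, μ, tape⟩ = if b < μ (E.MG + k) then 1 else 0 := by
      rw [← e1, ← e2]; rfl
    refine wp_ite.2 ⟨fun h' => ?_, fun h' => ?_⟩
    · rw [e3] at h'
      have h3 : b < μ (E.MG + k) := by
        by_contra hc; rw [if_neg hc] at h'; exact h' rfl
      refine wp_seq.2 (wp_assign.2 (wp_assign.2 ⟨by simp [Expr.cost, readAt], le_rfl, ?_, k,
        μ (E.MG + k), ?_, ?_, Or.inr ⟨hk, rfl⟩⟩))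
      · simp
      · rw [e1]
        congr 1
        funext y
        simp only [Expr.eval, Function.update_apply]
        split_ifs <;> simp_all
      · intro x hx
        rcases (Nat.lt_succ_iff.1 hx).eq_or_lt with rfl | hx
        · exact le_rfl
        · exact (h1 x hx).trans h3.le
    · rw [e3] at h'
      have h3 : ¬ b < μ (E.MG + k) := by
        intro hc; rw [if_pos hc] at h'; exact one_ne_zero h'
      refine wp_skip.2 ⟨by simp [Expr.cost, readAt], le_rfl, by simp, s, b, by simp, ?_, h2⟩
      intro x hx
      rcases (Nat.lt_succ_iff.1 hx).eq_or_lt with rfl | hx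
      · omega
      · exact h1 x hx
  · simp only [Finset.sum_const, Finset.card_range, smul_eq_mul, Expr.cost]; omega
  · intro σ t r ht hr h
    refine ⟨?_, by omega, h⟩
    simp only [Expr.cost]; omega

theorem eval_valExpr {a b : Expr} {u v H : ℕ} {μ₀ : Mem} (h0 : V 0 = E.N.n) (h9 : V 9 = E.PR)
    (hheap : E.HeapOK μ₀ H) (hμ : ∀ x, E.PR ≤ x → μ x = μ₀ x) (hu : u < E.N.n) (hv : v < E.N.n)
    (ha : a.eval E.w ⟨V, μ, tape⟩ = u) (hb : b.eval E.w ⟨V, μ, tape⟩ = v) :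
    (valExpr a b).eval E.w ⟨V, μ, tape⟩ = E.val μ₀ u v := by
  obtain ⟨l1, l2, l3, l4, l5, l6, l7, l8, l9⟩ := E.layout
  have hidx := idx_lt hu hv
  have hge := hheap.ptr_ge hu hv
  simp only [valExpr, readAt, Expr.eval, ha, hb, h0, h9]
  rw [Nat.mod_eq_of_lt (show u * E.N.n < 2 ^ E.w by omega),
    Nat.mod_eq_of_lt (show u * E.N.n + v < 2 ^ E.w by omega),
    Nat.mod_eq_of_lt (show E.PR + (u * E.N.n + v) < 2 ^ E.w by omega),
    hμ (E.PR + (u * E.N.n + v)) (by omega)]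
  change μ (E.ptr μ₀ u v) = _
  rw [hμ _ (by omega)]
  rfl

theorem relax_spec {H s : ℕ} {μ₀ : Mem} (hR : E.Regs V) (hheap : E.HeapOK μ₀ H)
    (hμ : ∀ x, E.PR ≤ x → μ x = μ₀ x) (h18 : V 18 = s) (hs : s < E.N.n) :
    Run E.w E.O relaxCmd ⟨V, μ, tape⟩ (80 * (E.N.n + 1)) 0 fun σ => ∃ M,
      σ = ⟨Function.update V 30 E.N.n, M, tape⟩ ∧
      (∀ a, ¬ (E.MG ≤ a ∧ a < E.MG + E.N.n) → ¬ (E.PT ≤ a ∧ a < E.PT + E.N.n) → M a = μ a) ∧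
      ∀ x < E.N.n, (μ (E.MG + x) ≠ 0 ∧ μ (E.MG + x) < E.val μ₀ s x →
        M (E.MG + x) = E.val μ₀ s x ∧ M (E.PT + x) = s) ∧
        (¬ (μ (E.MG + x) ≠ 0 ∧ μ (E.MG + x) < E.val μ₀ s x) →
          M (E.MG + x) = μ (E.MG + x) ∧ M (E.PT + x) = μ (E.PT + x)) := by
  obtain ⟨l1, l2, l3, l4, l5, l6, l7, l8, l9⟩ := E.layout
  refine Run.for (cnt := E.N.n) (fun k σ => ∃ M, σ = ⟨Function.update V 30 k, M, tape⟩ ∧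
      (∀ a, ¬ (E.MG ≤ a ∧ a < E.MG + k) → ¬ (E.PT ≤ a ∧ a < E.PT + k) → M a = μ a) ∧
      ∀ x < k, (μ (E.MG + x) ≠ 0 ∧ μ (E.MG + x) < E.val μ₀ s x →
        M (E.MG + x) = E.val μ₀ s x ∧ M (E.PT + x) = s) ∧
        (¬ (μ (E.MG + x) ≠ 0 ∧ μ (E.MG + x) < E.val μ₀ s x) →
          M (E.MG + x) = μ (E.MG + x) ∧ M (E.PT + x) = μ (E.PT + x))) (fun _ => 60)
    (by omega) ?_ ?_ ?_ ?_ fun _ h => h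
  · exact ⟨μ, rfl, fun _ _ _ => rfl, by simp⟩
  · rintro k hk _ ⟨M, rfl, -⟩
    exact ⟨by simp [Expr.eval, hR.r0], by simp⟩
  · rintro k hk _ ⟨M, rfl, hM, hx⟩
    have hMk : M (E.MG + k) = μ (E.MG + k) := hM _ (by omega) (by omega)
    have hMk' : M (E.PT + k) = μ (E.PT + k) := hM _ (by omega) (by omega)
    have e1 : (readAt 6 (.var 30)).eval E.w ⟨Function.update V 30 k, M, tape⟩ = μ (E.MG + k) := by
      simp only [readAt, Expr.eval, ne_eq, Nat.reduceEqDiff, not_false_eq_true,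
        Function.update_of_ne, Function.update_self, hR.r6]
      simp (disch := omega) only [Nat.mod_eq_of_lt, hMk]
    have e2 : (valExpr (.var 18) (.var 30)).eval E.w ⟨Function.update V 30 k, M, tape⟩
        = E.val μ₀ s k := eval_valExpr (by simp [hR.r0]) (by simp [hR.r9]) hheap
      (fun x hx => (hM x (by omega) (by omega)).trans (hμ x hx)) hs hk (by simp [Expr.eval, h18])
      (by simp [Expr.eval])
    have e3 : (Expr.mul (.lt (readAt 6 (.var 30)) (valExpr (.var 18) (.var 30)))
        (.ne (readAt 6 (.var 30)) (.const 0))).eval E.w ⟨Function.update V 30 k, M, tape⟩ =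
        if μ (E.MG + k) ≠ 0 ∧ μ (E.MG + k) < E.val μ₀ s k then 1 else 0 := by
      have h3 : ∀ a b : Expr, (Expr.mul a b).eval E.w ⟨Function.update V 30 k, M, tape⟩ =
        a.eval E.w ⟨Function.update V 30 k, M, tape⟩ *
        b.eval E.w ⟨Function.update V 30 k, M, tape⟩ % 2 ^ E.w := fun _ _ => rfl
      have h4 : ∀ a b : Expr, (Expr.lt a b).eval E.w ⟨Function.update V 30 k, M, tape⟩ =
        if a.eval E.w ⟨Function.update V 30 k, M, tape⟩ <
          b.eval E.w ⟨Function.update V 30 k, M, tape⟩ then 1 else 0 := fun _ _ => rfl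
      have h5 : (Expr.const 0).eval E.w ⟨Function.update V 30 k, M, tape⟩ = 0 := by simp [Expr.eval]
      rw [h3, h4, Expr.eval_ne, e1, e2, h5]
      have h6 : 1 % 2 ^ E.w = 1 := Nat.mod_eq_of_lt (by omega)
      by_cases ha : μ (E.MG + k) = 0 <;> by_cases hb : μ (E.MG + k) < E.val μ₀ s k <;>
        simp [ha, hb, h6]
    refine wp_ite.2 ⟨fun h' => ?_, fun h' => ?_⟩
    · rw [e3] at h'
      have hc : μ (E.MG + k) ≠ 0 ∧ μ (E.MG + k) < E.val μ₀ s k := by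
        by_contra hc; rw [if_neg hc] at h'; exact h' rfl
      have e4 : (Expr.add (.var 6) (.var 30)).eval E.w ⟨Function.update V 30 k, M, tape⟩
          = E.MG + k := by
        simp only [Expr.eval, ne_eq, Nat.reduceEqDiff, not_false_eq_true,
          Function.update_of_ne, Function.update_self, hR.r6]
        simp (disch := omega) only [Nat.mod_eq_of_lt]
      have e5 : ∀ M', (Expr.add (.var 5) (.var 30)).eval E.w ⟨Function.update V 30 k, M', tape⟩
          = E.PT + k := by
        intro M'
        simp only [Expr.eval, ne_eq, Nat.reduceEqDiff, not_false_eq_true,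
          Function.update_of_ne, Function.update_self, hR.r5]
        simp (disch := omega) only [Nat.mod_eq_of_lt]
      have e6 : ∀ M', (Expr.var 18).eval E.w ⟨Function.update V 30 k, M', tape⟩ = s := by
        intro M'; simp [Expr.eval, h18]
      refine wp_seq.2 (wp_store.2 (wp_store.2 ⟨by simp [Expr.cost, readAt, valExpr, Expr.ne], le_rfl,
        by simp, Function.update (Function.update M (E.MG + k) (E.val μ₀ s k)) (E.PT + k) s, ?_, ?_,
        ?_⟩))
      · simp only [e4, e2, e5, e6, Function.update_idem]
      · intro a h1 h2
        rw [Function.update_of_ne (by omega), Function.update_of_ne (by omega)]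
        exact hM a (by omega) (by omega)
      · intro x hxk
        rcases (Nat.lt_succ_iff.1 hxk).eq_or_lt with rfl | hxk
        · refine ⟨fun _ => ⟨?_, ?_⟩, fun h => absurd hc h⟩
          · rw [Function.update_of_ne (by omega), Function.update_self]
          · rw [Function.update_self]
        · rw [Function.update_of_ne (by omega), Function.update_of_ne (by omega),
            Function.update_of_ne (by omega), Function.update_of_ne (by omega)]
          exact hx x hxk
    · rw [e3] at h'
      have hc : ¬ (μ (E.MG + k) ≠ 0 ∧ μ (E.MG + k) < E.val μ₀ s k) := by
        intro hc; rw [if_pos hc] at h'; exact one_ne_zero h'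
      refine wp_skip.2 ⟨by simp [Expr.cost, readAt, valExpr, Expr.ne], le_rfl, by simp, M, by simp, ?_,
        ?_⟩
      · intro a h1 h2
        exact hM a (by omega) (by omega)
      · intro x hxk
        rcases (Nat.lt_succ_iff.1 hxk).eq_or_lt with rfl | hxk
        · exact ⟨fun h => absurd h hc, fun _ => ⟨hMk, hMk'⟩⟩
        · exact hx x hxk
  · simp only [Finset.sum_const, Finset.card_range, smul_eq_mul, Expr.cost]; omega

end Ram

end Env

namespace Env

/-- The memory during Prim's algorithm, after `i` rounds. -/
structure Growing (E : Env) (μ₀ : Mem) (ord par : ℕ → ℕ) (i : ℕ) (M : Mem) : Prop where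
  frame : ∀ x, E.PR ≤ x → M x = μ₀ x
  inv : PrimInv E.N.n (E.val μ₀) ord par i (fun x => M (E.MG + x)) (fun x => M (E.PT + x))
  out : ∀ j < i, M (3 * j) = ord (j + 1) ∧ M (3 * j + 1) = ord (par (j + 1)) ∧
    M (3 * j + 2) = E.val μ₀ (ord (par (j + 1))) (ord (j + 1))

/-- The edges overwrite the input, which is no longer read: the number of nodes is in a register,
and the values lie at `PR` and beyond. -/
theorem grow_spec {E : Env} {V : ℕ → ℕ} {μ μ₀ : Mem} {tape : List ℕ} {ord par : ℕ → ℕ} {i H : ℕ}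
    (hR : E.Regs V) (hheap : E.HeapOK μ₀ H)
    (hpos : ∀ u < E.N.n, ∀ v < E.N.n, u ≠ v → 0 < E.val μ₀ u v)
    (h : E.Growing μ₀ ord par i μ) (h31 : V 31 = i) (hi : i + 1 < E.N.n) :
    Run E.w E.O growCmd ⟨V, μ, tape⟩ (160 * (E.N.n + 1)) 0 fun σ =>
      E.Regs σ.vars ∧ σ.vars 31 = i ∧ ∃ ord' par', E.Growing μ₀ ord' par' (i + 1) σ.mem := by
  obtain ⟨l1, l2, l3, l4, l5, l6, l7, l8, l9⟩ := E.layout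
  refine wp_seq.2 ((findMax_spec hR).wp ?_)
  rintro _ t₁ r₁ ht₁ hr₁ ⟨s, b, rfl, hb, hbs⟩
  -- Some node is still outside, so the maximum is nonzero and the default outcome `b = 0` of the
  -- search is excluded.
  obtain ⟨x, hx, hx0⟩ := h.inv.exists_key hi
  obtain ⟨hs, hbs⟩ : s < E.N.n ∧ b = μ (E.MG + s) := by
    have := hb x hx
    rcases hbs with h' | h'
    · omega
    · exact h'
  have hb0 : b ≠ 0 := by have := hb x hx; omega
  set V₁ := Function.update (Function.update (Function.update V 17 b) 18 s) 30 E.N.n with hV₁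
  have hR₁ : E.Regs V₁ := ((hR.update 17 _).update 18 _).update 30 _
  have e17 : V₁ 17 = b := by simp [hV₁]
  have e18 : V₁ 18 = s := by simp [hV₁]
  have e31 : V₁ 31 = i := by simp [hV₁, h31]
  clear_value V₁
  obtain ⟨j₀, hj₀, hadj₀, -⟩ := h.inv.adj_eq s hs (by rw [← hbs]; exact hb0)
  refine wp_seq.2 (wp_store.2 (wp_seq.2 (wp_store.2 (wp_seq.2 (wp_store.2 (wp_seq.2
    (wp_store.2 ?_)))))))
  have a0 : ∀ M, (Expr.mul (.const 3) (.var 31)).eval E.w ⟨V₁, M, tape⟩ = 3 * i := by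
    intro M
    simp (disch := omega) only [Expr.eval, e31, Nat.mod_eq_of_lt]
  have a1 : ∀ M, (Expr.add (.mul (.const 3) (.var 31)) (.const 1)).eval E.w ⟨V₁, M, tape⟩
      = 3 * i + 1 := by
    intro M
    simp (disch := omega) only [Expr.eval, e31, Nat.mod_eq_of_lt]
  have a2 : ∀ M, (Expr.add (.mul (.const 3) (.var 31)) (.const 2)).eval E.w ⟨V₁, M, tape⟩
      = 3 * i + 2 := by
    intro M
    simp (disch := omega) only [Expr.eval, e31, Nat.mod_eq_of_lt]
  have a3 : ∀ M, (Expr.add (.var 6) (.var 18)).eval E.w ⟨V₁, M, tape⟩ = E.MG + s := by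
    intro M
    simp (disch := omega) only [Expr.eval, hR₁.r6, e18, Nat.mod_eq_of_lt]
  have b0 : ∀ M, (Expr.var 18).eval E.w ⟨V₁, M, tape⟩ = s := fun M => e18
  have b1 : ∀ M, (readAt 5 (.var 18)).eval E.w ⟨V₁, M, tape⟩ = M (E.PT + s) := by
    intro M
    simp (disch := omega) only [readAt, Expr.eval, hR₁.r5, e18, Nat.mod_eq_of_lt]
  have b2 : ∀ M, (Expr.var 17).eval E.w ⟨V₁, M, tape⟩ = b := fun M => e17
  have b3 : ∀ M, (Expr.const 0).eval E.w ⟨V₁, M, tape⟩ = 0 := fun M => by simp [Expr.eval]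
  simp only [a0, a1, a2, a3, b0, b1, b2, b3]
  rw [Function.update_of_ne (show E.PT + s ≠ 3 * i by omega)]
  set M₁ := Function.update (Function.update (Function.update (Function.update μ (3 * i) s)
    (3 * i + 1) (μ (E.PT + s))) (3 * i + 2) b) (E.MG + s) 0 with hM₁
  have c0 : M₁ (3 * i) = s := by
    rw [hM₁, Function.update_of_ne (by omega), Function.update_of_ne (by omega),
      Function.update_of_ne (by omega), Function.update_self]
  have c1 : M₁ (3 * i + 1) = μ (E.PT + s) := by
    rw [hM₁, Function.update_of_ne (by omega), Function.update_of_ne (by omega),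
      Function.update_self]
  have c2 : M₁ (3 * i + 2) = b := by
    rw [hM₁, Function.update_of_ne (by omega), Function.update_self]
  have c3 : M₁ (E.MG + s) = 0 := by rw [hM₁, Function.update_self]
  have c4 : ∀ a, a ≠ 3 * i → a ≠ 3 * i + 1 → a ≠ 3 * i + 2 → a ≠ E.MG + s → M₁ a = μ a := by
    intro a h0 h1 h2 h3
    rw [hM₁, Function.update_of_ne h3, Function.update_of_ne h2, Function.update_of_ne h1,
      Function.update_of_ne h0]
  clear_value M₁
  refine (relax_spec (s := s) hR₁ hheap (fun x hx => (c4 x (by omega) (by omega) (by omega)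
    (by omega)).trans (h.frame x hx)) e18 hs).wp ?_
  rintro _ t₂ r₂ ht₂ hr₂ ⟨M, rfl, hM, hrel⟩
  refine ⟨by simp only [Expr.cost, readAt]; omega, by omega, hR₁.update 30 _, by simp [e31], ?_⟩
  have hc : ∀ x < E.N.n, x ≠ s → M₁ (E.MG + x) = μ (E.MG + x) ∧ M₁ (E.PT + x) = μ (E.PT + x) :=
    fun x hx hxs => ⟨c4 _ (by omega) (by omega) (by omega) (by omega),
      c4 _ (by omega) (by omega) (by omega) (by omega)⟩
  have hupd : ∀ x < E.N.n, x ≠ s → μ (E.MG + x) ≠ 0 → μ (E.MG + x) < E.val μ₀ s x →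
      M (E.MG + x) = E.val μ₀ s x ∧ M (E.PT + x) = s := fun x hx hxs h0 hlt =>
    (hrel x hx).1 (by rw [(hc x hx hxs).1]; exact ⟨h0, hlt⟩)
  have hsame : ∀ x < E.N.n, x ≠ s → ¬ (μ (E.MG + x) ≠ 0 ∧ μ (E.MG + x) < E.val μ₀ s x) →
      M (E.MG + x) = μ (E.MG + x) ∧ M (E.PT + x) = μ (E.PT + x) := fun x hx hxs hn => by
    have := (hrel x hx).2 (by rw [(hc x hx hxs).1]; exact hn)
    rwa [(hc x hx hxs).1, (hc x hx hxs).2] at this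
  obtain ⟨ord', par', hinv, hold, ho, hp, hv⟩ := h.inv.step (w := s)
    (key' := fun x => M (E.MG + x)) (adj' := fun x => M (E.PT + x)) hpos hs
    (by rw [← hbs]; exact hb0) (fun x hx => (hb x hx).trans hbs.le)
    (((hrel s hs).2 (by simp [c3])).1.trans c3) hupd hsame
  · refine ⟨ord', par', ⟨fun x hx => ?_, hinv, fun j hj => ?_⟩⟩
    · rw [← h.frame x hx]
      exact (hM x (by omega) (by omega)).trans (c4 x (by omega) (by omega) (by omega) (by omega))
    · simp only
      rw [hM (3 * j) (by omega) (by omega), hM (3 * j + 1) (by omega) (by omega),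
        hM (3 * j + 2) (by omega) (by omega)]
      rcases Nat.lt_succ_iff_lt_or_eq.1 hj with hj | rfl
      · have hpl := h.inv.par_lt (j + 1) hj (by omega)
        rw [c4 (3 * j) (by omega) (by omega) (by omega) (by omega),
          c4 (3 * j + 1) (by omega) (by omega) (by omega) (by omega),
          c4 (3 * j + 2) (by omega) (by omega) (by omega) (by omega),
          (hold (j + 1) hj).1, (hold (j + 1) hj).2, (hold (par (j + 1)) (by omega)).1]
        exact h.out j hj
      · rw [c0, c1, c2, ho, hp, hv]
        exact ⟨rfl, rfl, hbs⟩

theorem prim_spec {E : Env} {V : ℕ → ℕ} {μ₀ : Mem} {tape : List ℕ} {H : ℕ}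
    (hR : E.Regs V) (hheap : E.HeapOK μ₀ H)
    (hpos : ∀ u < E.N.n, ∀ v < E.N.n, u ≠ v → 0 < E.val μ₀ u v) :
    Run E.w E.O primCmd ⟨V, μ₀, tape⟩ (400 * (E.N.n * E.N.n)) 0 fun σ =>
      ∃ ord par, E.Growing μ₀ ord par (E.N.n - 1) σ.mem := by
  obtain ⟨l1, l2, l3, l4, l5, l6, l7, l8, l9⟩ := E.layout
  refine wp_seq.2 (Run.wp (R := 0) (T := 30 * (E.N.n + 1)) (Run.fill (base := E.MG)
    (cnt := E.N.n) (E.val μ₀ 0) (by omega) ?_ ?_ ?_ ?_ (P := fun σ => σ = _) rfl) ?_)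
  · intro k M; simp [Expr.eval, hR.r6]
  · intro k M; simp [Expr.eval, hR.r0]
  · intro k hk
    exact eval_valExpr (by simp [hR.r0]) (by simp [hR.r9]) hheap
      (fun x hx => writeArr_of_ge (by omega)) (by omega) hk (by simp [Expr.eval])
      (by simp [Expr.eval])
  · simp [Expr.cost, valExpr, readAt]
  rintro _ t₁ r₁ ht₁ hr₁ rfl
  set μ₁ := writeArr μ₀ E.MG E.N.n (E.val μ₀ 0) with hμ₁
  have hk₁ : ∀ x < E.N.n, μ₁ (E.MG + x) = E.val μ₀ 0 x := fun x hx => writeArr_at hx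
  have hf₁ : ∀ a, ¬ (E.MG ≤ a ∧ a < E.MG + E.N.n) → μ₁ a = μ₀ a := fun a ha => if_neg ha
  clear_value μ₁
  refine wp_seq.2 (wp_store.2 ?_)
  have e6 : (Expr.var 6).eval E.w ⟨Function.update V 30 E.N.n, μ₁, tape⟩ = E.MG := by
    simp [Expr.eval, hR.r6]
  have e0 : (Expr.const 0).eval E.w ⟨Function.update V 30 E.N.n, μ₁, tape⟩ = 0 := by
    simp [Expr.eval]
  simp only [e6, e0]
  refine wp_seq.2 (Run.wp (R := 0) (T := 13 * (E.N.n + 1)) (Run.fill (base := E.PT)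
    (cnt := E.N.n) (fun _ => 0) (by omega) ?_ ?_ ?_ ?_ (P := fun σ => σ = _) rfl) ?_)
  · intro k M; simp [Expr.eval, hR.r5]
  · intro k M; simp [Expr.eval, hR.r0]
  · intro k hk; simp [Expr.eval]
  · simp [Expr.cost]
  rintro _ t₂ r₂ ht₂ hr₂ rfl
  rw [Function.update_idem]
  set μ₂ := writeArr (Function.update μ₁ E.MG 0) E.PT E.N.n (fun _ => 0) with hμ₂
  have hp₂ : ∀ x < E.N.n, μ₂ (E.PT + x) = 0 := fun x hx => writeArr_at hx
  have hf₂ : ∀ a, ¬ (E.PT ≤ a ∧ a < E.PT + E.N.n) → a ≠ E.MG → μ₂ a = μ₁ a := fun a ha ha' =>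
    (if_neg ha).trans (Function.update_of_ne ha' _ _)
  have hz₂ : μ₂ (E.MG + 0) = 0 := by
    rw [hμ₂, writeArr_of_ge (by omega), add_zero, Function.update_self]
  clear_value μ₂
  refine Run.wp (R := 0) (T := 180 * ((E.N.n + 1) * (E.N.n - 1 + 1))) (Run.for (cnt := E.N.n - 1)
    (P := fun σ => ∃ ord par, E.Growing μ₀ ord par (E.N.n - 1) σ.mem)
    (fun k σ => E.Regs σ.vars ∧ σ.vars 31 = k ∧ ∃ ord par, E.Growing μ₀ ord par k σ.mem)
    (fun _ => 160 * (E.N.n + 1)) (by omega) ?_ ?_ ?_ ?_ ?_) ?_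
  · refine ⟨(hR.update 30 _).update 31 _, by simp, fun _ => 0, fun _ => 0, fun x hx => ?_, ?_, by simp⟩
    · exact (hf₂ x (by omega) (by omega)).trans (hf₁ x (by omega))
    · refine PrimInv.init (by omega) hpos hz₂ (fun x hx hx0 => ?_) hp₂
      simp only
      rw [hf₂ _ (by omega) (by omega), hk₁ x hx]
  · rintro k hk ⟨V', M, tape'⟩ ⟨hR', h31, -⟩
    simp only at hR' h31
    refine ⟨?_, h31⟩
    simp (disch := omega) only [Expr.eval, hR'.r0, Nat.mod_eq_of_lt]
  · rintro k hk ⟨V', M, tape'⟩ ⟨hR', h31, ord, par, hG⟩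
    refine (grow_spec hR' hheap hpos hG h31 (by omega)).mono le_rfl le_rfl ?_
    rintro σ ⟨hR'', h31', ord', par', hG'⟩
    exact ⟨h31', hR''.update 31 _, by simp, ord', par', hG'⟩
  · simp only [Finset.sum_const, Finset.card_range, smul_eq_mul, Expr.cost]
    have h1 : (E.N.n - 1) * (160 * (E.N.n + 1)) ≤ 160 * ((E.N.n + 1) * (E.N.n - 1 + 1)) := by
      rw [mul_comm, mul_assoc]; gcongr; omega
    have h2 : E.N.n - 1 + 1 ≤ (E.N.n + 1) * (E.N.n - 1 + 1) := Nat.le_mul_of_pos_left _ (by omega)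
    omega
  · rintro σ ⟨-, -, h⟩; exact h
  · rintro σ t r ht hr h
    refine ⟨?_, by omega, h⟩
    rw [Nat.sub_add_cancel (by omega)] at ht
    have h1 : 2 * E.N.n ≤ E.N.n * E.N.n := Nat.mul_le_mul_right _ l9
    simp only [add_mul, one_mul] at ht
    simp only [Expr.cost]
    omega

end Env

/-- Builds the tree. -/
def treeAlgCmd : Cmd := .seq buildCmd primCmd

namespace Env

theorem treeAlg_spec {E : Env} (hS : E.Sound)
    (hspace : E.H0 + (E.N.n + 2) * (2 + 4 * (E.depth * E.N.n)) ≤ E.hmax) {tape : List ℕ} :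
    Run E.w E.O treeAlgCmd ⟨fun _ => 0, loadList E.inp, tape⟩
      (E.buildTime + 400 * (E.N.n * E.N.n)) (2 * (E.depth * E.N.n)) fun σ =>
      ∃ vl ord par key adj, PrimInv E.N.n vl ord par (E.N.n - 1) key adj ∧
      (∀ j < E.N.n - 1, σ.mem (3 * j) = ord (j + 1) ∧ σ.mem (3 * j + 1) = ord (par (j + 1)) ∧
        σ.mem (3 * j + 2) = vl (ord (par (j + 1))) (ord (j + 1))) ∧
      ∀ u < E.N.n, ∀ v < E.N.n, u ≠ v → E.N.lam u v ≤ vl u v ∧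
        vl u v * E.N.q ^ 2 ≤ (E.N.p + E.N.q) ^ 2 * E.N.lam u v := by
  refine Run.seq (build_spec hS hspace) ?_ (T₂ := 400 * (E.N.n * E.N.n)) (R₂ := 0) le_rfl le_rfl
  rintro ⟨V, μ, tape'⟩ ⟨H, h⟩
  have hlam : ∀ u < E.N.n, ∀ v < E.N.n, u ≠ v → E.N.lam u v ≤ E.val μ u v := by
    intro u hu v hv huv
    obtain ⟨h1, h2⟩ := h.cut hu hv huv
    simp only at h1 h2
    rw [h1]
    exact hS.lam_le _ hu hv h2
  refine (prim_spec h.regs h.heapOK fun u hu v hv huv =>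
    (E.N.lam_pos hu hv huv).trans_le (hlam u hu v hv huv)).mono le_rfl le_rfl ?_
  rintro σ ⟨ord, par, hG⟩
  exact ⟨_, ord, par, _, _, hG.inv, hG.out, fun u hu v hv huv => ⟨hlam u hu v hv huv,
    (h.done hu hv huv).2⟩⟩

end Env

/-! ### Minimum cuts -/

namespace CapGraph

variable {n m : ℕ} (G : CapGraph n m)

theorem Separates.symm {S : Set (Fin n)} {s t : Fin n} (h : Separates S s t) : Separates S t s :=
  fun h' => h h'.symm

theorem maxFlow_le {S : Set (Fin n)} {s t : Fin n} (h : Separates S s t) :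
    G.maxFlow s t ≤ G.cutCap S := Nat.sInf_le ⟨S, h, rfl⟩

theorem exists_minCut {s t : Fin n} (h : s ≠ t) :
    ∃ S : Set (Fin n), Separates S s t ∧ G.cutCap S = G.maxFlow s t :=
  Nat.sInf_mem (s := {x | ∃ S : Set (Fin n), Separates S s t ∧ G.cutCap S = x})
    ⟨_, {s}, by simp [Separates, h.symm], rfl⟩

theorem maxFlow_comm (s t : Fin n) : G.maxFlow s t = G.maxFlow t s := by
  unfold maxFlow
  congr 1
  ext x
  exact ⟨fun ⟨S, h, h'⟩ => ⟨S, h.symm, h'⟩, fun ⟨S, h, h'⟩ => ⟨S, h.symm, h'⟩⟩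

/-- In a minimum cut between `s` and `x`, the node `t` lies on one of the two sides. -/
theorem maxFlow_ultra {s t x : Fin n} (h : s ≠ x) :
    G.maxFlow s t ≤ G.maxFlow s x ∨ G.maxFlow t x ≤ G.maxFlow s x := by
  obtain ⟨S, hS, hc⟩ := G.exists_minCut h
  by_cases h1 : s ∈ S ↔ t ∈ S
  · right
    rw [← hc]
    exact G.maxFlow_le fun h2 => hS (h1.trans h2)
  · left
    rw [← hc]
    exact G.maxFlow_le h1

theorem cap_le_cutCap {S : Set (Fin n)} {i : Fin m} (h : Separates S (G.src i) (G.dst i)) :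
    G.cap i ≤ G.cutCap S := by
  unfold cutCap
  refine le_trans ?_ (Finset.single_le_sum (fun _ _ => Nat.zero_le _) (Finset.mem_univ i))
  rw [if_neg h]

theorem cutCap_le (S : Set (Fin n)) : G.cutCap S ≤ ∑ i, G.cap i := by
  unfold cutCap
  refine Finset.sum_le_sum fun i _ => ?_
  split_ifs <;> simp

theorem adj_iff {a b : Fin n} : G.graph.Adj a b ↔ ∃ i, s(G.src i, G.dst i) = s(a, b) := by
  simp only [graph, SimpleGraph.fromEdgeSet_adj, Set.mem_range]
  constructor
  · exact fun h => h.1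
  · rintro ⟨i, hi⟩
    refine ⟨⟨i, hi⟩, ?_⟩
    rintro rfl
    have := G.no_loop i
    simp only [Sym2.eq_iff] at hi
    rcases hi with ⟨h1, h2⟩ | ⟨h1, h2⟩ <;> exact this (h1.trans h2.symm)

/-- If no edge crossed the cut, membership in `S` would be constant along a walk from `s` to `t`. -/
theorem maxFlow_pos {s t : Fin n} (h : s ≠ t) : 0 < G.maxFlow s t := by
  obtain ⟨S, hS, hc⟩ := G.exists_minCut h
  obtain ⟨W⟩ := G.connected.preconnected s t
  have key : ∃ i, Separates S (G.src i) (G.dst i) := by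
    by_contra! hn
    have hadj : ∀ a b, G.graph.Adj a b → (a ∈ S ↔ b ∈ S) := by
      intro a b hab
      obtain ⟨i, hi⟩ := G.adj_iff.1 hab
      have := hn i
      simp only [Separates, not_not] at this
      simp only [Sym2.eq_iff] at hi
      rcases hi with ⟨rfl, rfl⟩ | ⟨rfl, rfl⟩
      · exact this
      · exact this.symm
    have : ∀ {a b : Fin n}, G.graph.Walk a b → (a ∈ S ↔ b ∈ S) := by
      intro a b W
      induction W with
      | nil => exact Iff.rfl
      | cons h _ ih => exact (hadj _ _ h).trans ih
    exact hS (this W)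
  obtain ⟨i, hi⟩ := key
  rw [← hc]
  exact (G.cap_pos i).trans_le (G.cap_le_cutCap hi)

theorem maxFlow_le_sum {s t : Fin n} (h : s ≠ t) : G.maxFlow s t ≤ ∑ i, G.cap i := by
  obtain ⟨S, -, hc⟩ := G.exists_minCut h
  rw [← hc]
  exact G.cutCap_le S

end CapGraph

/-! ### Maximum spanning trees -/

namespace Env.PrimInv

open CapGraph

/-- The relation between the index of a node and the one of its child. -/
def Child (n : ℕ) (par : ℕ → ℕ) (i j : ℕ) : Prop := 0 < j ∧ j < n ∧ par j = i

/-- `j` is a descendant of `i`. -/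
def Desc (n : ℕ) (par : ℕ → ℕ) : ℕ → ℕ → Prop := Relation.ReflTransGen (Child n par)

variable {n : ℕ} {vl : ℕ → ℕ → ℕ} {ord par key adj : ℕ → ℕ}

theorem Desc.le (hpar : ∀ j < n, 0 < j → par j < j) {i j : ℕ} (h : Desc n par i j) : i ≤ j := by
  induction h with
  | refl => exact le_rfl
  | tail _ h ih =>
    obtain ⟨h1, h2, rfl⟩ := h
    exact ih.trans (hpar _ h2 h1).le

theorem desc_par {i j : ℕ} (hj0 : 0 < j) (hj : j < n) (hij : j ≠ i) :
    Desc n par i j ↔ Desc n par i (par j) := by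
  unfold Desc
  rw [Relation.ReflTransGen.cases_tail_iff]
  constructor
  · rintro (h | ⟨c, h, -, -, rfl⟩)
    · exact absurd h hij
    · exact h
  · exact fun h => Or.inr ⟨_, h, hj0, hj, rfl⟩

/-- Some edge of the tree path between `a` and `b` crosses `S`, and it separates the two endpoints
in the tree. The path is followed by replacing the larger index by its parent; `N` is only the
measure of the induction. -/
theorem exists_desc (hpar : ∀ j < n, 0 < j → par j < j) {S : ℕ → Prop} :
    ∀ N a b, a + b = N → a < b → b < n → ¬ (S a ↔ S b) →
      ∃ i, 0 < i ∧ i < n ∧ ¬ (S i ↔ S (par i)) ∧ ¬ (Desc n par i a ↔ Desc n par i b) := by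
  intro N
  induction N using Nat.strong_induction_on with
  | _ N ih =>
    rintro a b rfl hab hb hS
    have hpb := hpar b hb (by omega)
    by_cases hSb : S b ↔ S (par b)
    · have hS' : ¬ (S a ↔ S (par b)) := fun h => hS (h.trans hSb.symm)
      have hne : a ≠ par b := fun h => hS' (by rw [h])
      obtain ⟨i, hi0, hi, hSi, hD⟩ : ∃ i, 0 < i ∧ i < n ∧ ¬ (S i ↔ S (par i)) ∧
          ¬ (Desc n par i a ↔ Desc n par i (par b)) := by
        rcases lt_or_gt_of_ne hne with h | h
        · exact ih (a + par b) (by omega) a (par b) rfl h (by omega) hS'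
        · obtain ⟨i, h1, h2, h3, h4⟩ := ih (par b + a) (by omega) (par b) a rfl h (by omega)
            fun h => hS' h.symm
          exact ⟨i, h1, h2, h3, fun h => h4 h.symm⟩
      refine ⟨i, hi0, hi, hSi, ?_⟩
      have hib : b ≠ i := by
        rintro rfl
        refine hD ⟨fun h => ?_, fun h => ?_⟩
        · have := Desc.le hpar h; omega
        · have := Desc.le hpar h; omega
      rwa [desc_par (by omega) hb hib]
    · refine ⟨b, by omega, hb, hSb, fun h => ?_⟩
      have := Desc.le hpar (h.2 Relation.ReflTransGen.refl)
      omega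

/-- The argument follows the tree path, keeping as invariant that all nodes attached after the
smaller endpoint, up to the larger one, came with an edge of weight at least `y`. One of the edges
on the path crosses `S`. -/
theorem exists_heavy (h : PrimInv n vl ord par (n - 1) key adj)
    {S : ℕ → Prop} {y : ℕ} : ∀ b a, a < b → b < n →
      (∀ j, a < j → j ≤ b → y ≤ vl (ord (par j)) (ord j)) → ¬ (S a ↔ S b) →
      ∃ i, 0 < i ∧ i < n ∧ ¬ (S i ↔ S (par i)) ∧ y ≤ vl (ord (par i)) (ord i) := by
  intro b
  induction b using Nat.strong_induction_on with
  | _ b ih =>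
    intro a hab hb hy hS
    have hpb := h.par_lt b (by omega) (by omega)
    by_cases hSb : S b ↔ S (par b)
    · have hS' : ¬ (S a ↔ S (par b)) := fun h => hS (h.trans hSb.symm)
      have hne : a ≠ par b := fun h => hS' (by rw [h])
      rcases lt_or_gt_of_ne hne with hlt | hlt
      · exact ih (par b) hpb a hlt (by omega) (fun j h1 h2 => hy j h1 (by omega)) hS'
      -- The parent of `b` precedes `a`. While the nodes up to `a` were attached, the edge from this
      -- parent to `b` was available, so each of them came with an edge at least as heavy.
      · refine ih a hab (par b) hlt (by omega) (fun j h1 h2 => ?_) fun h => hS' h.symm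
        refine (hy b hab le_rfl).trans (h.key_max j (by omega) (by omega) _ h1 _
          (h.ord_lt b (by omega)) fun c hc hcb => ?_)
        have := h.ord_inj c (by omega) b (by omega) hcb
        omega
    · exact ⟨b, by omega, hb, hSb, hy b hab le_rfl⟩

theorem exists_index (h : PrimInv n vl ord par (n - 1) key adj) (v : Fin n) :
    ∃ j < n, ord j = v := by
  let e : Fin n → Fin n := fun j => ⟨ord j, h.ord_lt j (by omega)⟩
  have he : Function.Injective e := by
    intro j j' hjj
    have := h.ord_inj j (by omega) j' (by omega) (by simpa [e] using hjj)
    exact Fin.ext this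
  obtain ⟨j, hj⟩ := Finite.injective_iff_surjective.1 he v
  exact ⟨j, j.2, by rw [← hj]⟩

/-- The tree with the edges between the nodes and their parents. -/
def tree (h : PrimInv n vl ord par (n - 1) key adj) (hn : 0 < n)
    (hpos : ∀ u < n, ∀ v < n, u ≠ v → 0 < vl u v) : CapGraph n (n - 1) where
  src i := ⟨ord (i + 1), h.ord_lt _ (by omega)⟩
  dst i := ⟨ord (par (i + 1)), h.ord_lt _ (by have := h.par_lt (i + 1) (by omega) (by omega); omega)⟩
  cap i := vl (ord (par (i + 1))) (ord (i + 1))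
  cap_pos i := by
    have hp := h.par_lt (i + 1) (by omega) (by omega)
    refine hpos _ (h.ord_lt _ (by omega)) _ (h.ord_lt _ (by omega)) fun he => ?_
    have := h.ord_inj _ (by omega) _ (by omega) he
    omega
  no_loop i he := by
    have hp := h.par_lt (i + 1) (by omega) (by omega)
    have := h.ord_inj _ (by omega) _ (by omega) (Fin.mk.inj_iff.1 he)
    omega
  no_parallel i j hij := by
    have hp := h.par_lt (i + 1) (by omega) (by omega)
    have hp' := h.par_lt (j + 1) (by omega) (by omega)
    simp only [Sym2.eq_iff, Fin.mk.injEq] at hij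
    rcases hij with ⟨h1, -⟩ | ⟨h1, h2⟩
    · have := h.ord_inj _ (by omega) _ (by omega) h1
      exact Fin.ext (by omega)
    · have h3 := h.ord_inj _ (by omega) _ (by omega) h1
      have h4 := h.ord_inj _ (by omega) _ (by omega) h2
      omega
  connected := by
    rw [SimpleGraph.connected_iff_exists_forall_reachable]
    refine ⟨⟨ord 0, h.ord_lt 0 (by omega)⟩, fun v => ?_⟩
    obtain ⟨j, hj, hjv⟩ := h.exists_index v
    have hv : v = ⟨ord j, h.ord_lt j (by omega)⟩ := Fin.ext hjv.symm
    rw [hv]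
    clear hjv hv
    induction j using Nat.strong_induction_on with
    | _ j ih =>
      rcases Nat.eq_zero_or_pos j with rfl | hj0
      · exact SimpleGraph.Reachable.refl _
      have hp := h.par_lt j (by omega) hj0
      refine (ih (par j) hp (by omega)).trans (SimpleGraph.Adj.reachable ?_)
      rw [SimpleGraph.fromEdgeSet_adj]
      refine ⟨⟨⟨j - 1, by omega⟩, ?_⟩, fun he => ?_⟩
      · simp only [Nat.sub_add_cancel hj0]
        exact Sym2.eq_swap
      · have := h.ord_inj _ (by omega) _ (by omega) (Fin.mk.inj_iff.1 he)
        omega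

/-- It is connected and has `n - 1` different edges. -/
theorem tree_isTree (h : PrimInv n vl ord par (n - 1) key adj) (hn : 0 < n)
    (hpos : ∀ u < n, ∀ v < n, u ≠ v → 0 < vl u v) : (h.tree hn hpos).graph.IsTree := by
  classical
  set T := h.tree hn hpos
  rw [SimpleGraph.isTree_iff_connected_and_card]
  refine ⟨T.connected, ?_⟩
  have he : T.graph.edgeSet = Set.range fun i => s(T.src i, T.dst i) := by
    ext e
    induction e using Sym2.ind with
    | _ a b => rw [SimpleGraph.mem_edgeSet, T.adj_iff]; rfl
  rw [he, Nat.card_range_of_injective T.no_parallel]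
  simp only [Nat.card_eq_fintype_card, Fintype.card_fin]
  omega

/-- When the nodes after `a` up to `b` were attached, `ord a` was in the tree and `ord b` was not,
so each came with weight at least `vl (ord a) (ord b)`. By `exists_heavy`, every tree cut between
the two contains such an edge. -/
theorem le_maxFlow_tree (h : PrimInv n vl ord par (n - 1) key adj) (hn : 0 < n)
    (hpos : ∀ u < n, ∀ v < n, u ≠ v → 0 < vl u v) {a b : ℕ} (hab : a < b) (hb : b < n) :
    vl (ord a) (ord b) ≤ (h.tree hn hpos).maxFlow ⟨ord a, h.ord_lt a (by omega)⟩
      ⟨ord b, h.ord_lt b (by omega)⟩ := by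
  have hne : (⟨ord a, h.ord_lt a (by omega)⟩ : Fin n) ≠ ⟨ord b, h.ord_lt b (by omega)⟩ := by
    intro he
    have := h.ord_inj a (by omega) b (by omega) (Fin.mk.inj_iff.1 he)
    omega
  obtain ⟨S, hS, hc⟩ := (h.tree hn hpos).exists_minCut hne
  obtain ⟨i, hi0, hi, hSi, hy⟩ := h.exists_heavy (S := fun j => ∃ hj : j < n,
    (⟨ord j, h.ord_lt j (by omega)⟩ : Fin n) ∈ S) (y := vl (ord a) (ord b)) b a hab hb
    (fun j h1 h2 => h.key_max j (by omega) (by omega) a h1 _ (h.ord_lt b (by omega)) fun c hc hcb => by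
      have := h.ord_inj c (by omega) b (by omega) hcb
      omega) (by
      intro hiff
      refine hS ⟨fun h' => ?_, fun h' => ?_⟩
      · exact (hiff.1 ⟨by omega, h'⟩).2
      · exact (hiff.2 ⟨by omega, h'⟩).2)
  have hp := h.par_lt i (by omega) hi0
  rw [← hc]
  have hcap := (h.tree hn hpos).cap_le_cutCap (S := S) (i := ⟨i - 1, by omega⟩) (by
    intro hiff
    simp only [tree, Nat.sub_add_cancel hi0] at hiff
    exact hSi ⟨fun ⟨_, h'⟩ => ⟨by omega, hiff.1 h'⟩, fun ⟨_, h'⟩ => ⟨by omega, hiff.2 h'⟩⟩)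
  simp only [tree, Nat.sub_add_cancel hi0] at hcap
  exact hy.trans hcap

/-- An edge of the tree path crosses `S`; removing it gives a cut of the tree, with the descendants
of its lower end as one side, whose capacity is the weight of that single edge. -/
theorem maxFlow_tree_le (h : PrimInv n vl ord par (n - 1) key adj) (hn : 0 < n)
    (hpos : ∀ u < n, ∀ v < n, u ≠ v → 0 < vl u v) {a b : ℕ} (hab : a < b) (hb : b < n)
    {S : Set (Fin n)} (hS : Separates S ⟨ord a, h.ord_lt a (by omega)⟩ ⟨ord b, h.ord_lt b (by omega)⟩) :
    ∃ u v : Fin n, Separates S u v ∧ (h.tree hn hpos).maxFlow ⟨ord a, h.ord_lt a (by omega)⟩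
      ⟨ord b, h.ord_lt b (by omega)⟩ ≤ vl u v := by
  obtain ⟨i, hi0, hi, hSi, hD⟩ := exists_desc (n := n) (par := par)
    (fun j hj hj0 => h.par_lt j (by omega) hj0) (S := fun j => ∃ hj : j < n,
    (⟨ord j, h.ord_lt j (by omega)⟩ : Fin n) ∈ S) _ a b rfl hab hb (by
      intro hiff
      refine hS ⟨fun h' => ?_, fun h' => ?_⟩
      · exact (hiff.1 ⟨by omega, h'⟩).2
      · exact (hiff.2 ⟨by omega, h'⟩).2)
  have hp := h.par_lt i (by omega) hi0
  -- The parent comes first because `vl` is not assumed symmetric and this is the order in which the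
  -- edge got its weight.
  refine ⟨⟨ord (par i), h.ord_lt _ (by omega)⟩, ⟨ord i, h.ord_lt i (by omega)⟩, fun hiff => hSi
    ⟨fun ⟨_, h'⟩ => ⟨by omega, hiff.2 h'⟩, fun ⟨_, h'⟩ => ⟨by omega, hiff.1 h'⟩⟩, ?_⟩
  set D : Set (Fin n) := {v | ∃ j < n, ord j = v ∧ Desc n par i j} with hDdef
  have hmem : ∀ j (hj : j < n), (⟨ord j, h.ord_lt j (by omega)⟩ : Fin n) ∈ D ↔ Desc n par i j := by
    intro j hj
    simp only [hDdef, Set.mem_ofPred_eq]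
    constructor
    · rintro ⟨j', hj', he, hd⟩
      rwa [← h.ord_inj j' (by omega) j (by omega) he]
    · exact fun hd => ⟨j, hj, rfl, hd⟩
  refine ((h.tree hn hpos).maxFlow_le (S := D) ?_).trans ?_
  · unfold Separates
    rwa [hmem a (by omega), hmem b hb]
  · classical
    unfold cutCap
    rw [Finset.sum_eq_single ⟨i - 1, by omega⟩]
    · simp only [tree, Nat.sub_add_cancel hi0]
      split_ifs <;> simp
    -- For a node other than `i`, either both the node and its parent descend from `i` or neither
    -- does, so its edge does not cross.
    · intro j _ hj
      have hj' : (j : ℕ) + 1 ≠ i := fun h' => hj (Fin.ext (by simp only; omega))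
      have hpj := h.par_lt (j + 1) (by omega) (by omega)
      rw [if_pos]
      simp only [tree]
      rw [hmem _ (by omega), hmem _ (by omega)]
      exact desc_par (by omega) (by omega) hj'
    · simp

end Env.PrimInv

/-! ### The graph on the machine -/

theorem List.getD_flatMap_three {α : Type*} (x y z : α → ℕ) (l : List α) (i : ℕ)
    (hi : i < l.length) :
    (l.flatMap fun a => [x a, y a, z a]).getD (3 * i) 0 = x l[i] ∧
    (l.flatMap fun a => [x a, y a, z a]).getD (3 * i + 1) 0 = y l[i] ∧
    (l.flatMap fun a => [x a, y a, z a]).getD (3 * i + 2) 0 = z l[i] := by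
  induction l generalizing i with
  | nil => simp at hi
  | cons a l ih =>
    cases i with
    | zero => simp
    | succ i =>
      have := ih i (by simpa using hi)
      simpa [Nat.mul_succ, List.flatMap_cons] using this

namespace CapGraph

variable {n m : ℕ} (G : CapGraph n m)

theorem edgeWords_length : G.edgeWords.length = 3 * m := by
  simp [edgeWords, List.length_flatMap, mul_comm]

theorem edgeWords_getD (i : Fin m) : G.edgeWords.getD (3 * i) 0 = G.src i ∧
    G.edgeWords.getD (3 * i + 1) 0 = G.dst i ∧ G.edgeWords.getD (3 * i + 2) 0 = G.cap i := by
  have := List.getD_flatMap_three (fun i => (G.src i : ℕ)) (fun i => (G.dst i : ℕ)) G.cap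
    (List.finRange m) i (by simp)
  simpa [edgeWords] using this

theorem loadList_inputWords (p q : ℕ) (i : Fin m) :
    loadList (G.inputWords p q) (4 + 3 * i) = G.src i ∧
    loadList (G.inputWords p q) (4 + 3 * i + 1) = G.dst i ∧
    loadList (G.inputWords p q) (4 + 3 * i + 2) = G.cap i := by
  have h := G.edgeWords_getD i
  have hl : ∀ j, loadList (G.inputWords p q) (4 + j) = G.edgeWords.getD j 0 := by
    intro j
    rw [add_comm]
    rfl
  refine ⟨(hl _).trans h.1, ?_, ?_⟩
  · rw [add_assoc]; exact (hl _).trans h.2.1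
  · rw [add_assoc]; exact (hl _).trans h.2.2

theorem edges_le (G : CapGraph n m) : m ≤ n * n := by
  have hinj : Function.Injective fun i => (G.src i, G.dst i) := by
    intro i j hij
    refine G.no_parallel ?_
    simp only [Prod.mk.injEq] at hij
    simp only [hij.1, hij.2]
  simpa using Fintype.card_le_of_injective _ hinj

/-- The sum of the capacities. -/
def total : ℕ := ∑ i, G.cap i

theorem total_le {κ : ℕ} (h : ∀ i, G.cap i ≤ n ^ κ) : G.total ≤ n ^ (κ + 2) := by
  calc G.total ≤ ∑ _i : Fin m, n ^ κ := Finset.sum_le_sum fun i _ => h i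
    _ = m * n ^ κ := by simp
    _ ≤ n * n * n ^ κ := Nat.mul_le_mul_right _ G.edges_le
    _ = n ^ (κ + 2) := by ring

/-- The minimum cut values as a function on the natural numbers. -/
noncomputable def flowValue (u v : ℕ) : ℕ :=
  if h : u < n ∧ v < n then G.maxFlow ⟨u, h.1⟩ ⟨v, h.2⟩ else 0

theorem flowValue_eq {u v : ℕ} (hu : u < n) (hv : v < n) :
    G.flowValue u v = G.maxFlow ⟨u, hu⟩ ⟨v, hv⟩ := dif_pos ⟨hu, hv⟩

/-- The minimum cut values of a graph. -/
noncomputable def net (p q : ℕ) (hq : 0 < q) : Net where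
  n := n
  tot := G.total
  p := p
  q := q
  lam := G.flowValue
  q_pos := hq
  lam_le hu hv huv := by
    rw [G.flowValue_eq hu hv]
    exact G.maxFlow_le_sum fun h => huv (Fin.mk.inj_iff.1 h)
  lam_pos hu hv huv := by
    rw [G.flowValue_eq hu hv]
    exact G.maxFlow_pos fun h => huv (Fin.mk.inj_iff.1 h)
  lam_symm u v := by
    unfold flowValue
    by_cases h : u < n ∧ v < n
    · rw [dif_pos h, dif_pos h.symm, G.maxFlow_comm]
    · rw [dif_neg h, dif_neg fun h' => h h'.symm]
  lam_ultra hu hv hx _ _ hux := by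
    rw [G.flowValue_eq hu hv, G.flowValue_eq hu hx, G.flowValue_eq hv hx]
    exact G.maxFlow_ultra fun h => hux (Fin.mk.inj_iff.1 h)

/-- The number of memory cells in use. -/
def space : ℕ :=
  10 + 6 * m + 6 * n + n * n + (n + 2) * (2 + 4 * (Nat.size G.total * n))

/-- The machine that works on a graph. -/
noncomputable def env (p q w tA : ℕ) (hq : 0 < q) (O : Subroutine) (ans : ℕ → ℕ → Mem)
    (hn : 2 ≤ n)
    (hcall : ∀ r v, r < n → v < n → r ≠ v →
      ∃ t ≤ tA, O (loadList (r :: v :: G.inputWords p q)) (ans r v) t)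
    (hw : 16 + G.space + n < 2 ^ w) (hw' : (G.total + 2) * (p + q + 1) < 2 ^ w) : Env where
  N := G.net p q hq
  m := m
  w := w
  tA := tA
  hmax := G.space
  inp := G.inputWords p q
  O := O
  ans := ans
  n_ge := hn
  inp_length := by simp [inputWords, G.edgeWords_length]; ring
  inp_zero := rfl
  inp_one := rfl
  inp_two := rfl
  inp_three := rfl
  src_lt i hi := by
    rw [(G.loadList_inputWords p q ⟨i, hi⟩).1]
    exact (G.src _).2
  dst_lt i hi := by
    rw [(G.loadList_inputWords p q ⟨i, hi⟩).2.1]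
    exact (G.dst _).2
  sum_cap := by
    rw [Finset.sum_range]
    exact Finset.sum_congr rfl fun i _ => (G.loadList_inputWords p q i).2.2
  call := hcall
  word := hw
  word_mul := hw'
  hmax_ge := by
    simp only [space, net]
    omega

variable {p q w tA : ℕ} {hq : 0 < q} {O : Subroutine} {ans : ℕ → ℕ → Mem} {hn : 2 ≤ n}
  {hcall : ∀ r v, r < n → v < n → r ≠ v →
      ∃ t ≤ tA, O (loadList (r :: v :: G.inputWords p q)) (ans r v) t}
  {hw : 16 + G.space + n < 2 ^ w} {hw' : (G.total + 2) * (p + q + 1) < 2 ^ w}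

theorem env_cutVal (S : ℕ → Prop) :
    (G.env p q w tA hq O ans hn hcall hw hw').cutVal S = G.cutCap {v | S v} := by
  unfold Env.cutVal cutCap
  rw [Finset.sum_range]
  refine Finset.sum_congr rfl fun i _ => ?_
  obtain ⟨h1, h2, h3⟩ := G.loadList_inputWords p q i
  have hiff : (S (loadList (G.inputWords p q) (4 + 3 * i)) ↔
      S (loadList (G.inputWords p q) (4 + 3 * i + 1))) ↔ (S (G.src i) ↔ S (G.dst i)) := by
    rw [h1, h2]
  by_cases h : S (G.src i) ↔ S (G.dst i)
  · exact (if_pos (hiff.2 h)).trans (if_pos h).symm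
  · exact (if_neg (hiff.not.2 h)).trans (h3.trans (if_neg h).symm)

theorem env_sound (hans : ∀ x y : Fin n, x ≠ y →
    G.IsApproxMinCut ((p : ℝ) / q) x y (storedSide n (ans x y) 0)) :
    (G.env p q w tA hq O ans hn hcall hw hw').Sound where
  sep {r v} hr hv hrv hiff := by
    refine (hans ⟨r, hr⟩ ⟨v, hv⟩ fun h => hrv (Fin.mk.inj_iff.1 h)).1 ?_
    simp only [storedSide, Set.mem_ofPred_eq, zero_add]
    exact hiff.symm
  cap {r v} hr hv hrv := by
    have h := (hans ⟨r, hr⟩ ⟨v, hv⟩ fun h => hrv (Fin.mk.inj_iff.1 h)).2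
    rw [G.env_cutVal]
    have hs : storedSide n (ans r v) 0 = {x : Fin n | ans r v x ≠ 0} := by
      simp only [storedSide, zero_add]
    simp only [hs] at h
    change q * G.cutCap {x : Fin n | ans r v x ≠ 0} ≤ (p + q) * G.flowValue r v
    rw [G.flowValue_eq hr hv]
    have hq' : (0 : ℝ) < q := by exact_mod_cast hq
    have h' := mul_le_mul_of_nonneg_left h hq'.le
    have he : (q : ℝ) * ((1 + (p : ℝ) / q) * G.maxFlow ⟨r, hr⟩ ⟨v, hv⟩) =
        (p + q) * G.maxFlow ⟨r, hr⟩ ⟨v, hv⟩ := by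
      field_simp
      ring
    rw [he] at h'
    exact_mod_cast h'
  lam_le S {u v} hu hv h := by
    rw [G.env_cutVal]
    change G.flowValue u v ≤ _
    rw [G.flowValue_eq hu hv]
    exact G.maxFlow_le h

theorem le_of_sq_bound (hq : 0 < q) {x l : ℕ} {ε : ℝ} (hε : (1 + (p : ℝ) / q) ^ 2 ≤ 1 + ε)
    (h : x * q ^ 2 ≤ (p + q) ^ 2 * l) : (x : ℝ) ≤ (1 + ε) * l := by
  have hq' : (0 : ℝ) < q := by exact_mod_cast hq
  have h' : (x : ℝ) * q ^ 2 ≤ (p + q) ^ 2 * l := by exact_mod_cast h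
  refine le_trans ?_ (mul_le_mul_of_nonneg_right hε (Nat.cast_nonneg l))
  have he : (1 + (p : ℝ) / q) ^ 2 * l = (p + q) ^ 2 * l / q ^ 2 := by
    field_simp
    ring
  rw [he, le_div_iff₀ (by positivity)]
  exact h'

/-- The tree of an execution of Prim's algorithm on approximate minimum cut values. -/
theorem holdsFlowTree_of_primInv {ε : ℝ} (hε : 0 ≤ 1 + ε) {vl : ℕ → ℕ → ℕ} {ord par key adj : ℕ → ℕ}
    {M : Mem} (h : Env.PrimInv n vl ord par (n - 1) key adj) (hn : 2 ≤ n)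
    (hM : ∀ j < n - 1, M (3 * j) = ord (j + 1) ∧ M (3 * j + 1) = ord (par (j + 1)) ∧
      M (3 * j + 2) = vl (ord (par (j + 1))) (ord (j + 1)))
    (hlow : ∀ s t : Fin n, s ≠ t → G.maxFlow s t ≤ vl s t)
    (hupp : ∀ s t : Fin n, s ≠ t → (vl s t : ℝ) ≤ (1 + ε) * G.maxFlow s t) :
    HoldsFlowTree G ε M := by
  have hpos : ∀ u < n, ∀ v < n, u ≠ v → 0 < vl u v := fun u hu v hv huv => by
    have hne : (⟨u, hu⟩ : Fin n) ≠ ⟨v, hv⟩ := fun h => huv (Fin.mk.inj_iff.1 h)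
    exact (G.maxFlow_pos hne).trans_le (hlow _ _ hne)
  set T := h.tree (by omega) hpos with hT
  have key : ∀ a b (hab : a < b) (hb : b < n),
      (G.maxFlow ⟨ord a, h.ord_lt a (by omega)⟩ ⟨ord b, h.ord_lt b (by omega)⟩ : ℝ) ≤
        T.maxFlow ⟨ord a, h.ord_lt a (by omega)⟩ ⟨ord b, h.ord_lt b (by omega)⟩ ∧
      (T.maxFlow ⟨ord a, h.ord_lt a (by omega)⟩ ⟨ord b, h.ord_lt b (by omega)⟩ : ℝ) ≤
        (1 + ε) *
          G.maxFlow ⟨ord a, h.ord_lt a (by omega)⟩ ⟨ord b, h.ord_lt b (by omega)⟩ := by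
    intro a b hab hb
    have hne : (⟨ord a, h.ord_lt a (by omega)⟩ : Fin n) ≠ ⟨ord b, h.ord_lt b (by omega)⟩ := by
      intro he
      have := h.ord_inj a (by omega) b (by omega) (Fin.mk.inj_iff.1 he)
      omega
    constructor
    · exact_mod_cast (hlow _ _ hne).trans (h.le_maxFlow_tree (by omega) hpos hab hb)
    · obtain ⟨S, hS, hc⟩ := G.exists_minCut hne
      obtain ⟨u, v, hS', hle⟩ := h.maxFlow_tree_le (by omega) hpos hab hb hS
      have huv : u ≠ v := by
        rintro rfl
        exact hS' Iff.rfl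
      -- `S` is a minimum cut of `G` for the given pair and also separates the ends `u`, `v` of a
      -- tree edge, so it bounds their minimum cut value.
      calc (T.maxFlow _ _ : ℝ) ≤ vl u v := by exact_mod_cast hle
        _ ≤ (1 + ε) * G.maxFlow u v := hupp _ _ huv
        _ ≤ (1 + ε) * G.cutCap S := by
          refine mul_le_mul_of_nonneg_left ?_ hε
          exact_mod_cast G.maxFlow_le hS'
        _ = _ := by rw [hc]
  refine ⟨T, ⟨h.tree_isTree (by omega) hpos, fun s t hst => ?_⟩, fun i hi => ?_⟩
  · obtain ⟨a, ha, has⟩ := h.exists_index s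
    obtain ⟨b, hb, hbt⟩ := h.exists_index t
    have hs : s = ⟨ord a, h.ord_lt a (by omega)⟩ := Fin.ext has.symm
    have ht : t = ⟨ord b, h.ord_lt b (by omega)⟩ := Fin.ext hbt.symm
    rcases lt_trichotomy a b with hab | hab | hab
    · rw [hs, ht]
      exact key a b hab hb
    · subst hab
      exact absurd (hs.trans ht.symm) hst
    · rw [hs, ht, G.maxFlow_comm, T.maxFlow_comm]
      exact key b a hab ha
  · rw [edgeWords_length] at hi
    have hj : i / 3 < n - 1 := by omega
    obtain ⟨h1, h2, h3⟩ := T.edgeWords_getD ⟨i / 3, hj⟩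
    obtain ⟨h1', h2', h3'⟩ := hM _ hj
    have hi' : i = 3 * (i / 3) ∨ i = 3 * (i / 3) + 1 ∨ i = 3 * (i / 3) + 2 := by omega
    rcases hi' with hi' | hi' | hi' <;> rw [hi']
    · rw [h1, h1']; rfl
    · rw [h2, h2']; rfl
    · rw [h3, h3']; rfl

end CapGraph

theorem WordRAM.prob_of_forall {w T : ℕ} {good : List ℕ → Prop} (h : ∀ ρ, good ρ) :
    prob w T good = 1 := by
  unfold prob
  have : {ρ : Fin T → Fin (2 ^ w) | good (List.ofFn fun i => (ρ i : ℕ))} = Set.univ :=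
    Set.eq_univ_of_forall fun _ => h _
  rw [this, Set.ncard_univ, Nat.card_eq_fintype_card]
  simp

theorem WordRAM.prob_nonneg {w T : ℕ} {good : List ℕ → Prop} : 0 ≤ prob w T good :=
  div_nonneg (Nat.cast_nonneg _) (by positivity)

/-! ### Numerical bounds on words, space and time -/

namespace CapGraph

variable {n m : ℕ} (G : CapGraph n m)

theorem size_total_le {κ : ℕ} (h : ∀ i, G.cap i ≤ n ^ κ) :
    Nat.size G.total ≤ (κ + 2) * (Nat.log 2 n + 1) := by
  rw [Nat.size_le]
  calc G.total ≤ n ^ (κ + 2) := G.total_le h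
    _ < (2 ^ (Nat.log 2 n + 1)) ^ (κ + 2) :=
      Nat.pow_lt_pow_left (Nat.lt_pow_succ_log_self (by norm_num) n) (by omega)
    _ = 2 ^ ((κ + 2) * (Nat.log 2 n + 1)) := by rw [← pow_mul, mul_comm]

theorem total_pos (hn : 2 ≤ n) : 0 < G.total :=
  have hne : (⟨0, by omega⟩ : Fin n) ≠ ⟨1, by omega⟩ := by simp
  (G.maxFlow_pos hne).trans_le (G.maxFlow_le_sum hne)

theorem space_le (hn : 2 ≤ n) : G.space ≤ 40 * Nat.size G.total * n ^ 2 := by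
  have hm := G.edges_le
  have hd := Nat.size_pos.2 (G.total_pos hn)
  unfold space
  set d := Nat.size G.total
  have h1 : n * n ≤ d * (n * n) := Nat.le_mul_of_pos_left _ hd
  have h2 : 2 * n ≤ n * n := Nat.mul_le_mul_right _ hn
  have h3 : d * (2 * n) ≤ d * (n * n) := Nat.mul_le_mul_left _ h2
  have h4 : (n + 2) * (2 + 4 * (d * n)) = 2 * n + 4 + 4 * (d * (n * n)) + 4 * (d * (2 * n)) := by
    ring
  have h5 : 40 * d * n ^ 2 = 40 * (d * (n * n)) := by ring
  rw [h4, h5]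
  omega

/-- With `X = n + p + q ≥ 3`, everything is a power of `X`: the factor `κ + 2` is below `2 ^ (κ + 2)
≤ X ^ (κ + 2)`, the logarithm is at most `X`, and the constant `58` is below `3 ^ 5 ≤ X ^ 5`. The
exponent `β + κ + 20` is generous. -/
theorem word_bounds {κ β p q w : ℕ} (hcap : ∀ i, G.cap i ≤ n ^ κ) (hn : 2 ≤ n) (hq : 0 < q)
    (hw : (n + p + q) ^ (β + κ + 20) ≤ 2 ^ w) :
    (n + p + q) ^ β ≤ 2 ^ w ∧ 16 + G.space + n < 2 ^ w ∧
      (G.total + 2) * (p + q + 1) < 2 ^ w := by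
  have hX : 3 ≤ n + p + q := by omega
  have hnX : n ≤ n + p + q := by omega
  have hpX : p + q + 1 ≤ n + p + q := by omega
  set X := n + p + q
  have htot : G.total ≤ X ^ (κ + 2) := (G.total_le hcap).trans (Nat.pow_le_pow_left hnX _)
  have hpow : ∀ a, a ≤ β + κ + 20 → X ^ a ≤ 2 ^ w := fun a ha =>
    (Nat.pow_le_pow_right (by omega) ha).trans hw
  have hκ : κ + 2 ≤ X ^ (κ + 2) :=
    (Nat.lt_pow_self (by norm_num : 1 < 2)).le.trans (Nat.pow_le_pow_left (by omega) _)
  have hlog : Nat.log 2 n + 1 ≤ X := (Nat.log_lt_self 2 (by omega)).trans_le hnX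
  have hd : Nat.size G.total ≤ X ^ (κ + 2) * X :=
    (G.size_total_le hcap).trans (Nat.mul_le_mul hκ hlog)
  have hn2 : n ^ 2 ≤ X ^ 2 := Nat.pow_le_pow_left hnX _
  refine ⟨hpow β (by omega), ?_, ?_⟩
  · refine lt_of_lt_of_le ?_ (hpow (κ + 10) (by omega))
    have h1 : 16 + 40 * Nat.size G.total * n ^ 2 + n ≤ 58 * X ^ (κ + 5) := by
      have h2 : 40 * Nat.size G.total * n ^ 2 ≤ 40 * (X ^ (κ + 2) * X) * X ^ 2 :=
        Nat.mul_le_mul (Nat.mul_le_mul_left _ hd) hn2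
      have h3 : 40 * (X ^ (κ + 2) * X) * X ^ 2 = 40 * X ^ (κ + 5) := by ring
      have h4 : X ≤ X ^ (κ + 5) := Nat.le_self_pow (by omega) X
      have h5 : 1 ≤ X ^ (κ + 5) := Nat.one_le_pow _ _ (by omega)
      omega
    have h6 : 3 ^ 5 ≤ X ^ 5 := Nat.pow_le_pow_left hX 5
    have h7 : 0 < X ^ (κ + 5) := by positivity
    calc 16 + G.space + n ≤ 58 * X ^ (κ + 5) := by have := G.space_le hn; omega
      _ < X ^ 5 * X ^ (κ + 5) := Nat.mul_lt_mul_of_pos_right (by omega) h7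
      _ = X ^ (κ + 10) := by ring
  · refine lt_of_lt_of_le ?_ (hpow (κ + 4) (by omega))
    have h1 : 9 ≤ X ^ (κ + 2) := le_trans (by norm_num : 9 ≤ 3 ^ 2)
      ((Nat.pow_le_pow_left hX 2).trans (Nat.pow_le_pow_right (by omega) (by omega)))
    have h2 : 0 < X ^ (κ + 2) := by omega
    calc (G.total + 2) * (p + q + 1) ≤ (2 * X ^ (κ + 2)) * X :=
          Nat.mul_le_mul (by omega) hpX
      _ < (X * X ^ (κ + 2)) * X := 
          Nat.mul_lt_mul_of_pos_right (Nat.mul_lt_mul_of_pos_right (by omega) h2) (by omega)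
      _ = X ^ (κ + 4) := by ring

/-- Since `n + m ≤ t`, the quadratic bookkeeping is dominated by `n * t`, and the number of digits
`d ≥ 1` by `(κ + 2) * (log n + 1)`; the logarithm of the total capacity is the only polylogarithmic
factor. -/
theorem time_le {t κ : ℕ} (hcap : ∀ i, G.cap i ≤ n ^ κ) (hn : 2 ≤ n) (ht : n + m ≤ t) :
    600 * (n * n + m + 1) + (2 * t + 2300 * (n + m + 1)) * (Nat.size G.total * n) +
      80 * (Nat.size G.total * (n * n)) + 400 * (n * n) + 3 ≤
      7000 * (κ + 2) * n * t * (Nat.log 2 n + 1) := by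
  have hd := Nat.size_pos.2 (G.total_pos hn)
  have hs := G.size_total_le hcap
  set d := Nat.size G.total
  have h1 : n * n ≤ n * t := Nat.mul_le_mul_left _ (by omega)
  have h2 : t ≤ n * t := Nat.le_mul_of_pos_left _ (by omega)
  have h3 : n * t ≤ d * (n * t) := Nat.le_mul_of_pos_left _ hd
  have h4 : d * (n * n) ≤ d * (n * t) := Nat.mul_le_mul_left _ h1
  have h5 : (2 * t + 2300 * (n + m + 1)) * (d * n) ≤ (4602 * t) * (d * n) :=
    Nat.mul_le_mul_right _ (by omega)
  have h6 : (4602 * t) * (d * n) = 4602 * (d * (n * t)) := by ring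
  calc _ ≤ 7000 * (d * (n * t)) := by omega
    _ ≤ 7000 * ((κ + 2) * (Nat.log 2 n + 1) * (n * t)) :=
      Nat.mul_le_mul_left _ (Nat.mul_le_mul_right _ hs)
    _ = _ := by ring

end CapGraph

/-! ### The theorem -/

theorem theorem2p2 :
    ∃ treeAlg cutAlg queryAlg : Cmd, ∀ κ β c : ℕ, ∃ β' C k : ℕ,
      ∀ (A : Cmd) (p q : ℕ) (ε : ℝ) (t : ℕ → ℕ → ℕ), 0 < q →
        (1 + (p : ℝ) / q) ^ 2 ≤ 1 + ε →
        (∀ n m, n + m ≤ t n m) →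
        IsOfflineMinCutAlg A κ β p q t →
        ∀ (n m : ℕ) (G : CapGraph n m) (w T polylog : ℕ),
          (∀ i, G.cap i ≤ n ^ κ) → (n + p + q) ^ β' ≤ 2 ^ w →
          polylog = (Nat.log 2 n + 1) ^ k →
          T = C * n * t n m * polylog →
          (1 - 1 / (n : ℝ) ^ c ≤ prob w T fun ρ =>
            ∃ (M : Mem) (time calls : ℕ),
              RunsTo w A treeAlg (G.inputWords p q) ρ M time calls ∧
              time ≤ T ∧ calls ≤ C * n * polylog ∧
              HoldsFlowTree G ε M) ∧
          (1 - 1 / (n : ℝ) ^ c ≤ prob w T fun ρ =>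
            ∃ (M : Mem) (time calls : ℕ),
              RunsTo w A cutAlg (G.inputWords p q) ρ M time calls ∧
              time ≤ T ∧ calls ≤ C * n * polylog ∧
              HoldsCutStructure G ε w queryAlg
                (C * n ^ 2 * polylog) (C * n * polylog) (C * polylog) M) := by
  -- `β'` covers the words that `A` needs and all addresses; `k = 1` because a single logarithm
  -- occurs, and `C` carries the `κ + 2` from `tot ≤ n ^ (κ + 2)`.
  refine ⟨treeAlgCmd, cutAlgCmd, lookupCmd, fun κ β c => ⟨β + κ + 20, 7000 * (κ + 2), 1, ?_⟩⟩
  intro A p q ε t hq hε ht hA n m G w T polylog hcap hw hpoly hT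
  rw [pow_one] at hpoly
  have hn0 : 0 < n := by
    have := G.connected.nonempty
    exact Fin.pos_iff_nonempty.2 this
  rcases Nat.lt_or_ge n 2 with hn1 | hn
  -- With a single node the required probability `1 - 1 / 1 ^ c` vanishes.
  · obtain rfl : n = 1 := by omega
    have h0 : (1 : ℝ) - 1 / ((1 : ℕ) : ℝ) ^ c = 0 := by simp
    rw [h0]
    exact ⟨prob_nonneg, prob_nonneg⟩
  obtain ⟨hw1, hw2, hw3⟩ := G.word_bounds hcap hn hq hw
  -- One run of `A` is fixed for every query, so that the answers form a function; for invalid pairs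
  -- any memory will do.
  have hex : ∀ r v : ℕ, ∃ M : Mem, ∀ (hr : r < n) (hv : v < n), r ≠ v →
      (∃ s ≤ t n m, asSubroutine w A (loadList (r :: v :: G.inputWords p q)) M s) ∧
      G.IsApproxMinCut ((p : ℝ) / q) ⟨r, hr⟩ ⟨v, hv⟩ (storedSide n M 0) := by
    intro r v
    by_cases h : r < n ∧ v < n ∧ r ≠ v
    · obtain ⟨M, s, h1, h2, h3⟩ := hA n m G w hcap hw1 ⟨r, h.1⟩ ⟨v, h.2.1⟩
        fun he => h.2.2 (Fin.mk.inj_iff.1 he)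
      exact ⟨M, fun _ _ _ => ⟨⟨s, h2, h1⟩, h3⟩⟩
    · exact ⟨fun _ => 0, fun hr hv hrv => absurd ⟨hr, hv, hrv⟩ h⟩
  choose ans hans using hex
  let E := G.env p q w (t n m) hq (asSubroutine w A) ans hn
    (fun r v hr hv hrv => (hans r v hr hv hrv).1) hw2 hw3
  have hS : E.Sound := G.env_sound fun x y hxy =>
    (hans x y x.2 y.2 fun h => hxy (Fin.ext h)).2
  have hH0 : E.H0 = 10 + 6 * m + 6 * n + n * n := by
    simp only [Env.H0, Env.PR, Env.LA, Env.MG, Env.PT, Env.AB, E, CapGraph.env, CapGraph.net]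
    ring
  have hspace : E.H0 + (E.N.n + 2) * (2 + 4 * (E.depth * E.N.n)) ≤ E.hmax := by
    rw [hH0]
    exact le_rfl
  have hd := Nat.size_pos.2 (G.total_pos hn)
  have hs := G.size_total_le hcap
  have htime := G.time_le hcap hn (ht n m)
  have hbuild : E.buildTime = 600 * (n * n + m + 1) +
      (2 * t n m + 2300 * (n + m + 1)) * (Nat.size G.total * n) +
      80 * (Nat.size G.total * (n * n)) := rfl
  rw [← hpoly] at htime hs
  rw [← hT, ← hbuild] at htime
  have hcuts : 2 + 4 * (Nat.size G.total * n) ≤ 7000 * (κ + 2) * n * polylog := by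
    have h1 : n ≤ Nat.size G.total * n := Nat.le_mul_of_pos_left _ hd
    calc 2 + 4 * (Nat.size G.total * n) ≤ 7000 * (Nat.size G.total * n) := by omega
      _ ≤ 7000 * ((κ + 2) * polylog * n) :=
        Nat.mul_le_mul_left _ (Nat.mul_le_mul_right _ hs)
      _ = _ := by ring
  have hsize : G.space ≤ 7000 * (κ + 2) * n ^ 2 * polylog := by
    calc G.space ≤ 40 * Nat.size G.total * n ^ 2 := G.space_le hn
      _ ≤ 7000 * ((κ + 2) * polylog) * n ^ 2 :=
        Nat.mul_le_mul_right _ (Nat.mul_le_mul (by norm_num) hs)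
      _ = _ := by ring
  have hone : 1 - 1 / (n : ℝ) ^ c ≤ 1 := by
    have : 0 ≤ 1 / (n : ℝ) ^ c := by positivity
    linarith
  constructor
  · rw [prob_of_forall]
    · exact hone
    intro ρ
    obtain ⟨σ, s, r, hrun, hs1, hr1, vl, ord, par, key, adj, hprim, hmem, hval⟩ :=
      Env.treeAlg_spec hS hspace (tape := ρ)
    refine ⟨σ.mem, s, r, ⟨σ, hrun, rfl⟩, hs1.trans ?_, hr1.trans ?_, ?_⟩
    · change E.buildTime + 400 * (n * n) ≤ T
      omega
    · change 2 * (Nat.size G.total * n) ≤ _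
      omega
    · have hε' : 0 ≤ 1 + ε := (sq_nonneg _).trans hε
      refine G.holdsFlowTree_of_primInv hε' hprim hn hmem (fun x y hxy => ?_) fun x y hxy => ?_
      · have h := (hval x x.2 y y.2 fun h => hxy (Fin.ext h)).1
        exact (G.flowValue_eq x.2 y.2).symm.trans_le h
      · have h := (hval x x.2 y y.2 fun h => hxy (Fin.ext h)).2
        refine CapGraph.le_of_sq_bound hq hε (h.trans_eq ?_)
        exact congrArg _ (G.flowValue_eq x.2 y.2)
  · rw [prob_of_forall]
    · exact hone
    intro ρ
    obtain ⟨σ, s, r, hrun, hs1, hr1, K, hK, hcut⟩ := Env.cutAlg_spec hS hspace (tape := ρ)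
    refine ⟨σ.mem, s, r, ⟨σ, hrun, rfl⟩, hs1.trans ?_, hr1.trans ?_, ?_⟩
    · omega
    · change 2 * (Nat.size G.total * n) ≤ _
      omega
    · have hK' : K ≤ 2 + 4 * (Nat.size G.total * n) := by
        rw [hH0] at hK
        have h : (n + 2) * K ≤ (n + 2) * (2 + 4 * (Nat.size G.total * n)) :=
          Nat.le_of_add_le_add_left hK
        exact Nat.le_of_mul_le_mul_left h (by omega)
      refine ⟨E.H0 + (n + 2) * K, (Finset.range K).image fun k => E.H0 + (n + 2) * k + 2,
        le_trans hK hsize, ?_, ?_, ?_⟩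
      · refine Finset.card_image_le.trans ?_
        rw [Finset.card_range]
        exact hK'.trans hcuts
      · intro j hj
        obtain ⟨k, hk, rfl⟩ := Finset.mem_image.1 hj
        have h : (n + 2) * (k + 1) ≤ (n + 2) * K :=
          Nat.mul_le_mul_left _ (Finset.mem_range.1 hk)
        rw [Nat.mul_succ] at h
        omega
      · intro x y hxy
        obtain ⟨k, hk, ⟨s', hs', hquery⟩, hsep, hval⟩ :=
          hcut x x.2 y y.2 fun h => hxy (Fin.ext h)
        refine ⟨_, Finset.mem_image_of_mem _ (Finset.mem_range.2 hk), s', hs'.trans ?_, hquery,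
          hsep, ?_⟩
        · have h : 1 ≤ (κ + 2) * polylog := le_trans hd hs
          calc 20 ≤ 7000 * ((κ + 2) * polylog) := by omega
            _ = _ := by ring
        · have h := G.env_cutVal (p := p) (q := q) (tA := t n m) (hq := hq)
            (O := asSubroutine w A) (ans := ans) (hn := hn)
            (hcall := fun r v hr hv hrv => (hans r v hr hv hrv).1) (hw := hw2) (hw' := hw3)
            (Env.side σ.mem (E.H0 + (n + 2) * k))
          refine CapGraph.le_of_sq_bound hq hε ?_
          refine (congrArg (· * q ^ 2) h.symm).trans_le (hval.trans_eq ?_)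
          exact congrArg _ (G.flowValue_eq x.2 y.2)
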